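/- Let $p$ be a prime, $G=\mathrm{GL}(2,\mathbb{Q}_p)$, $B\subset G$ the upper triangular matrices, $|\cdot|$ the absolute value with $|p|=p^{-1}$, and $\psi$ an unramified additive character of $\mathbb{Q}_p$ (trivial on $\mathbb{Z}_p$ but not on $p^{-1}\mathbb{Z}_p$). For unitary characters $\chi_1,\chi_2$ of $\mathbb{Q}_p^\times$ let $\chi_1\boxplus\chi_2$ be the unitary principal series representation of $G$ by right translation on the smooth functions $f:G\to\mathbb{C}$ with $f\left(\begin{pmatrix}a&x\\0&d\end{pmatrix}g\right)=\chi_1(a)\chi_2(d)|a/d|^{1/2}f(g)$. A character of $\mathbb{Q}_p^\times$ has conductor $p^c$ if $c\ge 0$ is the least integer for which it is trivial on $\mathbb{Z}_p^\times\cap(1+p^c\mathbb{Z}_p)$; it is unramified if $c=0$. The conductor of a representation $\pi$ is $p^{c(\pi)}$, where $c(\pi)$ is the least $r\ge 0$ such that $\pi$ has a nonzero vector fixed by all $\begin{pmatrix}a&b\\c&d\end{pmatrix}\in\mathrm{GL}(2,\mathbb{Z}_p)$ with $c\equiv 0$ and $d\equiv 1$ modulo $p^r$; such a vector for $r=c(\pi)$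 is called a newvector. $\pi$ is twist-minimal if $c(\pi\otimes\eta)\ge c(\pi)$ for every character $\eta$ of $\mathbb{Q}_p^\times$. A newvector in the Whittaker model of $\pi$ is a function $W_\circ(g)=\Lambda(\pi(g)v)$, where $v$ is a newvector of $\pi$ and $\Lambda$ is a nonzero linear functional on $\pi$ with $\Lambda\left(\pi\begin{pmatrix}1&x\\0&1\end{pmatrix}v'\right)=\psi(x)\Lambda(v')$ for all $x\in\mathbb{Q}_p$ and all $v'$. It is normalized if $W_\circ(\mathbf e)=1$, where $\mathbf e$ is the identity matrix, and $h(\pi):=\max_{g\in G}|W_\circ(g)|$ for the normalized $W_\circ$. Put $a(y)=\begin{pmatrix}y&0\\0&1\end{pmatrix}$, $\mathbf k_1=\begin{pmatrix}p&0\\p&1\end{pmatrix}$, and let $I_2$ be the group of $\begin{pmatrix}a&b\\c&d\end{pmatrix}\in\mathrm{GL}(2,\mathbb{Z}_p)$ with $p^2\mid c$. 1. Let $\pi$ be a twist-minimal unitary principal series representation of $G$ of conductor $p^2$. There is exactly one normalized newvector in its Whittaker model. Every newvector $W_\circ$ in the Whittaker model satisfies $W_\circ(\mathbf e)\neq 0$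 and $$\max_{g\in G}|W_\circ(g)|=p^{1/2}|W_\circ(\mathbf e)|,$$ the maximum being attained at some point of the double coset $B\mathbf k_1I_2$. In particular $h(\pi)=p^{1/2}$. 2. If $\chi_1,\chi_2$ are unitary characters of $\mathbb{Q}_p^\times$, $\chi_1$ is unramified and $\chi_2$ has conductor $p^2$, then $h(\chi_1\boxplus\chi_2)=p^{1/2}$. 3. Let $\chi$ be a unitary character of $\mathbb{Q}_p^\times$ of conductor $p^2$ and $W_\circ$ the (unique) normalized newvector in the Whittaker model of $\mathbf 1\boxplus\chi$. There exists $y\in p^{-2}\mathbb{Z}_p^\times$ such that $$\chi(1-z)=\psi(yz)\quad\text{for all } z\in p\mathbb{Z}_p .$$ For every such $y$, $W_\circ(a(y)\mathbf k_1)=p^{1/2}$; for every other $y\in\mathbb{Q}_p^\times$, $W_\circ(a(y)\mathbf k_1)=0$. -/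

import Mathlib

open Matrix

noncomputable section

namespace GLTwo

variable (p : ℕ) [Fact p.Prime]

/-- The group `GL(2, ℚ_p)`, with its usual topology. -/
abbrev G : Type := GL (Fin 2) ℚ_[p]

/-- Quasi-characters of `ℚ_p^×`: continuous homomorphisms to `ℂ^×`. -/
abbrev QuasiChar : Type := ℚ_[p]ˣ →ₜ* ℂˣ

variable {p}

/-! ### Characters -/

/-- A character is unitary if its values have absolute value `1`. -/
def IsUnitaryChar (χ : QuasiChar p) : Prop := ∀ a : ℚ_[p]ˣ, ‖(χ a : ℂ)‖ = 1

/-- The exponent `c` of the conductor `p ^ c` of `χ`: the least `n` such that `χ` is trivial on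
`ℤ_p^× ∩ (1 + p ^ n ℤ_p)`. -/
def charConductor (χ : QuasiChar p) : ℕ :=
  sInf {n : ℕ | ∀ u : ℚ_[p]ˣ, ‖(u : ℚ_[p])‖ = 1 →
    ‖(u : ℚ_[p]) - 1‖ ≤ (p : ℝ) ^ (-(n : ℤ)) → χ u = 1}

/-- A character of `ℚ_p^×` is unramified if it is trivial on `ℤ_p^×`. -/
def IsUnramifiedChar (χ : QuasiChar p) : Prop :=
  ∀ u : ℚ_[p]ˣ, ‖(u : ℚ_[p])‖ = 1 → χ u = 1

/-- A continuous additive character of `ℚ_p` is unramified if `ℤ_p` is the largest fractional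
ideal on which it is trivial: it is trivial on `ℤ_p` but not on `p⁻¹ ℤ_p`. -/
def IsUnramifiedAddChar (ψ : AddChar ℚ_[p] Circle) : Prop :=
  Continuous ψ ∧ (∀ x : ℚ_[p], ‖x‖ ≤ 1 → ψ x = 1) ∧ ∃ x : ℚ_[p], ‖x‖ ≤ p ∧ ψ x ≠ 1

/-! ### Matrices -/

/-- The upper triangular matrix `(a x; 0 d)`. -/
def bMat (a : ℚ_[p]ˣ) (x : ℚ_[p]) (d : ℚ_[p]ˣ) : G p :=
  GeneralLinearGroup.mkOfDetNeZero !![(a : ℚ_[p]), x; 0, (d : ℚ_[p])] (by simp)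

/-- `n(x) = (1 x; 0 1)`. -/
def nMat (x : ℚ_[p]) : G p := bMat 1 x 1

/-- `a(y) = (y 0; 0 1)`. -/
def aMat (y : ℚ_[p]ˣ) : G p := bMat y 0 1

/-- `k₁ = (p 0; p 1)`. -/
def kOne : G p :=
  GeneralLinearGroup.mkOfDetNeZero !![(p : ℚ_[p]), 0; (p : ℚ_[p]), 1]
    (by simpa using (Fact.out : p.Prime).ne_zero)

/-- `g` lies in `GL(2, ℤ_p)`: integral entries and unit determinant. -/
def InMaximalCompact (g : G p) : Prop :=
  (∀ i j, ‖g i j‖ ≤ 1) ∧ ‖g.1.det‖ = 1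

/-- The group `I_r` of matrices `(a b; c d)` in `GL(2, ℤ_p)` with `p ^ r ∣ c`. -/
def iwahori (r : ℕ) : Set (G p) :=
  {k | InMaximalCompact k ∧ ‖k 1 0‖ ≤ (p : ℝ) ^ (-(r : ℤ))}

/-- The group `K₁(p ^ r)` of matrices `(a b; c d)` in `GL(2, ℤ_p)` with `c ≡ 0` and `d ≡ 1`
modulo `p ^ r`. -/
def kOneSubgroup (r : ℕ) : Set (G p) :=
  {k | InMaximalCompact k ∧ ‖k 1 0‖ ≤ (p : ℝ) ^ (-(r : ℤ)) ∧ ‖k 1 1 - 1‖ ≤ (p : ℝ) ^ (-(r : ℤ))}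

/-- The double coset `B g I_r`, with `B` the group of upper triangular matrices. -/
def doubleCoset (g : G p) (r : ℕ) : Set (G p) :=
  {h | ∃ (a : ℚ_[p]ˣ) (x : ℚ_[p]) (d : ℚ_[p]ˣ), ∃ k ∈ iwahori r, h = bMat a x d * g * k}

/-! ### Representations -/

section Rep

variable {V : Type*} [AddCommGroup V] [Module ℂ V]

/-- The twist `π ⊗ η`, that is `g ↦ η(det g) π(g)`. -/
def twist (π : Representation ℂ (G p) V) (η : QuasiChar p) : Representation ℂ (G p) V where
  toFun g := (η (GeneralLinearGroup.det g) : ℂ) • π g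
  map_one' := by simp
  map_mul' g h := by
    simp only [map_mul, Units.val_mul, smul_mul_smul_comm]

/-- The space of vectors of level `p ^ r`, those fixed by `K₁(p ^ r)`. If `π` has a central
character `ω` that is trivial on `ℤ_p^× ∩ (1 + p ^ r ℤ_p)`, these are for `r ≥ 1` the vectors on
which every `(a b; c d)` in `I_r` acts by `ω(d)`. -/
def levelVectors (π : Representation ℂ (G p) V) (r : ℕ) : Set V :=
  {v | ∀ k ∈ kOneSubgroup r, π k v = v}

/-- The exponent `c(π)` of the conductor `p ^ c(π)` of `π`: the least `r` such that `π` has a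
nonzero vector of level `p ^ r`. -/
def conductor (π : Representation ℂ (G p) V) : ℕ :=
  sInf {r : ℕ | ∃ v ∈ levelVectors π r, v ≠ 0}

/-- `π` is twist-minimal if no twist of `π` by a character has a smaller conductor. -/
def IsTwistMinimal (π : Representation ℂ (G p) V) : Prop :=
  ∀ η : QuasiChar p, conductor π ≤ conductor (twist π η)

/-- A newvector of `π`: a nonzero vector of level equal to the conductor. -/
def IsNewvector (π : Representation ℂ (G p) V) (v : V) : Prop :=
  v ≠ 0 ∧ v ∈ levelVectors π (conductor π)

/-- A nonzero `ψ`-Whittaker functional on `π`. -/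
def IsWhittakerFunctional (π : Representation ℂ (G p) V) (ψ : AddChar ℚ_[p] Circle)
    (Λ : V →ₗ[ℂ] ℂ) : Prop :=
  Λ ≠ 0 ∧ ∀ (x : ℚ_[p]) (v : V), Λ (π (nMat x) v) = (ψ x : ℂ) * Λ v

/-- The Whittaker function `W_v(g) = Λ(π(g) v)`. For a nonzero Whittaker functional `Λ` on an
irreducible `π`, these functions form the Whittaker model of `π`, on which `G` acts by right
translation, and `v ↦ W_v` is the isomorphism of `π` with it. -/
def whittakerFunction (π : Representation ℂ (G p) V) (Λ : V →ₗ[ℂ] ℂ) (v : V) : G p → ℂ :=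
  fun g => Λ (π g v)

/-- `W` is a newvector in the Whittaker model of `π` with respect to `ψ`. -/
def IsWhittakerNewvector (π : Representation ℂ (G p) V) (ψ : AddChar ℚ_[p] Circle)
    (W : G p → ℂ) : Prop :=
  ∃ Λ : V →ₗ[ℂ] ℂ, IsWhittakerFunctional π ψ Λ ∧
    ∃ v : V, IsNewvector π v ∧ W = whittakerFunction π Λ v

/-- `W` is a newvector in the Whittaker model normalized by `W(e) = 1`. -/
def IsNormalizedNewvector (π : Representation ℂ (G p) V) (ψ : AddChar ℚ_[p] Circle)
    (W : G p → ℂ) : Prop :=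
  IsWhittakerNewvector π ψ W ∧ W 1 = 1

/-- The values `|W(g)|` of the normalized newvector in the Whittaker model. -/
def newvectorValues (π : Representation ℂ (G p) V) (ψ : AddChar ℚ_[p] Circle) : Set ℝ :=
  {t | ∃ W : G p → ℂ, IsNormalizedNewvector π ψ W ∧ ∃ g : G p, t = ‖W g‖}

/-- The local invariant `h(π)`: the maximum of `|W(g)|` for the normalized newvector `W`. That the
supremum is a maximum is asserted separately wherever it is used. -/
def localInvariant (π : Representation ℂ (G p) V) (ψ : AddChar ℚ_[p] Circle) : ℝ :=
  sSup (newvectorValues π ψ)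

end Rep

/-! ### Principal series -/

/-- The space of the normalized parabolic induction of `(χ₁, χ₂)`: functions `f` on `G` with
`f((a x; 0 d) g) = χ₁(a) χ₂(d) |a / d|^(1/2) f(g)` that are invariant under right translation by
some open subgroup of `G`. -/
def principalSeriesSpace (χ₁ χ₂ : QuasiChar p) : Submodule ℂ (G p → ℂ) where
  carrier := {f |
    (∀ (a : ℚ_[p]ˣ) (x : ℚ_[p]) (d : ℚ_[p]ˣ) (g : G p),
      f (bMat a x d * g) =
        (χ₁ a : ℂ) * (χ₂ d : ℂ) * ((√‖(a : ℚ_[p]) / (d : ℚ_[p])‖ : ℝ) : ℂ) * f g) ∧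
    ∃ U : Subgroup (G p), IsOpen (U : Set (G p)) ∧ ∀ g : G p, ∀ k ∈ U, f (g * k) = f g}
  zero_mem' := ⟨by simp, ⊤, isOpen_univ, by simp⟩
  add_mem' := by
    rintro f f' ⟨hf, U, hU, hfU⟩ ⟨hf', U', hU', hfU'⟩
    refine ⟨fun a x d g => ?_, U ⊓ U', hU.inter hU', fun g k hk => ?_⟩
    · simp only [Pi.add_apply, hf a x d g, hf' a x d g, mul_add]
    · simp only [Pi.add_apply, hfU g k hk.1, hfU' g k hk.2]
  smul_mem' := by
    rintro c f ⟨hf, U, hU, hfU⟩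
    refine ⟨fun a x d g => ?_, U, hU, fun g k hk => ?_⟩
    · simp only [Pi.smul_apply, smul_eq_mul, hf a x d g]
      ring
    · simp only [Pi.smul_apply, hfU g k hk]

/-- Right translates stay in the induced space. -/
theorem principalSeriesSpace_translate {χ₁ χ₂ : QuasiChar p} {f : G p → ℂ}
    (hf : f ∈ principalSeriesSpace χ₁ χ₂) (h : G p) :
    (fun g => f (g * h)) ∈ principalSeriesSpace χ₁ χ₂ := by
  obtain ⟨hb, U, hU, hfU⟩ := hf
  refine ⟨fun a x d g => ?_, U.comap (MulAut.conj h⁻¹).toMonoidHom, ?_, fun g k hk => ?_⟩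
  · simp only [mul_assoc (bMat a x d) g h, hb a x d (g * h)]
  · have hc : Continuous fun k : G p => h⁻¹ * k * h⁻¹⁻¹ := by fun_prop
    exact hU.preimage hc
  · have hk' : h⁻¹ * k * h ∈ U := by simpa using hk
    have := hfU (g * h) _ hk'
    simpa [mul_assoc] using this

/-- The principal series representation attached to `(χ₁, χ₂)`: the group acts on the induced
space by right translation. (For unitary characters it is irreducible, so that it is the
representation `χ₁ ⊞ χ₂`.) -/
def principalSeries (χ₁ χ₂ : QuasiChar p) :
    Representation ℂ (G p) (principalSeriesSpace χ₁ χ₂) where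
  toFun h :=
    { toFun := fun f => ⟨fun g => f.1 (g * h), principalSeriesSpace_translate f.2 h⟩
      map_add' := fun _ _ => rfl
      map_smul' := fun _ _ => rfl }
  map_one' := by
    ext f g
    simp
  map_mul' h h' := by
    ext f g
    simp [mul_assoc]

/-- `π` is a unitary principal series representation: it is isomorphic to the principal series
attached to a pair of unitary characters. -/
def IsUnitaryPrincipalSeries {V : Type*} [AddCommGroup V] [Module ℂ V]
    (π : Representation ℂ (G p) V) : Prop :=
  ∃ χ₁ χ₂ : QuasiChar p, IsUnitaryChar χ₁ ∧ IsUnitaryChar χ₂ ∧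
    Nonempty (π.Equiv (principalSeries χ₁ χ₂))

/-- `y ∈ p⁻² ℤ_p^×` and `χ(1 - z) = ψ(y z)` for all `z ∈ p ℤ_p`. -/
def IsDual (χ : QuasiChar p) (ψ : AddChar ℚ_[p] Circle) (y : ℚ_[p]ˣ) : Prop :=
  ‖(y : ℚ_[p])‖ = (p : ℝ) ^ 2 ∧
    ∀ (z : ℚ_[p]) (u : ℚ_[p]ˣ), ‖z‖ ≤ (p : ℝ)⁻¹ → (u : ℚ_[p]) = 1 - z →
      (χ u : ℂ) = (ψ ((y : ℚ_[p]) * z) : ℂ)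

end GLTwo

end

noncomputable section

namespace GLTwo

variable {p : ℕ} [Fact p.Prime]

/-! ### Integration over fractional ideals of `ℚ_p` and additive characters -/

section HaarMeasure

open MeasureTheory Metric

/-! The argument computes the newvector explicitly in the induced model, applies a Jacquet integral,
and evaluates that integral by `p`-adic stationary phase.

`G` is the union of three double cosets `B g K₁(p²)`, with `g = 1`, `l(p) = (1 0; p 1)` and `w`
(`exists_bMat_mul`). A vector of level `p²` is determined by its values at these points, and a
nonzero value forces the inducing character to be trivial on the corresponding stabilizer: at `1`,
`χ₁` is unramified and `χ₂` trivial mod `p²`; at `w` the roles are exchanged; at `l(p)` both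
characters are trivial mod `p`. In the last case twisting by `χ₁⁻¹` lowers the conductor to at most
`p`, so twist-minimality leaves exactly one unramified character, the other having conductor `p²`,
and a line of newvectors. Whittaker functionals also form a line (`exists_eq_smul_of_whittaker`), so
the Whittaker newvector is unique up to a scalar.

Let `χ₁` be unramified. Up to constants, the integrand at `1` and at `l(p)` is `χ₁⁻¹χ₂(t) ψ(-t)
|t|⁻¹`. If `y` is dual to `χ₂`, this is near `t` an additive character of frequency `-(1 + y/t)`
(`phase_add`), so everything cancels except the coset `|t + y| ≤ p`, of measure `p`, where the
integrand has modulus `p⁻²`. That coset gives `|W(a(a))| = |a|^(1/2) p⁻¹` for `|a| ≤ 1`, and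
`|W(a(a) l(p))| = |a|^(1/2) p⁻¹` when `a/p` is dual to `χ₂`, hence `|a| = p`; otherwise both values
vanish. On the third coset the values are at most `p⁻¹`. Thus the ratio `p^(1/2)` is the factor
`|a|^(1/2)`, and `B k₁ I₂ = B l(p) I₂`.

If instead `χ₂` is unramified, multiplying by `(χ₁χ₂)⁻¹ ∘ det` leads to the pair `(χ₂⁻¹, χ₁⁻¹)`,
whose first member is unramified. Right translation by an Atkin–Lehner element carries its newvector
back (`whittakerFunction_alVec`), so the absolute values are the ones already computed, at
translated points. -/

instance instMeasurableSpacePadic : MeasurableSpace ℚ_[p] := borel _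

instance instBorelSpacePadic : BorelSpace ℚ_[p] := ⟨rfl⟩

/-! ### Haar measure on the `p`-adic numbers -/

/-- The Haar measure on `ℚ_p` for which `ℤ_p` has measure `1`. -/
def haar (p : ℕ) [Fact p.Prime] : Measure ℚ_[p] :=
  Measure.addHaarMeasure
    ⟨⟨closedBall 0 1, isCompact_closedBall _ _⟩,
      ⟨0, ball_subset_interior_closedBall (mem_ball_self one_pos)⟩⟩

instance : (haar p).IsAddHaarMeasure := by unfold haar; infer_instance

/-- The fractional ideal `p ^ (-k) ℤ_p`. -/
abbrev frac (p : ℕ) [Fact p.Prime] (k : ℤ) : Set ℚ_[p] := closedBall 0 ((p : ℝ) ^ k)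

lemma mem_frac {k : ℤ} {t : ℚ_[p]} : t ∈ frac p k ↔ ‖t‖ ≤ (p : ℝ) ^ k := by simp

lemma one_lt_cast_p : (1 : ℝ) < p := by exact_mod_cast (Fact.out : p.Prime).one_lt

lemma cast_p_pos : (0 : ℝ) < p := one_pos.trans one_lt_cast_p

lemma cast_p_ne_zero : (p : ℚ_[p]) ≠ 0 := by exact_mod_cast (Fact.out : p.Prime).ne_zero

lemma measurableSet_frac (k : ℤ) : MeasurableSet (frac p k) := isClosed_closedBall.measurableSet

lemma norm_add_le_of_le {x y : ℚ_[p]} {r : ℝ} (hx : ‖x‖ ≤ r) (hy : ‖y‖ ≤ r) : ‖x + y‖ ≤ r :=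
  (IsUltrametricDist.norm_add_le_max x y).trans (max_le hx hy)

lemma norm_sub_le_of_le {x y : ℚ_[p]} {r : ℝ} (hx : ‖x‖ ≤ r) (hy : ‖y‖ ≤ r) : ‖x - y‖ ≤ r := by
  rw [sub_eq_add_neg]
  exact norm_add_le_of_le hx (by rwa [norm_neg])

lemma norm_add_eq_left_of_lt {x y : ℚ_[p]} (h : ‖y‖ < ‖x‖) : ‖x + y‖ = ‖x‖ := by
  rw [IsUltrametricDist.norm_add_eq_max_of_norm_ne_norm h.ne', max_eq_left h.le]

lemma norm_eq_of_norm_sub_lt {x y : ℚ_[p]} (h : ‖x - y‖ < ‖y‖) : ‖x‖ = ‖y‖ := by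
  simpa using norm_add_eq_left_of_lt h

/-- Norms are powers of `p`, so that strict inequalities improve by a factor `p`. -/
lemma norm_le_of_lt_zpow {x : ℚ_[p]} {k : ℤ} (h : ‖x‖ < (p : ℝ) ^ k) : ‖x‖ ≤ (p : ℝ) ^ (k - 1) :=
  (Padic.norm_le_pow_iff_norm_lt_pow_add_one x (k - 1)).2 (by simpa using h)

lemma norm_le_div_of_lt {x y : ℚ_[p]} (h : ‖x‖ < ‖y‖) : ‖x‖ ≤ ‖y‖ / p := by
  have hy : y ≠ 0 := by
    rintro rfl
    simp at h
    exact absurd h (not_lt.2 (norm_nonneg _))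
  have hn := Padic.norm_eq_zpow_neg_valuation hy
  rw [hn] at h ⊢
  have := norm_le_of_lt_zpow h
  rwa [zpow_sub_one₀ cast_p_pos.ne'] at this

/-- Scaling by `p ^ (k + 1)` moves `t` into `ℤ_p`, and `j` is its residue modulo `p`. -/
lemma exists_nat_lt_norm_sub_le {t : ℚ_[p]} {k : ℤ} (ht : ‖t‖ ≤ (p : ℝ) ^ (k + 1)) :
    ∃ j < p, ‖t - j * (p : ℚ_[p]) ^ (-(k + 1))‖ ≤ (p : ℝ) ^ k := by
  have hp := (cast_p_ne_zero (p := p))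
  have hu : ‖t * (p : ℚ_[p]) ^ (k + 1)‖ ≤ 1 := by
    rw [norm_mul, Padic.norm_p_zpow]
    calc _ ≤ (p : ℝ) ^ (k + 1) * (p : ℝ) ^ (-(k + 1)) := by gcongr
      _ = 1 := by rw [← zpow_add₀ cast_p_pos.ne']; simp
  obtain ⟨j, hj, hm⟩ := PadicInt.exists_mem_range (⟨_, hu⟩ : ℤ_[p])
  refine ⟨j, hj, ?_⟩
  have h1 : ‖t * (p : ℚ_[p]) ^ (k + 1) - j‖ ≤ (p : ℝ) ^ (-1 : ℤ) := by
    rw [IsLocalRing.mem_maximalIdeal, PadicInt.mem_nonunits] at hm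
    have h0 : ‖t * (p : ℚ_[p]) ^ (k + 1) - j‖ < 1 := hm
    simpa using norm_le_of_lt_zpow (k := 0) (by simpa using h0)
  have h2 : t - j * (p : ℚ_[p]) ^ (-(k + 1)) =
      (t * (p : ℚ_[p]) ^ (k + 1) - j) * (p : ℚ_[p]) ^ (-(k + 1)) := by
    rw [sub_mul, mul_assoc, ← zpow_add₀ hp]; simp
  rw [h2, norm_mul, Padic.norm_p_zpow]
  calc _ ≤ (p : ℝ) ^ (-1 : ℤ) * (p : ℝ) ^ (- -(k + 1)) := by gcongr
    _ = _ := by rw [← zpow_add₀ cast_p_pos.ne']; congr 1; ring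

/-- The larger ideal is a disjoint union of `p` translates of the smaller one, indexed by residues
modulo `p`. -/
lemma haar_frac_succ (k : ℤ) : haar p (frac p (k + 1)) = p * haar p (frac p k) := by
  have hp := (cast_p_ne_zero (p := p))
  have hU : frac p (k + 1) =
      ⋃ j ∈ Finset.range p, (fun t => t + -((j : ℚ_[p]) * (p : ℚ_[p]) ^ (-(k + 1)))) ⁻¹' frac p k := by
    ext t
    simp only [Set.mem_iUnion, Set.mem_preimage, mem_frac, Finset.mem_range, exists_prop,
      ← sub_eq_add_neg]
    refine ⟨exists_nat_lt_norm_sub_le, ?_⟩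
    rintro ⟨j, -, hj⟩
    have h1 : ‖(j : ℚ_[p]) * (p : ℚ_[p]) ^ (-(k + 1))‖ ≤ (p : ℝ) ^ (k + 1) := by
      rw [norm_mul, Padic.norm_p_zpow, neg_neg]
      have : ‖(j : ℚ_[p])‖ ≤ 1 := by simpa using Padic.norm_int_le_one (p := p) (j : ℤ)
      exact mul_le_of_le_one_left (by positivity) this
    have h2 : (p : ℝ) ^ k ≤ (p : ℝ) ^ (k + 1) := zpow_le_zpow_right₀ one_lt_cast_p.le (by omega)
    simpa using norm_add_le_of_le (hj.trans h2) h1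
  rw [hU, measure_biUnion_finset]
  · simp only [measure_preimage_add_right, Finset.sum_const, Finset.card_range, nsmul_eq_mul]
  · intro i hi j hj hij
    simp only [Finset.coe_range, Set.mem_Iio] at hi hj
    refine Set.disjoint_left.2 fun t hti htj => hij ?_
    simp only [Set.mem_preimage, mem_frac, ← sub_eq_add_neg] at hti htj
    have h1 := norm_sub_le_of_le htj hti
    have h2 : t - j * (p : ℚ_[p]) ^ (-(k + 1)) - (t - i * (p : ℚ_[p]) ^ (-(k + 1))) =
        ((i - j : ℤ) : ℚ_[p]) * (p : ℚ_[p]) ^ (-(k + 1)) := by push_cast; ring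
    rw [h2, norm_mul, Padic.norm_p_zpow, neg_neg, zpow_add_one₀ cast_p_pos.ne'] at h1
    have h3 : ‖((i - j : ℤ) : ℚ_[p])‖ < 1 := by
      by_contra h
      push Not at h
      have h4 : (0 : ℝ) < (p : ℝ) ^ k := zpow_pos cast_p_pos _
      nlinarith [mul_le_mul_of_nonneg_right h (mul_pos h4 (cast_p_pos (p := p))).le,
        one_lt_cast_p (p := p)]
    rw [Padic.norm_intCast_lt_one_iff] at h3
    have := Int.eq_zero_of_abs_lt_dvd h3 (by rw [abs_lt]; omega)
    omega
  · intro j _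
    exact (measurableSet_frac k).preimage (measurable_add_const _)

lemma haar_real_frac (k : ℤ) : (haar p).real (frac p k) = (p : ℝ) ^ k := by
  have h0 : (haar p).real (frac p 0) = 1 := by
    have : haar p (frac p 0) = 1 := by
      have := Measure.addHaarMeasure_self (K₀ := (⟨⟨closedBall 0 1, isCompact_closedBall _ _⟩,
        ⟨0, ball_subset_interior_closedBall (mem_ball_self one_pos)⟩⟩ :
          TopologicalSpace.PositiveCompacts ℚ_[p]))
      simp only [frac, haar, zpow_zero]
      exact this
    simp [Measure.real, this]
  have hs (k : ℤ) : (haar p).real (frac p (k + 1)) = p * (haar p).real (frac p k) := by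
    simp [Measure.real, haar_frac_succ]
  induction k using Int.induction_on with
  | zero => simpa using h0
  | succ n ih => rw [hs, ih, zpow_add_one₀ cast_p_pos.ne', mul_comm]
  | pred n ih =>
    have := hs (-n - 1)
    rw [sub_add_cancel, ih] at this
    rw [zpow_sub_one₀ cast_p_pos.ne', this]
    field_simp [(cast_p_pos (p := p)).ne']

/-- Translation by elements of an additive subgroup preserves set integrals over stable sets. -/
lemma setIntegral_add_right {S : Set ℚ_[p]} {s : ℚ_[p]} (hS : ∀ t, t + s ∈ S ↔ t ∈ S)
    (f : ℚ_[p] → ℂ) : ∫ t in S, f (t + s) ∂haar p = ∫ t in S, f t ∂haar p := by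
  have h1 : (fun t => t + s) ⁻¹' S = S := by ext t; exact hS t
  have := (measurePreserving_add_right (haar p) s).setIntegral_preimage_emb
    (measurableEmbedding_addRight s) f S
  rwa [h1] at this

lemma setIntegral_frac_add (f : ℚ_[p] → ℂ) {k : ℤ} {s : ℚ_[p]} (hs : ‖s‖ ≤ (p : ℝ) ^ k) :
    ∫ t in frac p k, f (t + s) ∂haar p = ∫ t in frac p k, f t ∂haar p := by
  refine setIntegral_add_right (fun t => ?_) f
  rw [mem_frac, mem_frac]
  exact ⟨fun h => by simpa using norm_sub_le_of_le h hs, fun h => norm_add_le_of_le h hs⟩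

/-- The integral over a translate of a fractional ideal. -/
lemma setIntegral_closedBall (f : ℚ_[p] → ℂ) (t₀ : ℚ_[p]) (k : ℤ) :
    ∫ t in closedBall t₀ ((p : ℝ) ^ k), f t ∂haar p = ∫ s in frac p k, f (s + t₀) ∂haar p := by
  have := (measurePreserving_add_right (haar p) t₀).setIntegral_preimage_emb
    (measurableEmbedding_addRight t₀) f (closedBall t₀ ((p : ℝ) ^ k))
  rw [← this]
  congr 2
  ext t
  simp [dist_eq_norm]

/-- If the averages of `h` over the translates of a fractional ideal in `S` vanish, so does the
integral over `S`. -/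
lemma setIntegral_eq_zero_of_average {S : Set ℚ_[p]} {h : ℚ_[p] → ℂ} {k : ℤ} (hS : IsCompact S)
    (hSk : ∀ s, ‖s‖ ≤ (p : ℝ) ^ k → ∀ t, t + s ∈ S ↔ t ∈ S) (hc : ContinuousOn h S)
    (h0 : ∀ t ∈ S, ∫ s in frac p k, h (t + s) ∂haar p = 0) : ∫ t in S, h t ∂haar p = 0 := by
  have hint : IntegrableOn (fun x : ℚ_[p] × ℚ_[p] => h (x.1 + x.2)) (S ×ˢ frac p k)
      ((haar p).prod (haar p)) := by
    refine ContinuousOn.integrableOn_compact (hS.prod (isCompact_closedBall _ _)) ?_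
    refine hc.comp (by fun_prop) ?_
    rintro ⟨t, s⟩ ⟨ht, hs⟩
    exact (hSk s (mem_frac.1 hs) t).2 ht
  -- This double integral vanishes. In the other order it is the measure of the ideal times the
  -- integral over `S`, because `S` is stable under translation by the ideal.
  have h1 : ∫ t in S, ∫ s in frac p k, h (t + s) ∂haar p ∂haar p = 0 := by
    rw [setIntegral_congr_fun hS.measurableSet h0]
    simp
  have h2 : ∫ t in S, ∫ s in frac p k, h (t + s) ∂haar p ∂haar p =
      ∫ s in frac p k, ∫ t in S, h (t + s) ∂haar p ∂haar p := by
    apply integral_integral_swap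
    rwa [Measure.prod_restrict]
  have h3 : ∫ s in frac p k, ∫ t in S, h (t + s) ∂haar p ∂haar p =
      ∫ s in frac p k, (∫ t in S, h t ∂haar p) ∂haar p :=
    setIntegral_congr_fun (measurableSet_frac k) fun s hs =>
      setIntegral_add_right (hSk s (mem_frac.1 hs)) h
  rw [h2, h3, setIntegral_const, haar_real_frac, smul_eq_zero] at h1
  exact h1.resolve_left (zpow_pos cast_p_pos _).ne'

/-! ### Additive characters -/

/-- If `|κ| p ^ k > 1`, then `κ p ^ (-k) ℤ_p` contains `p⁻¹ ℤ_p`, where `ψ` is nontrivial.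
Discreteness of the norm supplies the missing factor `p`. -/
lemma IsUnramifiedAddChar.trivial_iff {ψ : AddChar ℚ_[p] Circle} (hψ : IsUnramifiedAddChar ψ)
    (κ : ℚ_[p]) (k : ℤ) :
    (∀ t : ℚ_[p], ‖t‖ ≤ (p : ℝ) ^ k → ψ (κ * t) = 1) ↔ ‖κ‖ * (p : ℝ) ^ k ≤ 1 := by
  obtain ⟨-, h1, x, hx, hx1⟩ := hψ
  refine ⟨fun h => ?_, fun h t ht => h1 _ ?_⟩
  · by_contra hlt
    push Not at hlt
    have hκ : κ ≠ 0 := by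
      rintro rfl
      simp at hlt
      linarith
    apply hx1
    have := h (κ⁻¹ * x) ?_
    · rwa [mul_inv_cancel_left₀ hκ] at this
    · have h2 : ‖κ‖⁻¹ < (p : ℝ) ^ k := by
        rw [inv_lt_iff_one_lt_mul₀ (norm_pos_iff.2 hκ)]
        linarith
      rw [← norm_inv] at h2
      have h3 := norm_le_of_lt_zpow h2
      rw [norm_mul]
      calc _ ≤ (p : ℝ) ^ (k - 1) * p := by gcongr
        _ = _ := by rw [zpow_sub_one₀ cast_p_pos.ne']; field_simp [(cast_p_pos (p := p)).ne']
  · rw [norm_mul]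
    exact (mul_le_mul_of_nonneg_left ht (norm_nonneg _)).trans h

/-- Orthogonality: a translation by `s` in the ideal with `ψ(κ s) ≠ 1` preserves the integral and
multiplies it by `ψ(κ s)`. -/
lemma setIntegral_frac_addChar {ψ : AddChar ℚ_[p] Circle} (hψ : IsUnramifiedAddChar ψ)
    (κ : ℚ_[p]) (k : ℤ) :
    ∫ t in frac p k, (ψ (κ * t) : ℂ) ∂haar p =
      if ‖κ‖ * (p : ℝ) ^ k ≤ 1 then (((p : ℝ) ^ k : ℝ) : ℂ) else 0 := by
  split_ifs with h
  · have h1 := (hψ.trivial_iff κ k).2 h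
    rw [setIntegral_congr_fun (g := fun _ => (1 : ℂ)) (measurableSet_frac k)
      fun t ht => by simp [h1 t (mem_frac.1 ht)]]
    simp only [setIntegral_const, haar_real_frac, Complex.real_smul, mul_one]
  · rw [← hψ.trivial_iff] at h
    push Not at h
    obtain ⟨s, hs, hs1⟩ := h
    have h2 := setIntegral_frac_add (fun t => (ψ (κ * t) : ℂ)) hs
    simp only [mul_add, AddChar.map_add_eq_mul, Circle.coe_mul] at h2
    rw [integral_mul_const] at h2
    have h3 : ((ψ (κ * s) : Circle) : ℂ) ≠ 1 := by simpa [Circle.ext_iff] using hs1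
    by_contra h0
    exact h3 (mul_left_cancel₀ h0 (by rw [h2, mul_one]))

end HaarMeasure

/-! ### Multiplicative characters and the dual elements of characters of conductor `p²` -/

section Characters

open MeasureTheory Metric

/-! ### Multiplicative characters -/

/-- A quasi-character of `ℚ_p^×`, extended to `ℚ_p` by zero. -/
def QuasiChar.ext (χ : QuasiChar p) : MulChar ℚ_[p] ℂ := MulChar.ofUnitHom (χ : ℚ_[p]ˣ →* ℂˣ)

/-- `χ` is trivial on `ℤ_p^× ∩ (1 + p ^ n ℤ_p)`. -/
def IsTrivialMod (χ : QuasiChar p) (n : ℕ) : Prop :=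
  ∀ u : ℚ_[p]ˣ, ‖(u : ℚ_[p])‖ = 1 → ‖(u : ℚ_[p]) - 1‖ ≤ (p : ℝ) ^ (-(n : ℤ)) → χ u = 1

lemma IsUnramifiedChar.isTrivialMod {χ : QuasiChar p} (h : IsUnramifiedChar χ) (n : ℕ) :
    IsTrivialMod χ n := fun u hu _ => h u hu

/-- The infimum of the empty set is `0` by default, so `n ≠ 0` guarantees that the infimum is
attained. -/
lemma isTrivialMod_of_charConductor {χ : QuasiChar p} {n : ℕ} (h : charConductor χ = n)
    (hn : n ≠ 0) : IsTrivialMod χ n := by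
  have hne : {n : ℕ | IsTrivialMod χ n}.Nonempty := by
    by_contra h0
    rw [Set.not_nonempty_iff_eq_empty] at h0
    apply hn
    rw [← h]
    exact (congrArg sInf h0).trans Nat.sInf_empty
  have := Nat.sInf_mem hne
  rwa [show sInf {n : ℕ | IsTrivialMod χ n} = n from h] at this

lemma not_isTrivialMod_of_lt_charConductor {χ : QuasiChar p} {n : ℕ} (h : n < charConductor χ) :
    ¬ IsTrivialMod χ n := fun hn => Nat.notMem_of_lt_sInf h hn

namespace QuasiChar

variable (χ : QuasiChar p)

@[simp] lemma ext_coe (u : ℚ_[p]ˣ) : χ.ext (u : ℚ_[p]) = χ u := MulChar.ofUnitHom_coe _ _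

@[simp] lemma ext_zero : χ.ext 0 = 0 := MulChar.map_zero _

lemma ext_ne_zero {x : ℚ_[p]} (hx : x ≠ 0) : χ.ext x ≠ 0 := by
  rw [← Units.val_mk0 hx, ext_coe]
  exact (χ _).ne_zero

lemma ext_mul (x y : ℚ_[p]) : χ.ext (x * y) = χ.ext x * χ.ext y := map_mul _ _ _

lemma ext_inv (x : ℚ_[p]) : χ.ext x⁻¹ = (χ.ext x)⁻¹ := by
  rcases eq_or_ne x 0 with rfl | hx
  · simp
  · exact eq_inv_of_mul_eq_one_left (by rw [← ext_mul, inv_mul_cancel₀ hx, MulChar.map_one])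

lemma ext_div (x y : ℚ_[p]) : χ.ext (x / y) = χ.ext x / χ.ext y := by
  rw [div_eq_mul_inv, ext_mul, ext_inv, div_eq_mul_inv]

variable {χ}

lemma ext_one_char {x : ℚ_[p]} (hx : x ≠ 0) : (1 : QuasiChar p).ext x = 1 := by
  rw [← Units.val_mk0 hx, ext_coe]
  simp

end QuasiChar

open QuasiChar

variable {χ : QuasiChar p}

lemma IsUnitaryChar.norm_ext (h : IsUnitaryChar χ) {x : ℚ_[p]} (hx : x ≠ 0) : ‖χ.ext x‖ = 1 := by
  rw [← Units.val_mk0 hx, ext_coe]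
  exact h _

lemma IsUnramifiedChar.ext_eq_one (h : IsUnramifiedChar χ) {x : ℚ_[p]} (hx : ‖x‖ = 1) :
    χ.ext x = 1 := by
  have hx0 : x ≠ 0 := by
    rintro rfl
    simp at hx
  rw [← Units.val_mk0 hx0, ext_coe, h _ (by simpa using hx), Units.val_one]

lemma IsUnramifiedChar.ext_congr (h : IsUnramifiedChar χ) {x y : ℚ_[p]} (hxy : ‖x‖ = ‖y‖) :
    χ.ext x = χ.ext y := by
  rcases eq_or_ne y 0 with rfl | hy
  · rw [norm_zero, norm_eq_zero] at hxy
    rw [hxy]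
  · have : χ.ext (x / y) = 1 := h.ext_eq_one (by rw [norm_div, hxy, div_self (norm_ne_zero_iff.2 hy)])
    rwa [ext_div, div_eq_one_iff_eq (ext_ne_zero χ hy)] at this

lemma zpow_neg_natCast_lt_one {n : ℕ} (hn : n ≠ 0) : (p : ℝ) ^ (-(n : ℤ)) < 1 :=
  zpow_lt_one_of_neg₀ one_lt_cast_p (by omega)

lemma norm_eq_one_of_sub_one {x : ℚ_[p]} {n : ℕ} (hn : n ≠ 0)
    (hx : ‖x - 1‖ ≤ (p : ℝ) ^ (-(n : ℤ))) : ‖x‖ = 1 := by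
  simpa using norm_eq_of_norm_sub_lt (y := 1) (by simpa using hx.trans_lt (zpow_neg_natCast_lt_one hn))

lemma IsTrivialMod.ext_eq_one {n : ℕ} (h : IsTrivialMod χ n) (hn : n ≠ 0) {x : ℚ_[p]}
    (hx : ‖x - 1‖ ≤ (p : ℝ) ^ (-(n : ℤ))) : χ.ext x = 1 := by
  have h1 := norm_eq_one_of_sub_one hn hx
  have hx0 : x ≠ 0 := by
    rintro rfl
    simp at h1
  rw [← Units.val_mk0 hx0, ext_coe, h _ (by simpa using h1) (by simpa using hx), Units.val_one]

lemma IsTrivialMod.ext_congr {n : ℕ} (h : IsTrivialMod χ n) (hn : n ≠ 0) {x y : ℚ_[p]}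
    (hxy : ‖x - y‖ ≤ (p : ℝ) ^ (-(n : ℤ)) * ‖y‖) : χ.ext x = χ.ext y := by
  rcases eq_or_ne y 0 with rfl | hy
  · simp only [sub_zero, norm_zero, mul_zero] at hxy
    rw [norm_le_zero_iff.1 hxy]
  · have : χ.ext (x / y) = 1 := by
      refine h.ext_eq_one hn ?_
      rw [div_sub_one hy, norm_div]
      exact div_le_of_le_mul₀ (norm_nonneg _) (zpow_nonneg cast_p_pos.le _) hxy
    rwa [ext_div, div_eq_one_iff_eq (ext_ne_zero χ hy)] at this

lemma IsTrivialMod.continuousAt_ext {n : ℕ} (h : IsTrivialMod χ n) (hn : n ≠ 0) {x : ℚ_[p]}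
    (hx : x ≠ 0) : ContinuousAt χ.ext x := by
  refine (continuousAt_const (y := χ.ext x)).congr ?_
  filter_upwards [closedBall_mem_nhds x
    (mul_pos (zpow_pos (cast_p_pos (p := p)) (-(n : ℤ))) (norm_pos_iff.2 hx))] with y hy
  exact (h.ext_congr hn (by simpa [dist_eq_norm] using hy)).symm

/-! ### Dual elements -/

variable {ψ : AddChar ℚ_[p] Circle}

lemma IsDual.ext_one_add {y : ℚ_[p]ˣ} (h : IsDual χ ψ y) {z : ℚ_[p]} (hz : ‖z‖ ≤ (p : ℝ)⁻¹) :
    χ.ext (1 + z) = ψ (-(y * z)) := by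
  have h1 : ‖(1 + z) - 1‖ ≤ (p : ℝ) ^ (-((1 : ℕ) : ℤ)) := by simpa using hz
  have h2 := norm_eq_one_of_sub_one one_ne_zero h1
  have h0 : 1 + z ≠ 0 := by
    intro h0
    simp [h0] at h2
  have := h.2 (-z) (Units.mk0 _ h0) (by simpa using hz) (by simp)
  rw [← ext_coe] at this
  simpa using this

/-- The dual elements form a coset of `p⁻¹ ℤ_p`: two of them define the same character of `p ℤ_p`
exactly when `ψ` is trivial on `(y₀ - y) p ℤ_p`. The norm of `y` comes for free, since `p < p² =
|y₀|`. -/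
lemma IsDual.iff_norm_sub_le (hψ : IsUnramifiedAddChar ψ) {y₀ : ℚ_[p]ˣ} (h : IsDual χ ψ y₀)
    (y : ℚ_[p]ˣ) : IsDual χ ψ y ↔ ‖(y₀ : ℚ_[p]) - y‖ ≤ p := by
  have key := hψ.trivial_iff ((y₀ : ℚ_[p]) - y) (-1)
  have h1 : ‖(y₀ : ℚ_[p]) - y‖ * (p : ℝ) ^ (-1 : ℤ) ≤ 1 ↔ ‖(y₀ : ℚ_[p]) - y‖ ≤ p := by
    rw [_root_.zpow_neg_one, mul_inv_le_iff₀ cast_p_pos, one_mul]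
  rw [← h1, ← key]
  have hz (z : ℚ_[p]) : ψ ((y₀ - y) * z) = 1 ↔ ψ (y₀ * z) = ψ (y * z) := by
    rw [sub_mul, AddChar.map_sub_eq_div, div_eq_one]
  constructor
  · intro hy z hz'
    rw [_root_.zpow_neg_one] at hz'
    have e1 := h.ext_one_add (z := -z) (by simpa using hz')
    have e2 := hy.ext_one_add (z := -z) (by simpa using hz')
    rw [hz]
    apply Circle.ext
    simpa using e1.symm.trans e2
  · intro hy
    refine ⟨?_, fun z u hz' hu => ?_⟩
    · have h2 := h1.1 (key.1 hy)
      have h3 : ‖(y : ℚ_[p]) - y₀‖ < ‖(y₀ : ℚ_[p])‖ := by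
        rw [h.1, norm_sub_rev]
        have := one_lt_cast_p (p := p)
        nlinarith
      rw [norm_eq_of_norm_sub_lt h3, h.1]
    · rw [h.2 z u hz' hu, (hz z).1 (hy z (by simpa using hz'))]

/-- Modulo `p ^ 2`, every element of `p ℤ_p` is a natural multiple of `p`. -/
lemma exists_natCast_mul_sub_le {z : ℚ_[p]} (hz : ‖z‖ ≤ (p : ℝ)⁻¹) :
    ∃ m : ℕ, ‖z - m * p‖ ≤ (p : ℝ) ^ (-2 : ℤ) := by
  obtain ⟨j, -, hj⟩ := exists_nat_lt_norm_sub_le (t := z) (k := -2) (by simpa using hz)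
  exact ⟨j, by simpa using hj⟩

/-- Since `(1 - mp)(1 - p) ≡ 1 - (m + 1)p` modulo `p²`, the map `z ↦ χ(1 - z)` is an additive
character of `p ℤ_p / p² ℤ_p`, determined by `θ = χ(1 - p)`. This is a `p`-th root of unity
different from `1`. For `|x| = p` with `ψ(x) ≠ 1`, the number `ψ(x)` is a primitive `p`-th root of
unity, so `θ = ψ(x) ^ j` with `j` prime to `p`, and `y = jx/p` is dual. -/
lemma exists_isDual (hψ : IsUnramifiedAddChar ψ) (h2 : IsTrivialMod χ 2)
    (h1 : ¬ IsTrivialMod χ 1) : ∃ y : ℚ_[p]ˣ, IsDual χ ψ y := by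
  have hp := cast_p_pos (p := p)
  have hp1 := one_lt_cast_p (p := p)
  have hpn : ‖(p : ℚ_[p])‖ = (p : ℝ)⁻¹ := Padic.norm_p
  obtain ⟨x, hx, hx1⟩ := hψ.2.2
  set θ : ℂ := χ.ext (1 - p) with hθ
  have hadd {z : ℚ_[p]} (m : ℕ) (hz : ‖z - m * p‖ ≤ (p : ℝ) ^ (-2 : ℤ)) :
      χ.ext (1 - z) = θ ^ m := by
    induction m generalizing z with
    | zero => simpa using h2.ext_eq_one two_ne_zero (x := 1 - z) (by simpa using hz)
    | succ m ih =>
      have hm : ‖(m : ℚ_[p])‖ ≤ 1 := by simpa using Padic.norm_int_le_one (p := p) (m : ℤ)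
      have e1 : χ.ext (1 - z) = χ.ext ((1 - (m : ℚ_[p]) * p) * (1 - p)) := by
        refine h2.ext_congr two_ne_zero ?_
        have hn : ‖(1 - (m : ℚ_[p]) * p) * (1 - p : ℚ_[p])‖ = 1 := by
          rw [norm_mul, norm_eq_one_of_sub_one (x := (1 - m * p : ℚ_[p])) (n := 1) one_ne_zero,
            norm_eq_one_of_sub_one (x := (1 - p : ℚ_[p])) (n := 1) one_ne_zero, one_mul]
          · simp
          · simpa using mul_le_of_le_one_left (inv_nonneg.2 hp.le) hm
        rw [hn, mul_one]
        have e2 : 1 - z - (1 - m * p) * (1 - p : ℚ_[p]) =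
            -(z - ((m + 1 : ℕ) : ℚ_[p]) * p) - m * (p * p) := by push_cast; ring
        rw [e2]
        refine norm_sub_le_of_le (by rwa [norm_neg]) ?_
        rw [norm_mul, norm_mul, hpn]
        calc _ ≤ 1 * ((p : ℝ)⁻¹ * (p : ℝ)⁻¹) := by gcongr
          _ = _ := by norm_num [_root_.zpow_neg, sq]
      rw [e1, ext_mul, ih (by simp), pow_succ]
  -- Here `z = 0` is approximated by `p · p`, at distance exactly `p⁻²`.
  have hθp : θ ^ p = 1 := by
    rw [← hadd (z := (0 : ℚ_[p])) p ?_, sub_zero, MulChar.map_one]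
    simp only [zero_sub, norm_neg, norm_mul, hpn]
    apply le_of_eq
    norm_num [_root_.zpow_neg, sq]
  have hprim : IsPrimitiveRoot ((ψ x : Circle) : ℂ) p := by
    rw [IsPrimitiveRoot.iff_orderOf]
    refine orderOf_eq_prime ?_ (by simpa [Circle.ext_iff] using hx1)
    rw [← Circle.coe_pow, ← AddChar.map_nsmul_eq_pow, hψ.2.1, Circle.coe_one]
    rw [nsmul_eq_mul, norm_mul, hpn]
    exact inv_mul_le_one_of_le₀ hx hp.le
  obtain ⟨j, -, hj⟩ := hprim.eq_pow_of_pow_eq_one hθp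
  have hθ1 : θ ≠ 1 := by
    intro h
    apply h1
    intro u hu hu1
    obtain ⟨m, hm⟩ := exists_natCast_mul_sub_le (z := 1 - (u : ℚ_[p]))
      (by rw [norm_sub_rev]; simpa using hu1)
    have := hadd m hm
    rw [h, one_pow, sub_sub_cancel, ext_coe] at this
    exact Units.ext this
  have hjp : ‖(j : ℚ_[p])‖ = 1 := by
    refine le_antisymm (by simpa using Padic.norm_int_le_one (p := p) (j : ℤ)) ?_
    by_contra hlt
    push Not at hlt
    rw [Padic.norm_natCast_lt_one_iff] at hlt
    obtain ⟨m, rfl⟩ := hlt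
    apply hθ1
    rw [← hj, pow_mul, hprim.pow_eq_one, one_pow]
  have hxn : ‖x‖ = p := by
    refine le_antisymm hx ?_
    by_contra hlt
    push Not at hlt
    exact hx1 (hψ.2.1 x (by simpa using norm_le_of_lt_zpow (k := 1) (by simpa using hlt)))
  have hy0 : (j : ℚ_[p]) * x / p ≠ 0 := by
    rw [← norm_ne_zero_iff, norm_div, norm_mul, hjp, hxn, hpn]
    positivity
  refine ⟨Units.mk0 _ hy0, ?_, fun z u hz hu => ?_⟩
  · simp only [Units.val_mk0, norm_div, norm_mul, hjp, hxn, hpn]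
    field_simp
  · obtain ⟨m, hm⟩ := exists_natCast_mul_sub_le hz
    rw [← ext_coe, hu, hadd m hm, ← hj, ← pow_mul, Units.val_mk0, ← Circle.coe_pow,
      ← AddChar.map_nsmul_eq_pow]
    congr 1
    have e : (j : ℚ_[p]) * x / p * z = (j * m) • x + (j : ℚ_[p]) * x / p * (z - m * p) := by
      have := cast_p_ne_zero (p := p)
      rw [nsmul_eq_mul]
      push_cast
      field_simp
      ring
    rw [e, AddChar.map_add_eq_mul, hψ.2.1 ((j : ℚ_[p]) * x / p * (z - m * p)), mul_one]
    rw [norm_mul, norm_div, norm_mul, hjp, hxn, hpn]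
    calc _ ≤ 1 * (p : ℝ) / (p : ℝ)⁻¹ * (p : ℝ) ^ (-2 : ℤ) := by gcongr
      _ = 1 := by
        rw [_root_.zpow_neg]
        field_simp

end Characters

/-! ### Stationary phase for `χ₁⁻¹(t) χ₂(t) ψ(-t) |t|⁻¹` -/

section OscillatoryIntegrals

open MeasureTheory Metric QuasiChar

/-! ### Oscillatory integrals -/

/-- The integrand `χ₁⁻¹(t) χ₂(t) ψ(-t) |t|⁻¹`. -/
def phase (χ₁ χ₂ : QuasiChar p) (ψ : AddChar ℚ_[p] Circle) (t : ℚ_[p]) : ℂ :=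
  χ₁.ext t⁻¹ * χ₂.ext t * ψ (-t) * ((‖t‖⁻¹ : ℝ) : ℂ)

variable {χ₁ χ₂ : QuasiChar p} {ψ : AddChar ℚ_[p] Circle} {y : ℚ_[p]ˣ}

lemma continuousOn_phase (hψ : Continuous ψ) (h₁ : IsUnramifiedChar χ₁) (h₂ : IsTrivialMod χ₂ 2) :
    ContinuousOn (phase χ₁ χ₂ ψ) {0}ᶜ := by
  intro t ht
  have ht0 : t ≠ 0 := ht
  refine ContinuousAt.continuousWithinAt ?_
  have c1 : ContinuousAt (fun t : ℚ_[p] => χ₁.ext t⁻¹) t :=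
    ContinuousAt.comp (g := χ₁.ext)
      ((h₁.isTrivialMod 1).continuousAt_ext one_ne_zero (inv_ne_zero ht0)) (continuousAt_inv₀ ht0)
  have c2 := h₂.continuousAt_ext two_ne_zero ht0
  have c3 : ContinuousAt (fun t : ℚ_[p] => ((ψ (-t) : Circle) : ℂ)) t := by fun_prop
  have c4 : ContinuousAt (fun t : ℚ_[p] => ((‖t‖⁻¹ : ℝ) : ℂ)) t :=
    Complex.continuous_ofReal.continuousAt.comp (continuous_norm.continuousAt.inv₀ (by simpa using ht0))
  exact ((c1.mul c2).mul c3).mul c4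

/-- For such `s` the norm, and with it the unramified `χ₁`, does not change, while duality gives
`χ₂(1 + s/t) = ψ(-y s/t)`. Hence the phase is locally an additive character, with `t = -y` as its
stationary point. -/
lemma phase_add (h₁ : IsUnramifiedChar χ₁) (hy : IsDual χ₂ ψ y) {t s : ℚ_[p]} (ht : t ≠ 0)
    (hs : ‖s‖ ≤ ‖t‖ / p) :
    phase χ₁ χ₂ ψ (t + s) = phase χ₁ χ₂ ψ t * ψ (-(1 + y / t) * s) := by
  have htn : 0 < ‖t‖ := norm_pos_iff.2 ht
  have hlt : ‖s‖ < ‖t‖ := hs.trans_lt (div_lt_self htn one_lt_cast_p)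
  have hn := norm_add_eq_left_of_lt hlt
  have h2 : χ₂.ext (t + s) = χ₂.ext t * ψ (-(y * (s / t))) := by
    rw [← hy.ext_one_add, ← ext_mul, mul_add, mul_one, mul_div_cancel₀ _ ht]
    rw [norm_div, div_le_iff₀ htn, inv_mul_eq_div]
    exact hs
  have e : -(1 + (y : ℚ_[p]) / t) * s = -s + -(y * (s / t)) := by ring
  have e' : -(t + s) = -t + -s := by ring
  simp only [phase, hn, h2, e, e', AddChar.map_add_eq_mul, Circle.coe_mul,
    h₁.ext_congr (show ‖(t + s)⁻¹‖ = ‖t⁻¹‖ by rw [norm_inv, norm_inv, hn])]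
  ring

/-- The frequency `-(1 + y/t)` is trivial on `p ^ (-k) ℤ_p` iff `|t + y| p ^ k ≤ |t| = p ^ (k + 1)`,
which is independent of `k`. All other cosets cancel. -/
lemma setIntegral_phase_coset (hψ : IsUnramifiedAddChar ψ) (h₁ : IsUnramifiedChar χ₁)
    (hy : IsDual χ₂ ψ y) {t : ℚ_[p]} {k : ℤ} (ht : ‖t‖ = (p : ℝ) ^ (k + 1)) :
    ∫ s in frac p k, phase χ₁ χ₂ ψ (t + s) ∂haar p =
      if ‖t + y‖ ≤ p then phase χ₁ χ₂ ψ t * (((p : ℝ) ^ k : ℝ) : ℂ) else 0 := by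
  have hp := cast_p_pos (p := p)
  have htn : 0 < ‖t‖ := ht ▸ zpow_pos hp _
  have ht0 : t ≠ 0 := norm_pos_iff.1 htn
  rw [setIntegral_congr_fun (measurableSet_frac k)
    (g := fun s => phase χ₁ χ₂ ψ t * ψ (-(1 + y / t) * s))
    fun s hs => phase_add h₁ hy ht0 (by
      rw [ht, zpow_add_one₀ hp.ne', mul_div_cancel_right₀ _ hp.ne']; exact mem_frac.1 hs)]
  rw [integral_const_mul, setIntegral_frac_addChar hψ]
  have hiff : ‖-(1 + (y : ℚ_[p]) / t)‖ * (p : ℝ) ^ k ≤ 1 ↔ ‖t + y‖ ≤ p := by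
    rw [norm_neg, one_add_div ht0, norm_div, ht, zpow_add_one₀ hp.ne', div_mul_eq_mul_div,
      div_le_one (by positivity), mul_comm ((p : ℝ) ^ k), mul_le_mul_iff_left₀ (by positivity)]
  simp only [hiff, mul_ite, mul_zero]

lemma isCompact_sphere_padic (r : ℝ) : IsCompact (sphere (0 : ℚ_[p]) r) := isCompact_sphere _ _

lemma sphere_subset_compl_zero (k : ℤ) : sphere (0 : ℚ_[p]) ((p : ℝ) ^ k) ⊆ {0}ᶜ := by
  intro t ht h0
  rw [Set.mem_singleton_iff.1 h0] at ht
  have := zpow_pos (cast_p_pos (p := p)) k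
  simp at ht
  linarith

/-- The only coset that does not cancel is the ball of radius `p` about `-y`, of measure `p`. It
lies in the sphere `|t| = p²`, on which the cosets to be averaged have just this radius. -/
lemma setIntegral_phase_sphere (hψ : IsUnramifiedAddChar ψ) (h₁ : IsUnramifiedChar χ₁)
    (h₂ : IsTrivialMod χ₂ 2) (hy : IsDual χ₂ ψ y) (k : ℤ) :
    ∫ t in sphere 0 ((p : ℝ) ^ k), phase χ₁ χ₂ ψ t ∂haar p =
      if k = 2 then phase χ₁ χ₂ ψ (-y) * p else 0 := by
  have hp := cast_p_pos (p := p)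
  have hp1 := one_lt_cast_p (p := p)
  have hyn : ‖(y : ℚ_[p])‖ = (p : ℝ) ^ (2 : ℤ) := by simpa using hy.1
  have hlt : (p : ℝ) ^ (k - 1) < (p : ℝ) ^ k := zpow_lt_zpow_right₀ hp1 (by omega)
  have hcont := (continuousOn_phase (ψ := ψ) hψ.1 h₁ h₂).mono (sphere_subset_compl_zero (p := p) k)
  have hstab : ∀ s : ℚ_[p], ‖s‖ ≤ (p : ℝ) ^ (k - 1) → ∀ t,
      t + s ∈ sphere (0 : ℚ_[p]) ((p : ℝ) ^ k) ↔ t ∈ sphere 0 ((p : ℝ) ^ k) := by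
    intro s hs t
    simp only [mem_sphere_zero_iff_norm]
    constructor
    · intro h
      have := norm_add_eq_left_of_lt (x := t + s) (y := -s) (by rw [norm_neg, h]; linarith)
      rwa [add_neg_cancel_right, h] at this
    · intro h
      rw [norm_add_eq_left_of_lt (by linarith), h]
  split_ifs with hk
  · subst hk
    set E : Set ℚ_[p] := closedBall (-(y : ℚ_[p])) ((p : ℝ) ^ (1 : ℤ)) with hE
    have hmemE {t : ℚ_[p]} : t ∈ E ↔ ‖t + y‖ ≤ p := by simp [hE, dist_eq_norm]
    have hES : E ⊆ sphere 0 ((p : ℝ) ^ (2 : ℤ)) := by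
      intro t ht
      rw [hmemE] at ht
      rw [mem_sphere_zero_iff_norm, ← hyn, ← norm_neg (y : ℚ_[p])]
      refine norm_eq_of_norm_sub_lt ?_
      rw [sub_neg_eq_add, norm_neg, hyn]
      refine ht.trans_lt ?_
      simpa using hlt
    have hint : IntegrableOn (phase χ₁ χ₂ ψ) (sphere 0 ((p : ℝ) ^ (2 : ℤ))) (haar p) :=
      hcont.integrableOn_compact (isCompact_sphere_padic _)
    have hEo : IsOpen E := IsUltrametricDist.isOpen_closedBall _ (by positivity)
    have hzero : ∫ t in sphere 0 ((p : ℝ) ^ (2 : ℤ)) \ E, phase χ₁ χ₂ ψ t ∂haar p = 0 := by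
      refine setIntegral_eq_zero_of_average (k := 1) ((isCompact_sphere_padic _).diff hEo) ?_
        (hcont.mono Set.sdiff_subset) ?_
      · intro s hs t
        rw [Set.mem_sdiff, Set.mem_sdiff, hstab s (by simpa using hs), hmemE, hmemE]
        rw [zpow_one] at hs
        have : ‖t + s + y‖ ≤ p ↔ ‖t + y‖ ≤ p := by
          constructor
          · intro h
            have := norm_sub_le_of_le h hs
            rwa [show t + s + (y : ℚ_[p]) - s = t + y by ring] at this
          · intro h
            have := norm_add_le_of_le h hs
            rwa [show t + (y : ℚ_[p]) + s = t + s + y by ring] at this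
        rw [this]
      · rintro t ⟨ht, htE⟩
        rw [setIntegral_phase_coset hψ h₁ hy (by simpa using ht), if_neg (fun h => htE (hmemE.2 h))]
    have hsplit := setIntegral_sdiff (μ := haar p) (f := phase χ₁ χ₂ ψ) hEo.measurableSet hint hES
    rw [hzero] at hsplit
    rw [sub_eq_zero.1 hsplit.symm, hE, setIntegral_closedBall]
    have := setIntegral_phase_coset hψ h₁ hy (t := -(y : ℚ_[p])) (k := 1)
      (by rw [norm_neg, hyn]; norm_num)
    simp only [neg_add_cancel, norm_zero, hp.le, if_true, zpow_one] at this
    rw [← Complex.ofReal_natCast p, ← this]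
    congr 1
    ext s
    rw [add_comm]
  · refine setIntegral_eq_zero_of_average (k := k - 1) (isCompact_sphere_padic _) hstab hcont ?_
    intro t ht
    rw [mem_sphere_zero_iff_norm] at ht
    rw [setIntegral_phase_coset hψ h₁ hy (by simpa using ht), if_neg]
    -- Away from radius `p²` no point is stationary: `|t + y|` is the larger of two distinct norms,
    -- hence at least `p² > p`.
    have hne : ‖t‖ ≠ ‖(y : ℚ_[p])‖ := by
      rw [ht, hyn]
      exact fun h => hk (zpow_right_injective₀ hp hp1.ne' h)
    rw [IsUltrametricDist.norm_add_eq_max_of_norm_ne_norm hne, not_le]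
    refine lt_of_lt_of_le ?_ (le_max_right _ _)
    rw [hy.1]
    nlinarith

lemma setIntegral_phase_annulus (hψ : IsUnramifiedAddChar ψ) (h₁ : IsUnramifiedChar χ₁)
    (h₂ : IsTrivialMod χ₂ 2) (hy : IsDual χ₂ ψ y) (m : ℤ) {n : ℤ} (hn : 2 ≤ n) :
    ∫ t in {t : ℚ_[p] | (p : ℝ) ^ m ≤ ‖t‖ ∧ ‖t‖ ≤ (p : ℝ) ^ n}, phase χ₁ χ₂ ψ t ∂haar p =
      if m ≤ 2 then phase χ₁ χ₂ ψ (-y) * p else 0 := by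
  have hp := cast_p_pos (p := p)
  have hp1 := one_lt_cast_p (p := p)
  have hU : {t : ℚ_[p] | (p : ℝ) ^ m ≤ ‖t‖ ∧ ‖t‖ ≤ (p : ℝ) ^ n} =
      ⋃ k ∈ Finset.Icc m n, sphere 0 ((p : ℝ) ^ k) := by
    ext t
    simp only [Set.mem_ofPred_eq, Set.mem_iUnion, Finset.mem_Icc, mem_sphere_zero_iff_norm,
      exists_prop]
    constructor
    · rintro ⟨h1, h2⟩
      have ht : t ≠ 0 := norm_pos_iff.1 ((zpow_pos hp m).trans_le h1)
      have hv := Padic.norm_eq_zpow_neg_valuation ht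
      rw [hv, zpow_le_zpow_iff_right₀ hp1] at h1 h2
      exact ⟨_, ⟨h1, h2⟩, hv⟩
    · rintro ⟨k, ⟨h1, h2⟩, hk⟩
      rw [hk, zpow_le_zpow_iff_right₀ hp1, zpow_le_zpow_iff_right₀ hp1]
      exact ⟨h1, h2⟩
  rw [hU, integral_biUnion_finset]
  · simp only [setIntegral_phase_sphere hψ h₁ h₂ hy, Finset.sum_ite_eq', Finset.mem_Icc, hn,
      and_true]
  · exact fun k _ => (isCompact_sphere_padic _).measurableSet
  · intro i _ j _ hij
    refine Set.disjoint_left.2 fun t hi hj => hij ?_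
    rw [mem_sphere_zero_iff_norm] at hi hj
    exact zpow_right_injective₀ hp hp1.ne' (hi.symm.trans hj)
  · exact fun k _ => ((continuousOn_phase hψ.1 h₁ h₂).mono
      (sphere_subset_compl_zero k)).integrableOn_compact (isCompact_sphere_padic _)

end OscillatoryIntegrals

/-! ### Level groups, their double cosets, and fixed vectors in the induced model -/

section LevelVectors

open QuasiChar Topology

/-! ### Matrices -/

/-- The lower triangular matrix `(1 0; x 1)`. -/
def lMat (x : ℚ_[p]) : G p := GeneralLinearGroup.mkOfDetNeZero !![1, 0; x, 1] (by simp)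

/-- The Weyl element `(0 1; 1 0)`. -/
def wMat : G p := GeneralLinearGroup.mkOfDetNeZero !![0, 1; 1, 0] (by simp)

section entries

variable (a d : ℚ_[p]ˣ) (x : ℚ_[p]) (g h : G p)

lemma mul_entry (i j : Fin 2) : (g * h) i j = g i 0 * h 0 j + g i 1 * h 1 j := by
  rw [GeneralLinearGroup.coe_mul, Matrix.mul_apply, Fin.sum_univ_two]

lemma det_mul_val : (g * h).1.det = g.1.det * h.1.det := by
  rw [Units.val_mul, Matrix.det_mul]

lemma det_eq : g.1.det = g 0 0 * g 1 1 - g 0 1 * g 1 0 := Matrix.det_fin_two _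

lemma det_ne_zero : g.1.det ≠ 0 := (GeneralLinearGroup.det g).ne_zero

@[simp] lemma bMat_zero_zero : bMat a x d 0 0 = a := rfl
@[simp] lemma bMat_zero_one : bMat a x d 0 1 = x := rfl
@[simp] lemma bMat_one_zero : bMat a x d 1 0 = 0 := rfl
@[simp] lemma bMat_one_one : bMat a x d 1 1 = d := rfl
@[simp] lemma lMat_zero_zero : lMat x 0 0 = 1 := rfl
@[simp] lemma lMat_zero_one : lMat x 0 1 = 0 := rfl
@[simp] lemma lMat_one_zero : lMat x 1 0 = x := rfl
@[simp] lemma lMat_one_one : lMat x 1 1 = 1 := rfl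
@[simp] lemma wMat_zero_zero : (wMat : G p) 0 0 = 0 := rfl
@[simp] lemma wMat_zero_one : (wMat : G p) 0 1 = 1 := rfl
@[simp] lemma wMat_one_zero : (wMat : G p) 1 0 = 1 := rfl
@[simp] lemma wMat_one_one : (wMat : G p) 1 1 = 0 := rfl
@[simp] lemma kOne_zero_zero : (kOne : G p) 0 0 = p := rfl
@[simp] lemma kOne_zero_one : (kOne : G p) 0 1 = 0 := rfl
@[simp] lemma kOne_one_zero : (kOne : G p) 1 0 = p := rfl
@[simp] lemma kOne_one_one : (kOne : G p) 1 1 = 1 := rfl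
@[simp] lemma one_zero_zero : (1 : G p) 0 0 = 1 := rfl
@[simp] lemma one_zero_one : (1 : G p) 0 1 = 0 := rfl
@[simp] lemma one_one_zero : (1 : G p) 1 0 = 0 := rfl
@[simp] lemma one_one_one : (1 : G p) 1 1 = 1 := rfl

@[simp] lemma det_bMat : (bMat a x d).1.det = a * d := by simp [det_eq]
@[simp] lemma det_lMat : (lMat x).1.det = 1 := by simp [det_eq]
@[simp] lemma det_wMat : (wMat : G p).1.det = -1 := by simp [det_eq]
@[simp] lemma det_nMat : (nMat x).1.det = 1 := by simp [nMat]
@[simp] lemma det_aMat : (aMat a).1.det = a := by simp [aMat]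

variable {g h} in
lemma ext_entries (h00 : g 0 0 = h 0 0) (h01 : g 0 1 = h 0 1) (h10 : g 1 0 = h 1 0)
    (h11 : g 1 1 = h 1 1) : g = h := by
  refine GeneralLinearGroup.ext fun i j => ?_
  fin_cases i <;> fin_cases j <;> assumption

lemma nMat_add (x y : ℚ_[p]) : nMat (x + y) = nMat x * nMat y := by
  refine ext_entries ?_ ?_ ?_ ?_ <;> simp [nMat, mul_entry, add_comm]

lemma nMat_zero : nMat (0 : ℚ_[p]) = 1 := by
  refine ext_entries ?_ ?_ ?_ ?_ <;> simp [nMat]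

lemma kOne_eq : (kOne : G p) = aMat (Units.mk0 (p : ℚ_[p]) cast_p_ne_zero) * lMat p := by
  refine ext_entries ?_ ?_ ?_ ?_ <;> simp [aMat, mul_entry]

lemma aMat_mul (a b : ℚ_[p]ˣ) : aMat (a * b) = aMat a * aMat b := by
  refine ext_entries ?_ ?_ ?_ ?_ <;> simp [aMat, mul_entry]

lemma eq_bMat_mul_lMat (hd : g 1 1 = d) :
    ∃ A X, g = bMat A X d * lMat (g 1 0 / (d : ℚ_[p])) := by
  have hd0 := d.ne_zero
  refine ⟨Units.mk0 (g.1.det / d) (div_ne_zero (det_ne_zero g) hd0), g 0 1, ?_⟩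
  refine ext_entries ?_ ?_ ?_ ?_ <;> simp [mul_entry, det_eq, hd] <;> field_simp
  ring

lemma eq_bMat_mul_lMat_mul_aMat {u : ℚ_[p]ˣ} {x : ℚ_[p]} (hd : g 1 1 = d)
    (hc : g 1 0 = d * x * u) : ∃ A X, g = bMat A X d * lMat x * aMat u := by
  have hd0 := d.ne_zero
  have hu0 := u.ne_zero
  refine ⟨Units.mk0 (g.1.det / (d * u)) (div_ne_zero (det_ne_zero g) (mul_ne_zero hd0 hu0)),
    g 0 1, ?_⟩
  refine ext_entries ?_ ?_ ?_ ?_ <;> simp [mul_entry, det_eq, hd, hc, aMat]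
  field_simp
  ring

lemma eq_bMat_mul_wMat_mul_nMat {c : ℚ_[p]ˣ} (hc : g 1 0 = c) :
    ∃ A X, g = bMat A X c * wMat * nMat (g 1 1 / (c : ℚ_[p])) := by
  have hc0 := c.ne_zero
  refine ⟨Units.mk0 (-g.1.det / c) (div_ne_zero (neg_ne_zero.2 (det_ne_zero g)) hc0), g 0 0, ?_⟩
  refine ext_entries ?_ ?_ ?_ ?_ <;> simp [mul_entry, det_eq, hc, nMat] <;> field_simp
  ring

end entries

/-! ### The level groups -/

lemma mem_kOneSubgroup_of_entries {r : ℕ} {k : G p} (h00 : ‖k 0 0‖ ≤ 1) (h01 : ‖k 0 1‖ ≤ 1)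
    (h10 : ‖k 1 0‖ ≤ (p : ℝ) ^ (-(r : ℤ))) (h11 : ‖k 1 1 - 1‖ ≤ (p : ℝ) ^ (-(r : ℤ)))
    (hdet : ‖k.1.det‖ = 1) : k ∈ kOneSubgroup r := by
  have hr : (p : ℝ) ^ (-(r : ℤ)) ≤ 1 := zpow_le_one_of_nonpos₀ one_lt_cast_p.le (by omega)
  have h11' : ‖k 1 1‖ ≤ 1 := by
    simpa using norm_add_le_of_le (h11.trans hr) (norm_one (α := ℚ_[p])).le
  refine ⟨⟨fun i j => ?_, hdet⟩, h10, h11⟩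
  fin_cases i <;> fin_cases j <;> first | assumption | exact h10.trans hr

lemma lMat_mem {r : ℕ} {x : ℚ_[p]} (hx : ‖x‖ ≤ (p : ℝ) ^ (-(r : ℤ))) : lMat x ∈ kOneSubgroup r :=
  mem_kOneSubgroup_of_entries (by simp) (by simp) (by simpa using hx)
    (by simp) (by simp)

lemma nMat_mem (r : ℕ) {x : ℚ_[p]} (hx : ‖x‖ ≤ 1) : nMat x ∈ kOneSubgroup r :=
  mem_kOneSubgroup_of_entries (by simp [nMat]) (by simpa [nMat] using hx)
    (by simp [nMat])
    (by simp [nMat]) (by simp)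

lemma aMat_mem (r : ℕ) {u : ℚ_[p]ˣ} (hu : ‖(u : ℚ_[p])‖ = 1) : aMat u ∈ kOneSubgroup r :=
  mem_kOneSubgroup_of_entries (by simp [aMat, hu]) (by simp [aMat])
    (by simp [aMat])
    (by simp [aMat]) (by simp [hu])

lemma kOneSubgroup_subset_iwahori (r : ℕ) : (kOneSubgroup r : Set (G p)) ⊆ iwahori r :=
  fun _ hk => ⟨hk.1, hk.2.1⟩

lemma kOneSubgroup_mono {r s : ℕ} (h : r ≤ s) : (kOneSubgroup s : Set (G p)) ⊆ kOneSubgroup r := by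
  have : (p : ℝ) ^ (-(s : ℤ)) ≤ (p : ℝ) ^ (-(r : ℤ)) :=
    zpow_le_zpow_right₀ one_lt_cast_p.le (by omega)
  exact fun k hk => ⟨hk.1, hk.2.1.trans this, hk.2.2.trans this⟩

lemma continuous_entry (i j : Fin 2) : Continuous fun g : G p => g i j :=
  Units.continuous_val.matrix_elem i j

lemma kOneSubgroup_mem_nhds (r : ℕ) : (kOneSubgroup r : Set (G p)) ∈ 𝓝 1 := by
  have hr : (0 : ℝ) < (p : ℝ) ^ (-(r : ℤ)) := zpow_pos cast_p_pos _
  have key (f : G p → ℚ_[p]) (hf : Continuous f) (ε : ℝ) (hε : 0 < ε) :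
      ∀ᶠ k in 𝓝 1, ‖f k - f 1‖ ≤ ε := by
    have := hf.continuousAt (x := 1) |>.eventually (Metric.closedBall_mem_nhds (f 1) hε)
    filter_upwards [this] with k hk
    simpa [dist_eq_norm] using hk
  have hdet : Continuous fun g : G p => g.1.det := by
    simp only [det_eq]
    exact ((continuous_entry 0 0).mul (continuous_entry 1 1)).sub
      ((continuous_entry 0 1).mul (continuous_entry 1 0))
  filter_upwards [key _ (continuous_entry 0 0) 1 one_pos, key _ (continuous_entry 0 1) 1 one_pos,
    key _ (continuous_entry 1 0) _ hr, key _ (continuous_entry 1 1) _ hr,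
    key _ hdet 2⁻¹ (by norm_num)] with k h00 h01 h10 h11 hd
  refine mem_kOneSubgroup_of_entries ?_ (by simpa using h01) (by simpa using h10)
    (by simpa using h11) ?_
  · simpa using norm_add_le_of_le (x := k 0 0 - (1 : G p) 0 0) (y := 1) h00 (by simp)
  · have : ‖k.1.det - 1‖ ≤ 2⁻¹ := by simpa using hd
    simpa using norm_eq_of_norm_sub_lt (x := k.1.det) (y := 1) (by
      rw [norm_one]; exact this.trans_lt (by norm_num))

/-- Modulo `p` the matrix is upper triangular, so its unit determinant is congruent to the product
of the diagonal entries. -/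
lemma iwahori_one_one_norm {r : ℕ} (hr : r ≠ 0) {k : G p} (hk : k ∈ iwahori r) : ‖k 1 1‖ = 1 := by
  refine le_antisymm (hk.1.1 1 1) ?_
  have hd := hk.1.2
  rw [det_eq] at hd
  by_contra hlt
  push Not at hlt
  have h1 : ‖k 0 0 * k 1 1‖ < 1 := by
    rw [norm_mul]
    exact mul_lt_one_of_nonneg_of_lt_one_right (hk.1.1 0 0) (norm_nonneg _) hlt
  have h2 : ‖k 0 1 * k 1 0‖ < 1 := by
    rw [norm_mul]
    exact mul_lt_one_of_nonneg_of_lt_one_right (hk.1.1 0 1) (norm_nonneg _)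
      (hk.2.trans_lt (zpow_neg_natCast_lt_one hr))
  have h3 := IsUltrametricDist.norm_add_le_max (k 0 0 * k 1 1) (-(k 0 1 * k 1 0))
  rw [norm_neg, ← sub_eq_add_neg, hd] at h3
  exact absurd (h3.trans_lt (max_lt h1 h2)) (lt_irrefl _)

/-! ### Vectors in the principal series -/

variable {χ₁ χ₂ : QuasiChar p}

@[simp] lemma principalSeries_apply (h g : G p) (f : principalSeriesSpace χ₁ χ₂) :
    (principalSeries χ₁ χ₂ h f).1 g = f.1 (g * h) := rfl

lemma mem_levelVectors_iff {r : ℕ} {f : principalSeriesSpace χ₁ χ₂} :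
    f ∈ levelVectors (principalSeries χ₁ χ₂) r ↔ ∀ k ∈ kOneSubgroup r, ∀ g, f.1 (g * k) = f.1 g :=
  forall₂_congr fun _ _ => Subtype.ext_iff.trans funext_iff

lemma principalSeries_bMat_mul (f : principalSeriesSpace χ₁ χ₂) (a d : ℚ_[p]ˣ) (x : ℚ_[p])
    (g : G p) : f.1 (bMat a x d * g) =
      (χ₁ a : ℂ) * (χ₂ d : ℂ) * ((√‖(a : ℚ_[p]) / (d : ℚ_[p])‖ : ℝ) : ℂ) * f.1 g :=
  f.2.1 a x d g

/-- Functions with the right transformation law that are fixed by a level group. -/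
lemma mem_principalSeriesSpace_of_level {f : G p → ℂ} (r : ℕ)
    (hb : ∀ (a : ℚ_[p]ˣ) (x : ℚ_[p]) (d : ℚ_[p]ˣ) (g : G p),
      f (bMat a x d * g) =
        (χ₁ a : ℂ) * (χ₂ d : ℂ) * ((√‖(a : ℚ_[p]) / (d : ℚ_[p])‖ : ℝ) : ℂ) * f g)
    (hk : ∀ g, ∀ k ∈ kOneSubgroup r, f (g * k) = f g) : f ∈ principalSeriesSpace χ₁ χ₂ := by
  let U : Subgroup (G p) :=
    { carrier := {k | ∀ g, f (g * k) = f g}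
      one_mem' := fun g => by rw [mul_one]
      mul_mem' := fun {k l} hk hl g => by rw [← mul_assoc, hl, hk]
      inv_mem' := fun {k} hk g => by rw [← hk (g * k⁻¹), inv_mul_cancel_right] }
  refine ⟨hb, U, U.isOpen_of_mem_nhds (g := 1) ?_, fun g k hk => hk g⟩
  exact Filter.mem_of_superset (kOneSubgroup_mem_nhds r) fun k hk' g => hk g k hk'

/-- The function supported on `B I_r` with value `1` at the identity. -/
def levelFun (χ₁ χ₂ : QuasiChar p) (r : ℕ) (g : G p) : ℂ :=
  if ‖g 1 0‖ ≤ (p : ℝ) ^ (-(r : ℤ)) * ‖g 1 1‖ then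
    χ₁.ext (g.1.det / g 1 1) * χ₂.ext (g 1 1) * ((√‖g.1.det / g 1 1 ^ 2‖ : ℝ) : ℂ) else 0

lemma levelFun_bMat_mul (r : ℕ) (a : ℚ_[p]ˣ) (x : ℚ_[p]) (d : ℚ_[p]ˣ) (g : G p) :
    levelFun χ₁ χ₂ r (bMat a x d * g) =
      (χ₁ a : ℂ) * (χ₂ d : ℂ) * ((√‖(a : ℚ_[p]) / (d : ℚ_[p])‖ : ℝ) : ℂ) * levelFun χ₁ χ₂ r g := by
  have h0 : (bMat a x d * g) 1 0 = d * g 1 0 := by simp [mul_entry]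
  have h1 : (bMat a x d * g) 1 1 = d * g 1 1 := by simp [mul_entry]
  have hd : (0 : ℝ) < ‖(d : ℚ_[p])‖ := norm_pos_iff.2 d.ne_zero
  have hc : ‖(d : ℚ_[p]) * g 1 0‖ ≤ (p : ℝ) ^ (-(r : ℤ)) * ‖(d : ℚ_[p]) * g 1 1‖ ↔
      ‖g 1 0‖ ≤ (p : ℝ) ^ (-(r : ℤ)) * ‖g 1 1‖ := by
    rw [norm_mul, norm_mul, mul_left_comm, mul_le_mul_iff_right₀ hd]
  simp only [levelFun, h0, h1, hc, det_mul_val, det_bMat]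
  split_ifs with h
  · rcases eq_or_ne (g 1 1) 0 with h11 | h11
    · simp [h11]
    have e1 : (a : ℚ_[p]) * d * g.1.det / (d * g 1 1) = a * (g.1.det / g 1 1) := by
      have := d.ne_zero
      field_simp
    have e2 : (a : ℚ_[p]) * d * g.1.det / (d * g 1 1) ^ 2 = a / d * (g.1.det / g 1 1 ^ 2) := by
      have := d.ne_zero
      field_simp
    rw [e1, e2, ext_mul, ext_mul, ext_coe, ext_coe, norm_mul, Real.sqrt_mul (norm_nonneg _)]
    push_cast
    ring
  · simp

/-- On the support, `(gk)₁₁` equals `g₁₁ k₁₁` up to a factor in `1 + p ^ r ℤ_p`, which `χ₂` does not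
see. The determinant changes by a unit, which neither `χ₁` nor the norm sees. -/
lemma levelFun_mul_iwahori {r : ℕ} (hr : r ≠ 0) (h₁ : IsUnramifiedChar χ₁)
    (h₂ : IsTrivialMod χ₂ r) (g : G p) {k : G p} (hk : k ∈ iwahori r) :
    levelFun χ₁ χ₂ r (g * k) = χ₂.ext (k 1 1) * levelFun χ₁ χ₂ r g := by
  have hp := cast_p_pos (p := p)
  have hq : (0 : ℝ) < (p : ℝ) ^ (-(r : ℤ)) := zpow_pos hp _
  have hq1 := zpow_neg_natCast_lt_one (p := p) hr
  have h11 := iwahori_one_one_norm hr hk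
  have hdet := hk.1.2
  have forward (g k : G p) (hk : k ∈ iwahori r) (hg : ‖g 1 0‖ ≤ (p : ℝ) ^ (-(r : ℤ)) * ‖g 1 1‖) :
      ‖(g * k) 1 1 - g 1 1 * k 1 1‖ ≤ (p : ℝ) ^ (-(r : ℤ)) * ‖g 1 1 * k 1 1‖ ∧
        ‖(g * k) 1 0‖ ≤ (p : ℝ) ^ (-(r : ℤ)) * ‖g 1 1 * k 1 1‖ := by
    have h11 := iwahori_one_one_norm hr hk
    rw [mul_entry, mul_entry, add_sub_cancel_right, norm_mul, norm_mul, h11, mul_one]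
    refine ⟨(mul_le_of_le_one_right (norm_nonneg _) (hk.1.1 0 1)).trans hg,
      norm_add_le_of_le ?_ ?_⟩
    · rw [norm_mul]
      exact (mul_le_of_le_one_right (norm_nonneg _) (hk.1.1 0 0)).trans hg
    · rw [norm_mul, mul_comm]
      exact mul_le_mul_of_nonneg_right hk.2 (norm_nonneg _)
  have hnorm {x y : ℚ_[p]} (h : ‖x - y‖ ≤ (p : ℝ) ^ (-(r : ℤ)) * ‖y‖) : ‖x‖ = ‖y‖ := by
    rcases eq_or_ne y 0 with rfl | hy
    · simp only [sub_zero, norm_zero, mul_zero, norm_le_zero_iff] at h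
      rw [h]
    · exact norm_eq_of_norm_sub_lt (h.trans_lt
        (mul_lt_of_lt_one_left (norm_pos_iff.2 hy) hq1))
  -- Applying `forward` to `k⁻¹` gives the converse inclusion, so that the support is stable.
  have hkinv : k⁻¹ ∈ iwahori r := by
    have e : ∀ i j, k⁻¹ i j = (k.1.det)⁻¹ * (k.1.adjugate) i j := by
      intro i j
      rw [GeneralLinearGroup.coe_inv, Matrix.inv_def]
      simp
    have hn : ‖(k.1.det)⁻¹‖ = 1 := by rw [norm_inv, hdet, inv_one]
    refine ⟨⟨fun i j => ?_, ?_⟩, ?_⟩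
    · rw [e, norm_mul, hn, one_mul, Matrix.adjugate_fin_two]
      fin_cases i <;> fin_cases j <;> simp [hk.1.1]
    · have := det_mul_val k⁻¹ k
      rw [inv_mul_cancel] at this
      have h2 := congrArg norm this
      rw [norm_mul, hdet, mul_one] at h2
      rw [← h2]
      simp
    · rw [e, norm_mul, hn, one_mul, Matrix.adjugate_fin_two]
      simpa using hk.2
  have hiff : ‖(g * k) 1 0‖ ≤ (p : ℝ) ^ (-(r : ℤ)) * ‖(g * k) 1 1‖ ↔
      ‖g 1 0‖ ≤ (p : ℝ) ^ (-(r : ℤ)) * ‖g 1 1‖ := by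
    constructor
    · intro h
      obtain ⟨h1, h2⟩ := forward (g * k) k⁻¹ hkinv h
      rw [mul_inv_cancel_right] at h1 h2
      rwa [hnorm h1]
    · intro h
      obtain ⟨h1, h2⟩ := forward g k hk h
      rwa [hnorm h1]
  simp only [levelFun, hiff]
  split_ifs with h
  · obtain ⟨h1, -⟩ := forward g k hk h
    have hn := hnorm h1
    rw [norm_mul, h11, mul_one] at hn
    rw [h₂.ext_congr hr h1, ext_mul,
      h₁.ext_congr (show ‖(g * k).1.det / (g * k) 1 1‖ = ‖g.1.det / g 1 1‖ by
        rw [norm_div, norm_div, hn, det_mul_val, norm_mul, hdet, mul_one]),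
      show ‖(g * k).1.det / (g * k) 1 1 ^ 2‖ = ‖g.1.det / g 1 1 ^ 2‖ by
        rw [norm_div, norm_div, norm_pow, norm_pow, hn, det_mul_val, norm_mul, hdet, mul_one]]
    ring
  · simp

/-- The vector of level `p ^ r` supported on `B I_r`. -/
def levelVec {r : ℕ} (hr : r ≠ 0) (h₁ : IsUnramifiedChar χ₁) (h₂ : IsTrivialMod χ₂ r) :
    principalSeriesSpace χ₁ χ₂ :=
  ⟨levelFun χ₁ χ₂ r, mem_principalSeriesSpace_of_level r (levelFun_bMat_mul r) fun g k hk => by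
    rw [levelFun_mul_iwahori hr h₁ h₂ g (kOneSubgroup_subset_iwahori r hk),
      h₂.ext_eq_one hr hk.2.2, one_mul]⟩

lemma levelVec_mem {r : ℕ} (hr : r ≠ 0) (h₁ : IsUnramifiedChar χ₁) (h₂ : IsTrivialMod χ₂ r) :
    levelVec hr h₁ h₂ ∈ levelVectors (principalSeries χ₁ χ₂) r :=
  mem_levelVectors_iff.2 fun k hk g => by
    change levelFun χ₁ χ₂ r (g * k) = levelFun χ₁ χ₂ r g
    rw [levelFun_mul_iwahori hr h₁ h₂ g (kOneSubgroup_subset_iwahori r hk),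
      h₂.ext_eq_one hr hk.2.2, one_mul]

lemma levelVec_apply_one {r : ℕ} (hr : r ≠ 0) (h₁ : IsUnramifiedChar χ₁)
    (h₂ : IsTrivialMod χ₂ r) : (levelVec hr h₁ h₂).1 1 = 1 := by
  have : levelFun χ₁ χ₂ r 1 = 1 := by
    simp [levelFun]
  exact this

lemma levelVec_ne_zero {r : ℕ} (hr : r ≠ 0) (h₁ : IsUnramifiedChar χ₁)
    (h₂ : IsTrivialMod χ₂ r) : levelVec hr h₁ h₂ ≠ 0 := by
  intro h
  have := levelVec_apply_one hr h₁ h₂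
  rw [h] at this
  simp at this

/-! ### Vectors of level `p ^ 2` -/

/-- `G` is the union of the double cosets `B g K₁(p ^ 2)` for three representatives `g`. -/
lemma exists_bMat_mul (g : G p) : ∃ a x d, ∃ k ∈ (kOneSubgroup 2 : Set (G p)),
    (g = bMat a x d * k) ∨ (g = bMat a x d * lMat p * k) ∨ (g = bMat a x d * wMat * k) := by
  have hp := cast_p_pos (p := p)
  -- The coset is read off from the ratio of the norms of `g₁₀` and `g₁₁`: at least `1` gives `w`,
  -- exactly `p⁻¹` gives `l(p)`, and at most `p⁻²` gives the identity.
  rcases le_or_gt ‖g 1 1‖ ‖g 1 0‖ with h | h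
  · have hc : g 1 0 ≠ 0 := by
      intro hc
      rw [hc, norm_zero, norm_le_zero_iff] at h
      exact det_ne_zero g (by simp [det_eq, hc, h])
    obtain ⟨A, X, hg⟩ := eq_bMat_mul_wMat_mul_nMat g (c := Units.mk0 _ hc) rfl
    refine ⟨A, X, _, _, nMat_mem 2 ?_, .inr (.inr hg)⟩
    rw [Units.val_mk0, norm_div]
    exact div_le_one_of_le₀ h (norm_nonneg _)
  · have hd : g 1 1 ≠ 0 := norm_pos_iff.1 ((norm_nonneg _).trans_lt h)
    have hdn := norm_pos_iff.2 hd
    rcases (norm_le_div_of_lt h).lt_or_eq with h1 | h1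
    · obtain ⟨A, X, hg⟩ := eq_bMat_mul_lMat (d := Units.mk0 _ hd) g rfl
      refine ⟨A, X, _, _, lMat_mem ?_, .inl hg⟩
      have h2 : ‖g 1 0‖ < ‖g 1 1 * (p : ℚ_[p])‖ := by
        rwa [norm_mul, Padic.norm_p, ← div_eq_mul_inv]
      have h3 := norm_le_div_of_lt h2
      rw [norm_mul, Padic.norm_p] at h3
      rw [Units.val_mk0, norm_div, div_le_iff₀ hdn]
      refine h3.trans_eq ?_
      rw [show (-((2 : ℕ) : ℤ)) = -1 + -1 by norm_num, zpow_add₀ hp.ne', _root_.zpow_neg_one]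
      ring
    · have hc : g 1 0 ≠ 0 := norm_ne_zero_iff.1 (by rw [h1]; positivity)
      have hu : g 1 0 / (g 1 1 * p) ≠ 0 := div_ne_zero hc (mul_ne_zero hd cast_p_ne_zero)
      obtain ⟨A, X, hg⟩ := eq_bMat_mul_lMat_mul_aMat (d := Units.mk0 _ hd) g (u := Units.mk0 _ hu)
        (x := p) rfl (by
          have := cast_p_ne_zero (p := p)
          rw [Units.val_mk0, Units.val_mk0]
          field_simp)
      refine ⟨A, X, _, _, aMat_mem 2 ?_, .inr (.inl hg)⟩
      rw [Units.val_mk0, norm_div, norm_mul, h1, Padic.norm_p, ← div_eq_mul_inv]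
      exact div_self (by positivity)

lemma ext_of_level_two {f f' : principalSeriesSpace χ₁ χ₂}
    (hf : f ∈ levelVectors (principalSeries χ₁ χ₂) 2)
    (hf' : f' ∈ levelVectors (principalSeries χ₁ χ₂) 2) (h1 : f.1 1 = f'.1 1)
    (hl : f.1 (lMat p) = f'.1 (lMat p)) (hw : f.1 wMat = f'.1 wMat) : f = f' := by
  rw [mem_levelVectors_iff] at hf hf'
  ext g
  obtain ⟨a, x, d, k, hk, rfl | rfl | rfl⟩ := exists_bMat_mul g
  · rw [hf k hk, hf' k hk, ← mul_one (bMat a x d), principalSeries_bMat_mul,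
      principalSeries_bMat_mul, h1]
  · rw [hf k hk, hf' k hk, principalSeries_bMat_mul, principalSeries_bMat_mul, hl]
  · rw [hf k hk, hf' k hk, principalSeries_bMat_mul, principalSeries_bMat_mul, hw]

/-- If `f` is fixed by `k` and `g k = b g` with `b` upper triangular, then `f(g) = 0` unless the
inducing character is trivial on `b`. -/
lemma char_eq_one_of_stabilizer {f : principalSeriesSpace χ₁ χ₂} {r : ℕ}
    (hf : f ∈ levelVectors (principalSeries χ₁ χ₂) r) {g k : G p} (hk : k ∈ kOneSubgroup r)
    {a d : ℚ_[p]ˣ} {x : ℚ_[p]} (ha : ‖(a : ℚ_[p])‖ = 1) (hd : ‖(d : ℚ_[p])‖ = 1)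
    (hb : g * k = bMat a x d * g) (hg : f.1 g ≠ 0) : (χ₁ a : ℂ) * χ₂ d = 1 := by
  have h := mem_levelVectors_iff.1 hf k hk g
  rw [hb, principalSeries_bMat_mul, norm_div, ha, hd] at h
  simpa [hg] using h

lemma characters_of_apply_one_ne_zero {f : principalSeriesSpace χ₁ χ₂} {r : ℕ}
    (hf : f ∈ levelVectors (principalSeries χ₁ χ₂) r) (h : f.1 1 ≠ 0) :
    IsUnramifiedChar χ₁ ∧ IsTrivialMod χ₂ r := by
  refine ⟨fun u hu => ?_, fun u hu hu1 => ?_⟩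
  · have := char_eq_one_of_stabilizer hf (aMat_mem r hu) (a := u) (d := 1) (x := 0) hu (by simp)
      (by rw [one_mul, mul_one, aMat]) h
    exact Units.ext (by simpa using this)
  · have := char_eq_one_of_stabilizer hf (k := bMat 1 0 u) (a := 1) (d := u) (x := 0)
      (mem_kOneSubgroup_of_entries (by simp) (by simp) (by simp)
        (by simpa using hu1) (by simpa using hu)) (by simp) hu
      (by rw [one_mul, mul_one]) h
    exact Units.ext (by simpa using this)

lemma characters_of_apply_wMat_ne_zero {f : principalSeriesSpace χ₁ χ₂} {r : ℕ}
    (hf : f ∈ levelVectors (principalSeries χ₁ χ₂) r) (h : f.1 wMat ≠ 0) :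
    IsTrivialMod χ₁ r ∧ IsUnramifiedChar χ₂ := by
  refine ⟨fun u hu hu1 => ?_, fun u hu => ?_⟩
  · have := char_eq_one_of_stabilizer hf (k := bMat 1 0 u) (a := u) (d := 1) (x := 0)
      (mem_kOneSubgroup_of_entries (by simp) (by simp) (by simp)
        (by simpa using hu1) (by simpa using hu)) hu (by simp)
      (by refine ext_entries ?_ ?_ ?_ ?_ <;> simp [mul_entry]) h
    exact Units.ext (by simpa using this)
  · have := char_eq_one_of_stabilizer hf (aMat_mem r hu) (a := 1) (d := u) (x := 0) (by simp) hu
      (by refine ext_entries ?_ ?_ ?_ ?_ <;> simp [mul_entry, aMat]) h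
    exact Units.ext (by simpa using this)

/-- Conjugating by `l(p)` costs one power of `p`, so the stabilizer contains only diagonal units
congruent to `1` modulo `p`. This is the coset that twist-minimality excludes. -/
lemma characters_of_apply_lMat_ne_zero {f : principalSeriesSpace χ₁ χ₂}
    (hf : f ∈ levelVectors (principalSeries χ₁ χ₂) 2) (h : f.1 (lMat p) ≠ 0) :
    IsTrivialMod χ₁ 1 ∧ IsTrivialMod χ₂ 1 := by
  have hp := cast_p_pos (p := p)
  have hp0 := cast_p_ne_zero (p := p)
  refine ⟨fun u hu hu1 => ?_, fun u hu hu1 => ?_⟩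
  · have := char_eq_one_of_stabilizer hf
      -- Solving `l(p) k = diag(u, 1) l(p)` gives the lower left entry `p(1 - u)`, divisible by `p²`
      -- because `u ≡ 1` modulo `p`.
      (k := bMat u 0 1 * lMat ((p : ℚ_[p]) * (1 - (u : ℚ_[p])))) (a := u) (d := 1) (x := 0)
      (mem_kOneSubgroup_of_entries (by simp [mul_entry, hu]) (by simp [mul_entry])
        (by
          rw [norm_sub_rev] at hu1
          simp only [mul_entry, bMat_one_zero, bMat_one_one, lMat_one_zero, lMat_zero_zero,
            Units.val_one, zero_mul, one_mul, zero_add, norm_mul, Padic.norm_p]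
          calc _ ≤ (p : ℝ)⁻¹ * (p : ℝ) ^ (-((1 : ℕ) : ℤ)) := by gcongr
            _ = _ := by norm_num [_root_.zpow_neg, sq])
        (by simp [mul_entry])
        (by simp [hu])) hu (by simp)
      (by refine ext_entries ?_ ?_ ?_ ?_ <;> simp [mul_entry]; ring) h
    exact Units.ext (by simpa using this)
  · have := char_eq_one_of_stabilizer hf
      -- Here `l(p) k = (1 x; 0 u) l(p)` with `x = (u - 1)/p`, which is integral because `u ≡ 1`
      -- modulo `p`.
      (k := bMat u ((u - 1) / p) 1) (a := 1) (d := u) (x := (u - 1) / p)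
      (mem_kOneSubgroup_of_entries (by simp [hu])
        (by
          rw [bMat_zero_one, norm_div, Padic.norm_p, div_inv_eq_mul]
          calc _ ≤ (p : ℝ) ^ (-((1 : ℕ) : ℤ)) * p := by gcongr
            _ = 1 := by simp [hp.ne'])
        (by simp) (by simp)
        (by simp [hu])) (by simp) hu
      (by refine ext_entries ?_ ?_ ?_ ?_ <;> simp [mul_entry] <;> field_simp; ring) h
    exact Units.ext (by simpa using this)

end LevelVectors

/-! ### Existence and uniqueness of Whittaker functionals by restriction to the big cell -/

section WhittakerFunctionals

open MeasureTheory Metric QuasiChar Topology Filter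

variable {χ₁ χ₂ : QuasiChar p} {ψ : AddChar ℚ_[p] Circle}

/-! ### Restriction to the big cell -/

lemma continuous_nMat : Continuous (nMat : ℚ_[p] → G p) := by
  have hinv (x : ℚ_[p]) : (nMat x)⁻¹ = nMat (-x) :=
    inv_eq_of_mul_eq_one_right (by rw [← nMat_add, add_neg_cancel, nMat_zero])
  have hval : Continuous fun x : ℚ_[p] => (nMat x).1 := by
    refine continuous_matrix fun i j => ?_
    fin_cases i <;> fin_cases j
    · exact continuous_const
    · exact continuous_id
    · exact continuous_const
    · exact continuous_const
  refine Units.continuous_iff.2 ⟨hval, ?_⟩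
  simp only [hinv]
  exact hval.comp continuous_neg

lemma lMat_eq_wMat_mul_nMat_mul_wMat (x : ℚ_[p]) : lMat x = wMat * nMat x * wMat := by
  refine ext_entries ?_ ?_ ?_ ?_ <;> simp [mul_entry, nMat]

lemma lMat_zero : lMat (0 : ℚ_[p]) = 1 := by
  refine ext_entries ?_ ?_ ?_ ?_ <;> simp

lemma continuous_lMat : Continuous (lMat : ℚ_[p] → G p) := by
  rw [show (lMat : ℚ_[p] → G p) = fun x => wMat * nMat x * wMat from
    funext lMat_eq_wMat_mul_nMat_mul_wMat]
  exact (continuous_const.mul continuous_nMat).mul continuous_const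

lemma eventually_fixed (f : principalSeriesSpace χ₁ χ₂) : ∀ᶠ k in 𝓝 (1 : G p), ∀ g,
    f.1 (g * k) = f.1 g := by
  obtain ⟨U, hU, hf⟩ := f.2.2
  filter_upwards [hU.mem_nhds U.one_mem] with k hk g using hf g k hk

lemma eventually_fixed_nMat (f : principalSeriesSpace χ₁ χ₂) : ∀ᶠ s in 𝓝 (0 : ℚ_[p]), ∀ g,
    f.1 (g * nMat s) = f.1 g :=
  (continuous_nMat (p := p)).continuousAt (x := 0) |>.eventually (by
    rw [nMat_zero]
    exact eventually_fixed f)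

lemma eventually_fixed_lMat (f : principalSeriesSpace χ₁ χ₂) : ∀ᶠ s in 𝓝 (0 : ℚ_[p]), ∀ g,
    f.1 (g * lMat s) = f.1 g :=
  (continuous_lMat (p := p)).continuousAt (x := 0) |>.eventually (by
    rw [lMat_zero]
    exact eventually_fixed f)

/-- The restriction `t ↦ f(w n(t))` of `f` to the big cell. -/
def bigCell (f : principalSeriesSpace χ₁ χ₂) (t : ℚ_[p]) : ℂ := f.1 (wMat * nMat t)

lemma bigCell_nMat (f : principalSeriesSpace χ₁ χ₂) (x t : ℚ_[p]) :
    bigCell (principalSeries χ₁ χ₂ (nMat x) f) t = bigCell f (t + x) := by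
  rw [bigCell, bigCell, principalSeries_apply, nMat_add, mul_assoc]

lemma continuous_bigCell (f : principalSeriesSpace χ₁ χ₂) : Continuous (bigCell f) := by
  refine continuous_iff_continuousAt.2 fun t => ?_
  refine (continuousAt_const (y := bigCell f t)).congr ?_
  have h : Tendsto (fun t' => t' - t) (𝓝 t) (𝓝 0) := by
    have : Continuous fun t' => t' - t := by fun_prop
    simpa using this.tendsto t
  filter_upwards [h.eventually (eventually_fixed_nMat f)] with t' ht'
  rw [bigCell, bigCell, ← ht', mul_assoc, ← nMat_add, add_sub_cancel]

lemma wMat_mul_nMat_eq {t : ℚ_[p]} (ht : t ≠ 0) :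
    ∃ A X, wMat * nMat t = bMat A X (Units.mk0 t ht) * lMat t⁻¹ := by
  obtain ⟨A, X, h⟩ := eq_bMat_mul_lMat (wMat * nMat t) (d := Units.mk0 t ht)
    (by simp [mul_entry, nMat])
  exact ⟨A, X, by simpa [mul_entry, nMat] using h⟩

/-- Functions vanishing at the identity have compact support on the big cell. -/
lemma exists_bigCell_eq_zero {f : principalSeriesSpace χ₁ χ₂} (hf : f.1 1 = 0) :
    ∃ N : ℤ, ∀ t, (p : ℝ) ^ N < ‖t‖ → bigCell f t = 0 := by
  obtain ⟨ε, hε, h⟩ := Metric.eventually_nhds_iff.1 (eventually_fixed_lMat f)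
  obtain ⟨n, hn⟩ := pow_unbounded_of_one_lt ε⁻¹ (one_lt_cast_p (p := p))
  refine ⟨n, fun t ht => ?_⟩
  rw [zpow_natCast] at ht
  have ht0 : t ≠ 0 := norm_pos_iff.1 ((inv_pos.2 hε).trans (hn.trans ht))
  have hs : dist t⁻¹ 0 < ε := by
    rw [dist_zero_right, norm_inv]
    exact inv_lt_of_inv_lt₀ hε (hn.trans ht)
  -- For large `t` the point `w n(t)` lies in `B l(t⁻¹)`, and `l(t⁻¹)` is close enough to the
  -- identity to fix `f`.
  obtain ⟨A, X, hA⟩ := wMat_mul_nMat_eq ht0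
  rw [bigCell, hA, h hs, ← mul_one (bMat _ _ _), principalSeries_bMat_mul, hf, mul_zero]

/-- Bruhat decomposition: `G` is the union of `B` and `B w N`. -/
lemma ext_of_bigCell {f f' : principalSeriesSpace χ₁ χ₂} (h1 : f.1 1 = f'.1 1)
    (h : ∀ t, bigCell f t = bigCell f' t) : f = f' := by
  ext g
  rcases eq_or_ne (g 1 0) 0 with hc | hc
  · have hd : g 1 1 ≠ 0 := fun hd => det_ne_zero g (by simp [det_eq, hc, hd])
    obtain ⟨A, X, hg⟩ := eq_bMat_mul_lMat (d := Units.mk0 _ hd) g rfl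
    rw [hc, zero_div, lMat_zero] at hg
    rw [hg, principalSeries_bMat_mul, principalSeries_bMat_mul, h1]
  · obtain ⟨A, X, hg⟩ := eq_bMat_mul_wMat_mul_nMat g (c := Units.mk0 _ hc) rfl
    rw [hg, mul_assoc, principalSeries_bMat_mul, principalSeries_bMat_mul]
    congr 1
    exact h _

/-! ### Existence of Whittaker functionals -/

lemma continuous_coe_neg (hψ : Continuous ψ) : Continuous fun t : ℚ_[p] => (ψ (-t) : ℂ) := by
  fun_prop

/-- The truncated Jacquet integral. -/
def jacquet (hψ : Continuous ψ) (n : ℤ) : principalSeriesSpace χ₁ χ₂ →ₗ[ℂ] ℂ where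
  toFun f := ∫ t in frac p n, bigCell f t * ψ (-t) ∂haar p
  map_add' f f' := by
    have hint (f : principalSeriesSpace χ₁ χ₂) :
        IntegrableOn (fun t => bigCell f t * ψ (-t)) (frac p n) (haar p) :=
      ((continuous_bigCell f).mul
        (continuous_coe_neg hψ)).continuousOn.integrableOn_compact (isCompact_closedBall _ _)
    rw [← integral_add (hint f) (hint f')]
    exact integral_congr_ae (Eventually.of_forall fun t => add_mul _ _ _)
  map_smul' c f := by
    rw [RingHom.id_apply, smul_eq_mul, ← integral_const_mul]
    exact integral_congr_ae (Eventually.of_forall fun t => mul_assoc _ _ _)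

lemma jacquet_apply (hψ : Continuous ψ) (n : ℤ) (f : principalSeriesSpace χ₁ χ₂) :
    jacquet hψ n f = ∫ t in frac p n, bigCell f t * ψ (-t) ∂haar p := rfl

lemma jacquet_nMat (hψ : Continuous ψ) {n : ℤ} {x : ℚ_[p]} (hx : ‖x‖ ≤ (p : ℝ) ^ n)
    (f : principalSeriesSpace χ₁ χ₂) :
    jacquet hψ n (principalSeries χ₁ χ₂ (nMat x) f) = ψ x * jacquet hψ n f := by
  rw [jacquet_apply, jacquet_apply, ← setIntegral_frac_add (fun t => bigCell f t * ψ (-t)) hx,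
    ← integral_const_mul]
  refine integral_congr_ae (Eventually.of_forall fun t => ?_)
  have h : (ψ x : ℂ) * ψ (-(t + x)) = ψ (-t) := by
    rw [← Circle.coe_mul, ← AddChar.map_add_eq_mul]
    congr 2
    ring
  simp only [bigCell_nMat]
  rw [mul_left_comm, h]

lemma jacquet_eq_of_support (hψ : Continuous ψ) {f : principalSeriesSpace χ₁ χ₂} {S : Set ℚ_[p]}
    {n : ℤ} (hS : S ⊆ frac p n) (hf : ∀ t ∈ frac p n, t ∉ S → bigCell f t = 0) :
    jacquet hψ n f = ∫ t in S, bigCell f t * ψ (-t) ∂haar p := by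
  rw [jacquet_apply]
  exact setIntegral_eq_of_subset_of_forall_sdiff_eq_zero (measurableSet_frac n) hS
    fun t ht => by rw [hf t ht.1 ht.2, zero_mul]

/-- The integral of `f` over the whole big cell need not converge absolutely. The difference
`π(n(x)) f - f` vanishes at the identity, hence has compact support on the big cell, and its
truncated integrals are eventually constant. They equal `ψ(x) - 1 ≠ 0` times those of `f` once `x`
lies in the domain of truncation. -/
lemma exists_eventually_jacquet_eq (hψ : IsUnramifiedAddChar ψ) (f : principalSeriesSpace χ₁ χ₂) :
    ∃ c, ∀ᶠ n in atTop, jacquet hψ.1 n f = c := by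
  obtain ⟨x, hx, hx1⟩ := hψ.2.2
  have hx1' : (ψ x : ℂ) - 1 ≠ 0 := sub_ne_zero.2 (by simpa [Circle.ext_iff] using hx1)
  set f' := principalSeries χ₁ χ₂ (nMat x) f - f with hf'
  have h1 : f'.1 1 = 0 := by
    have h := principalSeries_bMat_mul f 1 1 x 1
    change f.1 (1 * nMat x) - f.1 1 = 0
    rw [one_mul, ← mul_one (nMat x), nMat, h]
    simp
  obtain ⟨N, hN⟩ := exists_bigCell_eq_zero h1
  refine ⟨((ψ x : ℂ) - 1)⁻¹ * jacquet hψ.1 N f', ?_⟩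
  filter_upwards [eventually_ge_atTop N, eventually_ge_atTop 1] with n hn hn1
  have hp := one_lt_cast_p (p := p)
  have h2 : jacquet hψ.1 n f' = ((ψ x : ℂ) - 1) * jacquet hψ.1 n f := by
    rw [hf', map_sub, jacquet_nMat, sub_one_mul]
    refine hx.trans ?_
    simpa using zpow_le_zpow_right₀ hp.le hn1
  rw [eq_inv_mul_iff_mul_eq₀ hx1', ← h2]
  refine jacquet_eq_of_support hψ.1 (closedBall_subset_closedBall (zpow_le_zpow_right₀ hp.le hn)) ?_
  intro t _ ht
  exact hN t (by simpa using ht)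

/-- The stable value of the truncated Jacquet integrals. -/
def jacquetLimit (hψ : IsUnramifiedAddChar ψ) : principalSeriesSpace χ₁ χ₂ →ₗ[ℂ] ℂ where
  toFun f := (exists_eventually_jacquet_eq hψ f).choose
  map_add' f f' := by
    obtain ⟨n, h1, h2, h3⟩ := ((exists_eventually_jacquet_eq hψ (f + f')).choose_spec.and
      ((exists_eventually_jacquet_eq hψ f).choose_spec.and
        (exists_eventually_jacquet_eq hψ f').choose_spec)).exists
    rw [← h1, ← h2, ← h3, map_add]
  map_smul' c f := by
    obtain ⟨n, h1, h2⟩ := ((exists_eventually_jacquet_eq hψ (c • f)).choose_spec.and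
      (exists_eventually_jacquet_eq hψ f).choose_spec).exists
    rw [← h1, ← h2, map_smul, RingHom.id_apply]

lemma eventually_jacquet_eq (hψ : IsUnramifiedAddChar ψ) (f : principalSeriesSpace χ₁ χ₂) :
    ∀ᶠ n in atTop, jacquet hψ.1 n f = jacquetLimit hψ f :=
  (exists_eventually_jacquet_eq hψ f).choose_spec

lemma jacquetLimit_eq_of_eventually (hψ : IsUnramifiedAddChar ψ) {f : principalSeriesSpace χ₁ χ₂}
    {c : ℂ} (h : ∀ᶠ n in atTop, jacquet hψ.1 n f = c) : jacquetLimit hψ f = c := by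
  obtain ⟨n, h1, h2⟩ := (h.and (eventually_jacquet_eq hψ f)).exists
  rw [← h1, h2]

lemma eventually_le_zpow (r : ℝ) : ∀ᶠ n : ℤ in atTop, r ≤ (p : ℝ) ^ n := by
  obtain ⟨m, hm⟩ := pow_unbounded_of_one_lt r (one_lt_cast_p (p := p))
  filter_upwards [eventually_ge_atTop (m : ℤ)] with n hn
  refine hm.le.trans ?_
  simpa using zpow_le_zpow_right₀ (one_lt_cast_p (p := p)).le hn

lemma jacquetLimit_nMat (hψ : IsUnramifiedAddChar ψ) (x : ℚ_[p])
    (f : principalSeriesSpace χ₁ χ₂) :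
    jacquetLimit hψ (principalSeries χ₁ χ₂ (nMat x) f) = ψ x * jacquetLimit hψ f := by
  refine jacquetLimit_eq_of_eventually hψ ?_
  filter_upwards [eventually_jacquet_eq hψ f, eventually_le_zpow (p := p) ‖x‖] with n h1 h2
  rw [jacquet_nMat hψ.1 h2, h1]

/-- If the support on the big cell is compact, the Jacquet integral is a plain integral. -/
lemma jacquetLimit_eq_setIntegral (hψ : IsUnramifiedAddChar ψ) {f : principalSeriesSpace χ₁ χ₂}
    {S : Set ℚ_[p]} (hS : Bornology.IsBounded S) (hf : ∀ t, t ∉ S → bigCell f t = 0) :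
    jacquetLimit hψ f = ∫ t in S, bigCell f t * ψ (-t) ∂haar p := by
  refine jacquetLimit_eq_of_eventually hψ ?_
  obtain ⟨R, hR⟩ := hS.subset_closedBall (0 : ℚ_[p])
  filter_upwards [eventually_le_zpow (p := p) R] with n hn
  exact jacquet_eq_of_support hψ.1 (hR.trans (closedBall_subset_closedBall hn)) fun t _ => hf t

/-! ### Uniqueness of Whittaker functionals -/

/-- The fractional ideal `p ^ (-n) ℤ_p` as a subgroup. -/
def fracSubgroup (p : ℕ) [Fact p.Prime] (n : ℤ) : AddSubgroup ℚ_[p] where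
  carrier := frac p n
  add_mem' ha hb := mem_frac.2 (norm_add_le_of_le (mem_frac.1 ha) (mem_frac.1 hb))
  zero_mem' := mem_frac.2 (by simpa using zpow_nonneg cast_p_pos.le n)
  neg_mem' ha := mem_frac.2 (by rw [norm_neg]; exact mem_frac.1 ha)

lemma mem_fracSubgroup {n : ℤ} {t : ℚ_[p]} : t ∈ fracSubgroup p n ↔ ‖t‖ ≤ (p : ℝ) ^ n := mem_frac

/-- Averaging `ψ⁻¹(x) π(n(x)) f` over a large compact subgroup of the unipotent radical. -/
lemma exists_average (hψ : IsUnramifiedAddChar ψ) {f : principalSeriesSpace χ₁ χ₂}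
    (hf : f.1 1 = 0) : ∃ N : ℤ, ∀ n ≥ N, ∃ (h : principalSeriesSpace χ₁ χ₂) (c : ℂ), c ≠ 0 ∧
      (∀ Λ : principalSeriesSpace χ₁ χ₂ →ₗ[ℂ] ℂ,
        (∀ x v, Λ (principalSeries χ₁ χ₂ (nMat x) v) = ψ x * Λ v) → Λ h = c * Λ f) ∧
      h.1 1 = 0 ∧ ∀ t, bigCell h t = if ‖t‖ ≤ (p : ℝ) ^ n then ψ t * bigCell h 0 else 0 := by
  obtain ⟨N, hN⟩ := exists_bigCell_eq_zero hf
  refine ⟨N, fun n hn => ?_⟩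
  set π := principalSeries χ₁ χ₂
  let A := fracSubgroup p n
  have hA : CompactSpace A := isCompact_iff_compactSpace.1 (isCompact_closedBall _ _)
  have hπ (x y : ℚ_[p]) (v) : π (nMat (x + y)) v = π (nMat x) (π (nMat y) v) := by
    rw [nMat_add, map_mul, Module.End.mul_apply]
  -- The integrand `ψ(-x) π(n(x)) f` is constant on cosets of the open subgroup `M` of the compact
  -- group `A`. So the average is a finite sum over `A / M`, and no vector-valued integration is
  -- needed.
  let M : AddSubgroup A :=
    { carrier := {x | ψ x = 1 ∧ π (nMat x) f = f}
      zero_mem' := by simp [nMat_zero]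
      add_mem' := by
        rintro x y ⟨hx, hx'⟩ ⟨hy, hy'⟩
        refine ⟨?_, ?_⟩
        · rw [AddSubgroup.coe_add, AddChar.map_add_eq_mul, hx, hy, mul_one]
        · rw [AddSubgroup.coe_add, hπ, hy', hx']
      neg_mem' := by
        rintro x ⟨hx, hx'⟩
        refine ⟨?_, ?_⟩
        · rw [AddSubgroup.coe_neg, AddChar.map_neg_eq_inv, hx, inv_one]
        · rw [AddSubgroup.coe_neg]
          nth_rw 1 [← hx']
          rw [← hπ, neg_add_cancel, nMat_zero, map_one, Module.End.one_apply] }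
  have hM : IsOpen (M : Set A) := by
    refine M.isOpen_of_mem_nhds (g := 0) ?_
    have h1 : ∀ᶠ x in 𝓝 (0 : ℚ_[p]), ψ x = 1 ∧ π (nMat x) f = f := by
      filter_upwards [closedBall_mem_nhds (0 : ℚ_[p]) one_pos, eventually_fixed_nMat f]
        with x hx hx'
      refine ⟨hψ.2.1 x (by simpa using hx), ?_⟩
      ext g
      exact hx' g
    exact continuous_subtype_val.continuousAt (x := (0 : A)) |>.eventually h1
  have hfin : Finite (A ⧸ M) := AddSubgroup.quotient_finite_of_isOpen M hM
  have := Fintype.ofFinite (A ⧸ M)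
  let F : A → principalSeriesSpace χ₁ χ₂ := fun x => (ψ (-x) : ℂ) • π (nMat x) f
  have hF {x y : A} (h : (x : A ⧸ M) = y) : F x = F y := by
    obtain ⟨h1, h2⟩ := QuotientAddGroup.eq.1 h
    have e : (y : ℚ_[p]) = x + ((-x + y : A) : ℚ_[p]) := by simp
    have e1 : ψ (-y) = ψ (-x) := by
      rw [e, neg_add, AddChar.map_add_eq_mul, AddChar.map_neg_eq_inv ψ ((-x + y : A) : ℚ_[p]), h1,
        inv_one, mul_one]
    have e2 : π (nMat y) f = π (nMat x) f := by rw [e, hπ, h2]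
    simp only [F, e1, e2]
  let h : principalSeriesSpace χ₁ χ₂ := ∑ q : A ⧸ M, F q.out
  have hval (g : G p) : h.1 g = ∑ q : A ⧸ M, (F q.out).1 g := by
    simp only [h, AddSubmonoidClass.coe_finsetSum, Finset.sum_apply]
  -- Translation by `s` permutes the cosets. This equivariance fixes `h` on `p ^ (-n) ℤ_p` up to its
  -- value at `0`; outside, `h` vanishes because every translate of `f` does.
  have hequiv (s : A) : π (nMat s) h = (ψ s : ℂ) • h := by
    have h1 (x : A) : π (nMat s) (F x) = (ψ s : ℂ) • F (s + x) := by
      simp only [F, map_smul, AddSubgroup.coe_add, hπ, smul_smul, ← Circle.coe_mul,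
        ← AddChar.map_add_eq_mul]
      congr 4
      ring
    simp only [h, map_sum, h1, Finset.smul_sum]
    refine Fintype.sum_equiv (Equiv.addLeft (s : A ⧸ M)) _ _ fun q => ?_
    rw [hF (x := s + q.out) (y := (Equiv.addLeft (s : A ⧸ M) q).out)]
    simp
  refine ⟨h, Fintype.card (A ⧸ M), ?_, fun Λ hΛ => ?_, ?_, fun t => ?_⟩
  · exact_mod_cast Fintype.card_ne_zero
  · have h1 (x : A) : Λ (F x) = Λ f := by
      simp only [F, map_smul, hΛ, smul_eq_mul]
      rw [← mul_assoc, ← Circle.coe_mul, ← AddChar.map_add_eq_mul, neg_add_cancel,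
        AddChar.map_zero_eq_one, Circle.coe_one, one_mul]
    simp only [h, map_sum, h1, Finset.sum_const, Finset.card_univ, nsmul_eq_mul]
  · rw [hval]
    refine Finset.sum_eq_zero fun q _ => ?_
    change (ψ _ : ℂ) * f.1 (1 * nMat _) = 0
    rw [one_mul, ← mul_one (nMat _), nMat, principalSeries_bMat_mul, hf, mul_zero, mul_zero]
  · split_ifs with ht
    · have h1 := hequiv ⟨t, mem_fracSubgroup.2 ht⟩
      have h2 := bigCell_nMat h t 0
      rw [zero_add] at h2
      rw [← h2]
      exact congrArg (fun v => bigCell v 0) h1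
    · rw [bigCell, hval]
      refine Finset.sum_eq_zero fun q _ => ?_
      change (ψ _ : ℂ) * bigCell (π (nMat _) f) t = 0
      push Not at ht
      rw [bigCell_nMat, hN, mul_zero]
      rw [norm_add_eq_left_of_lt ((mem_fracSubgroup.1 (Quotient.out q).2).trans_lt ht)]
      exact (zpow_le_zpow_right₀ one_lt_cast_p.le hn).trans_lt ht

/-- Averaged with the same `n`, both vectors become multiples of `ψ` restricted to `p ^ (-n) ℤ_p`,
so they are proportional. Averaging scales every Whittaker functional by the same nonzero constant.
-/
lemma whittaker_mul_comm (hψ : IsUnramifiedAddChar ψ)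
    {Λ Λ' : principalSeriesSpace χ₁ χ₂ →ₗ[ℂ] ℂ}
    (hΛ : ∀ x v, Λ (principalSeries χ₁ χ₂ (nMat x) v) = ψ x * Λ v)
    (hΛ' : ∀ x v, Λ' (principalSeries χ₁ χ₂ (nMat x) v) = ψ x * Λ' v)
    {f f' : principalSeriesSpace χ₁ χ₂} (hf : f.1 1 = 0) (hf' : f'.1 1 = 0) :
    Λ f * Λ' f' = Λ' f * Λ f' := by
  obtain ⟨N, hN⟩ := exists_average hψ hf
  obtain ⟨N', hN'⟩ := exists_average hψ hf'
  obtain ⟨h, c, hc, hL, h1, hb⟩ := hN (max N N') (le_max_left _ _)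
  obtain ⟨h', c', hc', hL', h1', hb'⟩ := hN' (max N N') (le_max_right _ _)
  have key : bigCell h' 0 • h = bigCell h 0 • h' := by
    refine ext_of_bigCell ?_ fun t => ?_
    · change bigCell h' 0 * h.1 1 = bigCell h 0 * h'.1 1
      rw [h1, h1', mul_zero, mul_zero]
    · change bigCell h' 0 * bigCell h t = bigCell h 0 * bigCell h' t
      rw [hb t, hb' t]
      split_ifs
      · ring
      · simp
  have e1 := congrArg Λ key
  have e2 := congrArg Λ' key
  simp only [map_smul, smul_eq_mul, hL Λ hΛ, hL Λ' hΛ', hL' Λ hΛ, hL' Λ' hΛ'] at e1 e2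
  -- In this degenerate case `h' = 0`, so both functionals vanish on `f'`.
  by_cases h0 : bigCell h' 0 = 0
  · have hz : h' = 0 := ext_of_bigCell h1' fun t => by
      rw [hb' t, h0]
      simp [bigCell]
    have z1 := hL' Λ hΛ
    have z2 := hL' Λ' hΛ'
    rw [hz, map_zero, zero_eq_mul] at z1 z2
    rw [z1.resolve_left hc', z2.resolve_left hc']
    ring
  · apply mul_left_cancel₀ (mul_ne_zero h0 hc)
    linear_combination Λ' f' * e1 - Λ f' * e2

/-- Uniqueness of Whittaker functionals up to scalars. -/
theorem exists_eq_smul_of_whittaker (hψ : IsUnramifiedAddChar ψ)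
    {Λ Λ' : principalSeriesSpace χ₁ χ₂ →ₗ[ℂ] ℂ}
    (hΛ : IsWhittakerFunctional (principalSeries χ₁ χ₂) ψ Λ)
    (hΛ' : IsWhittakerFunctional (principalSeries χ₁ χ₂) ψ Λ') : ∃ c : ℂ, c ≠ 0 ∧ Λ' = c • Λ := by
  obtain ⟨x, -, hx1⟩ := hψ.2.2
  have hx : (ψ x : ℂ) - 1 ≠ 0 := sub_ne_zero.2 (by simpa [Circle.ext_iff] using hx1)
  -- `D` maps into the functions vanishing at the identity and scales every Whittaker functional by
  -- `ψ(x) - 1 ≠ 0`, which reduces the claim to `whittaker_mul_comm`.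
  let D (f : principalSeriesSpace χ₁ χ₂) := principalSeries χ₁ χ₂ (nMat x) f - f
  have hD1 (f) : (D f).1 1 = 0 := by
    have h := principalSeries_bMat_mul f 1 1 x 1
    change f.1 (1 * nMat x) - f.1 1 = 0
    rw [one_mul, ← mul_one (nMat x), nMat, h]
    simp
  have hD {Λ : principalSeriesSpace χ₁ χ₂ →ₗ[ℂ] ℂ}
      (hΛ : IsWhittakerFunctional (principalSeries χ₁ χ₂) ψ Λ) (f) :
      Λ (D f) = ((ψ x : ℂ) - 1) * Λ f := by rw [map_sub, hΛ.2, sub_one_mul]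
  obtain ⟨f₀, hf₀⟩ : ∃ f, Λ f ≠ 0 := by
    by_contra! h
    exact hΛ.1 (LinearMap.ext h)
  have key (f) : Λ' f = (Λ' f₀ / Λ f₀) * Λ f := by
    have := whittaker_mul_comm hψ hΛ.2 hΛ'.2 (hD1 f) (hD1 f₀)
    rw [hD hΛ, hD hΛ, hD hΛ', hD hΛ'] at this
    have h2 : Λ f * Λ' f₀ = Λ' f * Λ f₀ := by
      apply mul_left_cancel₀ (mul_ne_zero hx hx)
      linear_combination this
    field_simp
    linear_combination -h2
  refine ⟨Λ' f₀ / Λ f₀, fun h0 => hΛ'.1 (LinearMap.ext fun f => ?_), LinearMap.ext key⟩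
  rw [key, h0, zero_mul, LinearMap.zero_apply]

end WhittakerFunctionals

/-! ### Explicit values and bounds of the Whittaker newvector on the three cosets -/

section WhittakerValues

open MeasureTheory Metric QuasiChar Topology Filter

variable {χ₁ χ₂ : QuasiChar p} {ψ : AddChar ℚ_[p] Circle}

/-! ### Values of the Whittaker newvector -/

lemma exists_norm_eq_zpow (a : ℚ_[p]ˣ) : ∃ m : ℤ, ‖(a : ℚ_[p])‖ = (p : ℝ) ^ m :=
  ⟨_, Padic.norm_eq_zpow_neg_valuation a.ne_zero⟩

lemma phase_identity (a : ℚ_[p]ˣ) (t : ℚ_[p]) :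
    χ₁.ext (-a / t) * χ₂.ext t * ((√‖-(a : ℚ_[p]) / t ^ 2‖ : ℝ) : ℂ) * ψ (-t) =
      χ₁.ext (-a) * ((√‖(a : ℚ_[p])‖ : ℝ) : ℂ) * phase χ₁ χ₂ ψ t := by
  have h : √‖-(a : ℚ_[p]) / t ^ 2‖ = √‖(a : ℚ_[p])‖ * ‖t‖⁻¹ := by
    rw [norm_div, norm_neg, norm_pow, Real.sqrt_div (norm_nonneg _), Real.sqrt_sq (norm_nonneg _),
      div_eq_mul_inv]
  rw [h, phase, div_eq_mul_inv, ext_mul]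
  push_cast
  ring

/-- The newvector in the Whittaker model given by the Jacquet integral. -/
def newW (hψ : IsUnramifiedAddChar ψ) (h₁ : IsUnramifiedChar χ₁) (h₂ : IsTrivialMod χ₂ 2) :
    G p → ℂ :=
  whittakerFunction (principalSeries χ₁ χ₂) (jacquetLimit hψ) (levelVec two_ne_zero h₁ h₂)

section values

variable (hψ : IsUnramifiedAddChar ψ) (h₁ : IsUnramifiedChar χ₁) (h₂ : IsTrivialMod χ₂ 2)
  {y : ℚ_[p]ˣ}

lemma bigCell_levelVec (g : G p) (t : ℚ_[p]) :
    bigCell (principalSeries χ₁ χ₂ g (levelVec two_ne_zero h₁ h₂)) t =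
      levelFun χ₁ χ₂ 2 (wMat * nMat t * g) := rfl

/-- The integrand is a constant times the phase on `|t| ≥ p² |a|` and zero elsewhere. This region
contains the stationary sphere `|t| = p²` iff `|a| ≤ 1`. -/
lemma newW_aMat (hy : IsDual χ₂ ψ y) (a : ℚ_[p]ˣ) :
    newW hψ h₁ h₂ (aMat a) = if ‖(a : ℚ_[p])‖ ≤ 1 then
      χ₁.ext (-a) * ((√‖(a : ℚ_[p])‖ : ℝ) : ℂ) * (phase χ₁ χ₂ ψ (-y) * p) else 0 := by
  have hp := cast_p_pos (p := p)
  obtain ⟨m, hm⟩ := exists_norm_eq_zpow a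
  have hcond (t : ℚ_[p]) : ‖(a : ℚ_[p])‖ ≤ (p : ℝ) ^ (-((2 : ℕ) : ℤ)) * ‖t‖ ↔
      (p : ℝ) ^ (m + 2) ≤ ‖t‖ := by
    rw [hm, zpow_add₀ hp.ne', _root_.zpow_neg, inv_mul_eq_div, le_div_iff₀ (by positivity)]
    rfl
  have hcell (t : ℚ_[p]) : bigCell (principalSeries χ₁ χ₂ (aMat a) (levelVec two_ne_zero h₁ h₂)) t *
      ψ (-t) = if (p : ℝ) ^ (m + 2) ≤ ‖t‖ then
        χ₁.ext (-a) * ((√‖(a : ℚ_[p])‖ : ℝ) : ℂ) * phase χ₁ χ₂ ψ t else 0 := by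
    have e0 : (wMat * nMat t * aMat a : G p) 1 0 = (a : ℚ_[p]) := by simp [mul_entry, nMat, aMat]
    have e1 : (wMat * nMat t * aMat a : G p) 1 1 = (t : ℚ_[p]) := by simp [mul_entry, nMat, aMat]
    have e2 : (wMat * nMat t * aMat a : G p).1.det = -(a : ℚ_[p]) := by simp
    rw [bigCell_levelVec, levelFun, e0, e1, e2]
    simp only [hcond]
    split_ifs
    · exact phase_identity a t
    · rw [zero_mul]
  refine jacquetLimit_eq_of_eventually hψ ?_
  filter_upwards [eventually_ge_atTop 2] with n hn
  set S : Set ℚ_[p] := {t | (p : ℝ) ^ (m + 2) ≤ ‖t‖ ∧ ‖t‖ ≤ (p : ℝ) ^ n} with hS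
  have hSm : MeasurableSet S :=
    ((isClosed_le continuous_const continuous_norm).inter
      (isClosed_le continuous_norm continuous_const)).measurableSet
  have hSn : S ⊆ frac p n := fun t ht => mem_frac.2 ht.2
  rw [jacquet_eq_of_support hψ.1 hSn fun t ht htS => ?_]
  · rw [setIntegral_congr_fun hSm fun t ht => (hcell t).trans (if_pos ht.1), integral_const_mul,
      setIntegral_phase_annulus hψ h₁ h₂ hy _ hn, mul_ite, mul_zero]
    congr 1
    rw [hm, eq_iff_iff]
    constructor
    · intro h
      exact zpow_le_one_of_nonpos₀ one_lt_cast_p.le (by omega)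
    · intro h
      by_contra hlt
      exact absurd h (not_le.2 (one_lt_zpow₀ one_lt_cast_p (by omega)))
  · have h := hcell t
    rw [if_neg (fun h' => htS ⟨h', mem_frac.1 ht⟩), mul_eq_zero] at h
    exact h.resolve_right (Circle.coe_ne_zero _)

/-- The support is a ball about `-a/p` of radius `|a| = |a/p| / p`, a single coset in the sense of
`setIntegral_phase_coset`. It either is stationary or cancels completely. -/
lemma newW_aMat_mul_lMat (hy : IsDual χ₂ ψ y) (a : ℚ_[p]ˣ) :
    newW hψ h₁ h₂ (aMat a * lMat p) = if ‖-(a : ℚ_[p]) / p + y‖ ≤ p then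
      χ₁.ext (-a) * ((√‖(a : ℚ_[p])‖ : ℝ) : ℂ) *
        (phase χ₁ χ₂ ψ (-a / p) * ((‖(a : ℚ_[p])‖ : ℝ) : ℂ)) else 0 := by
  have hp := cast_p_pos (p := p)
  have hp0 := cast_p_ne_zero (p := p)
  classical
  obtain ⟨m, hm⟩ := exists_norm_eq_zpow a
  have ha := norm_pos_iff.2 a.ne_zero
  have hn : ‖-(a : ℚ_[p]) / p‖ = ‖(a : ℚ_[p])‖ * p := by
    rw [norm_div, norm_neg, Padic.norm_p, div_inv_eq_mul]
  set S : Set ℚ_[p] := closedBall (-(a : ℚ_[p]) / p) ((p : ℝ) ^ m) with hS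
  -- The condition says `|t + a/p| ≤ |t| / p`. Either side of the equivalence forces `|t| = |a/p|`,
  -- which makes the radius independent of `t`.
  have hcond (t : ℚ_[p]) : ‖(a : ℚ_[p]) + t * p‖ ≤ (p : ℝ) ^ (-((2 : ℕ) : ℤ)) * ‖t‖ ↔ t ∈ S := by
    have e : (a : ℚ_[p]) + t * p = (t - -(a : ℚ_[p]) / p) * p := by field_simp; ring
    have e2 : (p : ℝ) ^ (-((2 : ℕ) : ℤ)) * ‖t‖ = ‖t‖ / p * (p : ℝ)⁻¹ := by
      rw [show (-((2 : ℕ) : ℤ)) = -1 + -1 by norm_num, zpow_add₀ hp.ne', _root_.zpow_neg_one]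
      ring
    rw [e, norm_mul, Padic.norm_p, e2, mul_le_mul_iff_left₀ (inv_pos.2 hp), hS, mem_closedBall,
      dist_eq_norm, ← hm]
    have hlt : ‖(a : ℚ_[p])‖ < ‖-(a : ℚ_[p]) / p‖ := by
      rw [hn]
      exact lt_mul_of_one_lt_right ha one_lt_cast_p
    constructor
    · intro h
      have ht0 : t ≠ 0 := by
        rintro rfl
        rw [norm_zero, zero_div, zero_sub, norm_neg, hn] at h
        exact absurd h (not_le.2 (by positivity))
      have h1 : ‖-(a : ℚ_[p]) / p - t‖ < ‖t‖ := by
        rw [norm_sub_rev]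
        exact h.trans_lt (div_lt_self (norm_pos_iff.2 ht0) one_lt_cast_p)
      rwa [← norm_eq_of_norm_sub_lt h1, hn, mul_div_cancel_right₀ _ hp.ne'] at h
    · intro h
      rwa [norm_eq_of_norm_sub_lt (h.trans_lt hlt), hn, mul_div_cancel_right₀ _ hp.ne']
  have hcell (t : ℚ_[p]) :
      bigCell (principalSeries χ₁ χ₂ (aMat a * lMat p) (levelVec two_ne_zero h₁ h₂)) t *
      ψ (-t) = if t ∈ S then
        χ₁.ext (-a) * ((√‖(a : ℚ_[p])‖ : ℝ) : ℂ) * phase χ₁ χ₂ ψ t else 0 := by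
    have e0 : (wMat * nMat t * (aMat a * lMat p) : G p) 1 0 = (a : ℚ_[p]) + t * p := by
      simp [mul_entry, nMat, aMat]
    have e1 : (wMat * nMat t * (aMat a * lMat p) : G p) 1 1 = (t : ℚ_[p]) := by simp [mul_entry, nMat, aMat]
    have e2 : (wMat * nMat t * (aMat a * lMat p) : G p).1.det = -(a : ℚ_[p]) := by simp
    rw [bigCell_levelVec, levelFun, e0, e1, e2]
    simp only [hcond]
    split_ifs
    · exact phase_identity a t
    · rw [zero_mul]
  have hJ := jacquetLimit_eq_setIntegral hψ
    (f := principalSeries χ₁ χ₂ (aMat a * lMat p) (levelVec two_ne_zero h₁ h₂)) (S := S)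
    isBounded_closedBall fun t ht => by
      have h := hcell t
      rw [if_neg ht, mul_eq_zero] at h
      exact h.resolve_right (Circle.coe_ne_zero _)
  rw [newW, whittakerFunction, hJ,
    setIntegral_congr_fun isClosed_closedBall.measurableSet fun t ht =>
      (hcell t).trans (if_pos ht), integral_const_mul, setIntegral_closedBall]
  have hc := setIntegral_phase_coset (χ₁ := χ₁) hψ h₁ hy (t := -(a : ℚ_[p]) / p) (k := m)
    (by rw [hn, hm, zpow_add_one₀ hp.ne'])
  simp only [add_comm _ (-(a : ℚ_[p]) / p)]
  rw [hc, hm, mul_ite, mul_zero]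

/-- Here the lower right entry does not depend on `t`, so only the additive character `ψ(-t)` is
left, on the ideal of radius `p ^ (m - 2)`. It survives iff that radius is at most `1`. -/
lemma newW_aMat_mul_wMat {a : ℚ_[p]ˣ} {m : ℤ} (hm : ‖(a : ℚ_[p])‖ = (p : ℝ) ^ m) :
    newW hψ h₁ h₂ (aMat a * wMat) = if m ≤ 2 then
      χ₂.ext a * ((√‖(a : ℚ_[p])‖⁻¹ : ℝ) : ℂ) * (((p : ℝ) ^ (m - 2) : ℝ) : ℂ) else 0 := by
  have hp := cast_p_pos (p := p)
  classical
  have hcond (t : ℚ_[p]) : ‖t‖ ≤ (p : ℝ) ^ (-((2 : ℕ) : ℤ)) * ‖(a : ℚ_[p])‖ ↔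
      t ∈ frac p (m - 2) := by
    rw [mem_frac, hm, ← zpow_add₀ hp.ne', neg_add_eq_sub, Nat.cast_ofNat]
  have hcell (t : ℚ_[p]) :
      bigCell (principalSeries χ₁ χ₂ (aMat a * wMat) (levelVec two_ne_zero h₁ h₂)) t *
      ψ (-t) = if t ∈ frac p (m - 2) then
        χ₂.ext a * ((√‖(a : ℚ_[p])‖⁻¹ : ℝ) : ℂ) * ψ (-1 * t) else 0 := by
    have e0 : (wMat * nMat t * (aMat a * wMat) : G p) 1 0 = (t : ℚ_[p]) := by simp [mul_entry, nMat, aMat]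
    have e1 : (wMat * nMat t * (aMat a * wMat) : G p) 1 1 = (a : ℚ_[p]) := by simp [mul_entry, nMat, aMat]
    have e2 : (wMat * nMat t * (aMat a * wMat) : G p).1.det = (a : ℚ_[p]) := by simp
    have e3 : (a : ℚ_[p]) / a ^ 2 = (a : ℚ_[p])⁻¹ := by
      have := a.ne_zero
      field_simp
    rw [bigCell_levelVec, levelFun, e0, e1, e2, e3, div_self a.ne_zero, MulChar.map_one, norm_inv]
    simp only [hcond, neg_one_mul, one_mul]
    split_ifs <;> simp
  have hJ := jacquetLimit_eq_setIntegral hψ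
    (f := principalSeries χ₁ χ₂ (aMat a * wMat) (levelVec two_ne_zero h₁ h₂)) (S := frac p (m - 2))
    isBounded_closedBall fun t ht => by
      have h := hcell t
      rw [if_neg ht, mul_eq_zero] at h
      exact h.resolve_right (Circle.coe_ne_zero _)
  rw [newW, whittakerFunction, hJ,
    setIntegral_congr_fun (measurableSet_frac _) fun t ht =>
      (hcell t).trans (if_pos ht), integral_const_mul, setIntegral_frac_addChar hψ, norm_neg,
    norm_one, one_mul, mul_ite, mul_zero]
  congr 1
  rw [eq_iff_iff]
  constructor
  · intro h
    by_contra hlt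
    exact absurd h (not_le.2 (one_lt_zpow₀ one_lt_cast_p (by omega)))
  · intro h
    exact zpow_le_one_of_nonpos₀ one_lt_cast_p.le (by omega)

end values

/-! ### Norms of Whittaker functions -/

lemma whittakerFunction_mul_of_level {Λ : principalSeriesSpace χ₁ χ₂ →ₗ[ℂ] ℂ} {r : ℕ}
    {v : principalSeriesSpace χ₁ χ₂} (hv : v ∈ levelVectors (principalSeries χ₁ χ₂) r) (g : G p)
    {k : G p} (hk : k ∈ kOneSubgroup r) :
    whittakerFunction (principalSeries χ₁ χ₂) Λ v (g * k) =
      whittakerFunction (principalSeries χ₁ χ₂) Λ v g := by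
  rw [whittakerFunction, whittakerFunction, map_mul, Module.End.mul_apply, hv k hk]

lemma bMat_eq (a d : ℚ_[p]ˣ) (x : ℚ_[p]) :
    bMat a x d = bMat d 0 d * nMat (x / (d : ℚ_[p])) * aMat (a / d) := by
  have := d.ne_zero
  refine ext_entries ?_ ?_ ?_ ?_ <;> simp [mul_entry, nMat, aMat] <;> field_simp

lemma norm_whittakerFunction_bMat_mul {Λ : principalSeriesSpace χ₁ χ₂ →ₗ[ℂ] ℂ}
    (hΛ : ∀ x v, Λ (principalSeries χ₁ χ₂ (nMat x) v) = ψ x * Λ v) (hu₁ : IsUnitaryChar χ₁)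
    (hu₂ : IsUnitaryChar χ₂) (v : principalSeriesSpace χ₁ χ₂) (a d : ℚ_[p]ˣ) (x : ℚ_[p]) (g : G p) :
    ‖whittakerFunction (principalSeries χ₁ χ₂) Λ v (bMat a x d * g)‖ =
      ‖whittakerFunction (principalSeries χ₁ χ₂) Λ v (aMat (a / d) * g)‖ := by
  have hz (v) : principalSeries χ₁ χ₂ (bMat d 0 d) v = ((χ₁ d : ℂ) * χ₂ d) • v := by
    ext h
    have hc : h * bMat d 0 d = bMat d 0 d * h := by
      refine ext_entries ?_ ?_ ?_ ?_ <;> simp [mul_entry, mul_comm]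
    rw [principalSeries_apply, hc, principalSeries_bMat_mul, div_self d.ne_zero]
    simp
  rw [whittakerFunction, whittakerFunction, bMat_eq, mul_assoc, mul_assoc, map_mul,
    Module.End.mul_apply, hz, map_smul, map_mul, Module.End.mul_apply, hΛ]
  rw [smul_eq_mul, norm_mul, norm_mul, norm_mul, hu₁ d, hu₂ d, Circle.norm_coe, one_mul, one_mul,
    one_mul]

section norms

variable (hψ : IsUnramifiedAddChar ψ) (h₁ : IsUnramifiedChar χ₁) (h₂ : IsTrivialMod χ₂ 2)
  (hu₁ : IsUnitaryChar χ₁) (hu₂ : IsUnitaryChar χ₂) {y : ℚ_[p]ˣ}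

include hu₁ hu₂ in
lemma norm_phase {t : ℚ_[p]} (ht : t ≠ 0) : ‖phase χ₁ χ₂ ψ t‖ = ‖t‖⁻¹ := by
  rw [phase, norm_mul, norm_mul, norm_mul, hu₁.norm_ext (inv_ne_zero ht), hu₂.norm_ext ht,
    Circle.norm_coe]
  simp

lemma neg_unit_ne_zero (a : ℚ_[p]ˣ) : -(a : ℚ_[p]) ≠ 0 := neg_ne_zero.2 a.ne_zero

lemma aMat_one : aMat (1 : ℚ_[p]ˣ) = 1 := by
  refine ext_entries ?_ ?_ ?_ ?_ <;> simp [aMat]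

include hu₁ hu₂ in
lemma norm_newW_aMat (hy : IsDual χ₂ ψ y) {a : ℚ_[p]ˣ} (ha : ‖(a : ℚ_[p])‖ ≤ 1) :
    ‖newW hψ h₁ h₂ (aMat a)‖ = √‖(a : ℚ_[p])‖ * (p : ℝ)⁻¹ := by
  have hp := cast_p_pos (p := p)
  rw [newW_aMat hψ h₁ h₂ hy, if_pos ha, norm_mul, norm_mul, norm_mul,
    hu₁.norm_ext (neg_unit_ne_zero a), norm_phase hu₁ hu₂ (neg_unit_ne_zero y), norm_neg, hy.1,
    Complex.norm_real, Real.norm_of_nonneg (Real.sqrt_nonneg _), Complex.norm_natCast]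
  field_simp

include hu₁ hu₂ in
lemma norm_newW_one (hy : IsDual χ₂ ψ y) : ‖newW hψ h₁ h₂ 1‖ = (p : ℝ)⁻¹ := by
  rw [← aMat_one, norm_newW_aMat hψ h₁ h₂ hu₁ hu₂ hy (by simp)]
  simp

include hu₁ hu₂ in
-- The stationary coset contributes modulus `p⁻²` times measure `p`, just as at the identity. The
-- gain is the factor `|a|^(1/2)`, since stationarity forces `|a| = p`.
lemma norm_newW_aMat_mul_lMat (hy : IsDual χ₂ ψ y) {a : ℚ_[p]ˣ}
    (ha : ‖-(a : ℚ_[p]) / p + y‖ ≤ p) :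
    ‖newW hψ h₁ h₂ (aMat a * lMat p)‖ = √(p : ℝ) * (p : ℝ)⁻¹ := by
  have hp := cast_p_pos (p := p)
  have hp1 := one_lt_cast_p (p := p)
  have hn : ‖-(a : ℚ_[p]) / p‖ = ‖(a : ℚ_[p])‖ * p := by
    rw [norm_div, norm_neg, Padic.norm_p, div_inv_eq_mul]
  have h1 : ‖-(a : ℚ_[p]) / p‖ = (p : ℝ) ^ 2 := by
    rw [← hy.1, ← norm_neg (y : ℚ_[p])]
    refine norm_eq_of_norm_sub_lt ?_
    rw [sub_neg_eq_add, norm_neg, hy.1]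
    nlinarith
  have h2 : ‖(a : ℚ_[p])‖ = p := by
    rw [hn, sq] at h1
    exact mul_right_cancel₀ hp.ne' h1
  have h0 : -(a : ℚ_[p]) / p ≠ 0 := div_ne_zero (neg_unit_ne_zero a) cast_p_ne_zero
  rw [newW_aMat_mul_lMat hψ h₁ h₂ hy, if_pos ha, norm_mul, norm_mul, norm_mul,
    hu₁.norm_ext (neg_unit_ne_zero a), norm_phase hu₁ hu₂ h0, h1, h2,
    Complex.norm_real, Real.norm_of_nonneg (Real.sqrt_nonneg _), Complex.norm_real, norm_natCast]
  field_simp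

include hu₁ hu₂ in
lemma norm_newW_le (hy : IsDual χ₂ ψ y) (g : G p) :
    ‖newW hψ h₁ h₂ g‖ ≤ √(p : ℝ) * (p : ℝ)⁻¹ := by
  have hp := cast_p_pos (p := p)
  have hp1 := one_lt_cast_p (p := p)
  have hs : 1 ≤ √(p : ℝ) := Real.one_le_sqrt.2 hp1.le
  have hnn : 0 ≤ √(p : ℝ) * (p : ℝ)⁻¹ := by positivity
  have hle : (p : ℝ)⁻¹ ≤ √(p : ℝ) * (p : ℝ)⁻¹ := le_mul_of_one_le_left (by positivity) hs
  have hmem := levelVec_mem (two_ne_zero) h₁ h₂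
  obtain ⟨a, x, d, k, hk, rfl | rfl | rfl⟩ := exists_bMat_mul g
  · rw [newW, whittakerFunction_mul_of_level hmem _ hk, ← mul_one (bMat a x d),
      norm_whittakerFunction_bMat_mul (jacquetLimit_nMat hψ) hu₁ hu₂, mul_one]
    change ‖newW hψ h₁ h₂ _‖ ≤ _
    by_cases ha : ‖((a / d : ℚ_[p]ˣ) : ℚ_[p])‖ ≤ 1
    · rw [norm_newW_aMat hψ h₁ h₂ hu₁ hu₂ hy ha]
      refine le_trans ?_ hle
      exact mul_le_of_le_one_left (by positivity) (Real.sqrt_le_one.2 ha)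
    · rwa [newW_aMat hψ h₁ h₂ hy, if_neg ha, norm_zero]
  · rw [newW, whittakerFunction_mul_of_level hmem _ hk,
      norm_whittakerFunction_bMat_mul (jacquetLimit_nMat hψ) hu₁ hu₂]
    change ‖newW hψ h₁ h₂ _‖ ≤ _
    by_cases ha : ‖-((a / d : ℚ_[p]ˣ) : ℚ_[p]) / p + y‖ ≤ p
    · exact (norm_newW_aMat_mul_lMat hψ h₁ h₂ hu₁ hu₂ hy ha).le
    · rwa [newW_aMat_mul_lMat hψ h₁ h₂ hy, if_neg ha, norm_zero]
  · rw [newW, whittakerFunction_mul_of_level hmem _ hk,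
      norm_whittakerFunction_bMat_mul (jacquetLimit_nMat hψ) hu₁ hu₂]
    change ‖newW hψ h₁ h₂ _‖ ≤ _
    obtain ⟨m, hm⟩ := exists_norm_eq_zpow (a / d)
    rw [newW_aMat_mul_wMat hψ h₁ h₂ hm]
    split_ifs with h
    · refine le_trans ?_ hle
      rw [norm_mul, norm_mul, hu₂.norm_ext (Units.ne_zero _), one_mul, Complex.norm_real,
        Complex.norm_real, Real.norm_of_nonneg (Real.sqrt_nonneg _),
        Real.norm_of_nonneg (zpow_nonneg hp.le _), hm]
      -- After squaring, the claim is `p ^ (-m) p ^ (2(m - 2)) = p ^ (m - 4) ≤ p⁻²`, that is `m ≤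
      -- 2`.
      refine le_of_sq_le_sq ?_ (by positivity)
      rw [mul_pow, Real.sq_sqrt (by positivity), ← zpow_natCast, ← _root_.zpow_mul, ← _root_.zpow_neg,
        ← zpow_add₀ hp.ne', ← _root_.zpow_neg_one, ← zpow_natCast, ← _root_.zpow_mul]
      exact zpow_le_zpow_right₀ hp1.le (by push_cast; linarith)
    · rwa [norm_zero]

include hu₂ in
-- This is the boundary case `m = 2` and covers the Atkin–Lehner point `alMat`. It gives the size at
-- the identity of the newvector when `χ₂` is unramified.
lemma norm_newW_aMat_mul_wMat {a : ℚ_[p]ˣ} (ha : ‖(a : ℚ_[p])‖ = (p : ℝ) ^ (2 : ℤ)) :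
    ‖newW hψ h₁ h₂ (aMat a * wMat)‖ = (p : ℝ)⁻¹ := by
  have hp := cast_p_pos (p := p)
  rw [newW_aMat_mul_wMat hψ h₁ h₂ ha, if_pos le_rfl, norm_mul, norm_mul,
    hu₂.norm_ext (Units.ne_zero _), ha, Complex.norm_real, Real.norm_of_nonneg (Real.sqrt_nonneg _),
    Real.sqrt_inv, Complex.norm_real]
  have : (p : ℝ) ^ (2 : ℤ) = (p : ℝ) ^ 2 := by norm_cast
  rw [this, Real.sqrt_sq hp.le]
  simp

end norms

end WhittakerValues

/-! ### Extremal newvectors, unramified `χ₁`, and twisting -/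

section Newvectors

open QuasiChar Topology Filter

variable {χ₁ χ₂ : QuasiChar p} {ψ : AddChar ℚ_[p] Circle}

/-! ### Whittaker newvectors with prescribed maximum -/

/-- `W` spans the line of Whittaker newvectors of `π`, does not vanish at the identity, and
`|W|` attains its maximum `p ^ (1/2) |W(e)|` on `B k₁ I₂`. -/
structure IsExtremalNewvector {V : Type*} [AddCommGroup V] [Module ℂ V]
    (π : Representation ℂ (G p) V) (ψ : AddChar ℚ_[p] Circle) (W : G p → ℂ) : Prop where
  isNewvector : IsWhittakerNewvector π ψ W
  unique : ∀ W', IsWhittakerNewvector π ψ W' → ∃ c : ℂ, c ≠ 0 ∧ W' = c • W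
  apply_one_ne_zero : W 1 ≠ 0
  norm_le : ∀ g, ‖W g‖ ≤ √(p : ℝ) * ‖W 1‖
  exists_norm_eq : ∃ g ∈ doubleCoset (kOne : G p) 2, ‖W g‖ = √(p : ℝ) * ‖W 1‖

lemma IsWhittakerNewvector.smul {V : Type*} [AddCommGroup V] [Module ℂ V]
    {π : Representation ℂ (G p) V} {W : G p → ℂ} (h : IsWhittakerNewvector π ψ W) {c : ℂ}
    (hc : c ≠ 0) : IsWhittakerNewvector π ψ (c • W) := by
  obtain ⟨Λ, hΛ, v, hv, rfl⟩ := h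
  refine ⟨c • Λ, ⟨smul_ne_zero hc hΛ.1, fun x v => ?_⟩, v, hv, rfl⟩
  rw [LinearMap.smul_apply, LinearMap.smul_apply, hΛ.2, smul_eq_mul, smul_eq_mul, mul_left_comm]

namespace IsExtremalNewvector

variable {V : Type*} [AddCommGroup V] [Module ℂ V] {π : Representation ℂ (G p) V} {W : G p → ℂ}

lemma smul (h : IsExtremalNewvector π ψ W) {c : ℂ} (hc : c ≠ 0) :
    IsExtremalNewvector π ψ (c • W) where
  isNewvector := h.isNewvector.smul hc
  unique W' hW' := by
    obtain ⟨d, hd, rfl⟩ := h.unique W' hW'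
    exact ⟨d / c, div_ne_zero hd hc, by rw [smul_smul, div_mul_cancel₀ _ hc]⟩
  apply_one_ne_zero := mul_ne_zero hc h.apply_one_ne_zero
  norm_le g := by
    simp only [Pi.smul_apply, smul_eq_mul, norm_mul]
    rw [mul_left_comm]
    exact mul_le_mul_of_nonneg_left (h.norm_le g) (norm_nonneg _)
  exists_norm_eq := by
    obtain ⟨g, hg, h⟩ := h.exists_norm_eq
    refine ⟨g, hg, ?_⟩
    simp only [Pi.smul_apply, smul_eq_mul, norm_mul]
    rw [mul_left_comm, h]

lemma of_isWhittakerNewvector (h : IsExtremalNewvector π ψ W) {W' : G p → ℂ}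
    (hW' : IsWhittakerNewvector π ψ W') : IsExtremalNewvector π ψ W' := by
  obtain ⟨c, hc, rfl⟩ := h.unique W' hW'
  exact h.smul hc

lemma isGreatest_range (h : IsExtremalNewvector π ψ W) :
    IsGreatest (Set.range fun g => ‖W g‖) (√(p : ℝ) * ‖W 1‖) := by
  obtain ⟨g, -, hg⟩ := h.exists_norm_eq
  refine ⟨⟨g, hg⟩, ?_⟩
  rintro _ ⟨g, rfl⟩
  exact h.norm_le g

lemma existsUnique_normalized (h : IsExtremalNewvector π ψ W) :
    ∃! W' : G p → ℂ, IsNormalizedNewvector π ψ W' := by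
  have h1 := h.apply_one_ne_zero
  refine ⟨(W 1)⁻¹ • W, ⟨h.isNewvector.smul (inv_ne_zero h1), inv_mul_cancel₀ h1⟩, ?_⟩
  rintro W' ⟨hW', h'⟩
  obtain ⟨c, -, rfl⟩ := h.unique W' hW'
  rw [eq_inv_of_mul_eq_one_left h']

lemma isGreatest_newvectorValues (h : IsExtremalNewvector π ψ W) :
    IsGreatest (newvectorValues π ψ) √(p : ℝ) := by
  obtain ⟨W', hW', -⟩ := h.existsUnique_normalized
  constructor
  · obtain ⟨g, -, hg⟩ := (h.of_isWhittakerNewvector hW'.1).exists_norm_eq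
    exact ⟨W', hW', g, by rw [hg, hW'.2, norm_one, mul_one]⟩
  · rintro _ ⟨W'', hW'', g, rfl⟩
    simpa [hW''.2] using (h.of_isWhittakerNewvector hW''.1).norm_le g

lemma localInvariant_eq (h : IsExtremalNewvector π ψ W) : localInvariant π ψ = √(p : ℝ) :=
  h.isGreatest_newvectorValues.csSup_eq

end IsExtremalNewvector

/-! ### Invariance under isomorphism -/

section transfer

variable {V V' : Type*} [AddCommGroup V] [Module ℂ V] [AddCommGroup V'] [Module ℂ V']
  {π : Representation ℂ (G p) V} {σ : Representation ℂ (G p) V'}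

lemma map_mem_levelVectors_iff (e : V ≃ₗ[ℂ] V') (he : ∀ g v, e (π g v) = σ g (e v)) {r : ℕ}
    {v : V} : e v ∈ levelVectors σ r ↔ v ∈ levelVectors π r :=
  forall₂_congr fun k _ => by rw [← he, e.injective.eq_iff]

lemma conductor_congr (e : V ≃ₗ[ℂ] V') (he : ∀ g v, e (π g v) = σ g (e v)) :
    conductor π = conductor σ := by
  refine congrArg sInf (Set.ext fun r => ⟨?_, ?_⟩)
  · rintro ⟨v, hv, hv0⟩
    exact ⟨e v, (map_mem_levelVectors_iff e he).2 hv, by simpa using hv0⟩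
  · rintro ⟨v, hv, hv0⟩
    refine ⟨e.symm v, (map_mem_levelVectors_iff e he).1 (by simpa using hv), by simpa using hv0⟩

lemma twist_apply (η : QuasiChar p) (g : G p) (v : V) :
    twist π η g v = (η (GeneralLinearGroup.det g) : ℂ) • π g v := rfl

lemma isTwistMinimal_congr (e : V ≃ₗ[ℂ] V') (he : ∀ g v, e (π g v) = σ g (e v))
    (h : IsTwistMinimal π) : IsTwistMinimal σ := by
  intro η
  rw [← conductor_congr e he,
    ← conductor_congr (π := twist π η) (σ := twist σ η) e fun g v => by
      rw [twist_apply, twist_apply, map_smul, he]]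
  exact h η

lemma isWhittakerNewvector_map (e : V ≃ₗ[ℂ] V') (he : ∀ g v, e (π g v) = σ g (e v)) {W : G p → ℂ}
    (h : IsWhittakerNewvector σ ψ W) : IsWhittakerNewvector π ψ W := by
  obtain ⟨Λ, hΛ, v, ⟨hv0, hv⟩, rfl⟩ := h
  refine ⟨Λ ∘ₗ e.toLinearMap, ⟨?_, fun x v => ?_⟩, e.symm v, ⟨by simpa using hv0, ?_⟩, ?_⟩
  · intro h0
    exact hΛ.1 (LinearMap.ext fun v => by simpa using LinearMap.congr_fun h0 (e.symm v))
  · simp [he, hΛ.2]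
  · rw [conductor_congr e he]
    exact (map_mem_levelVectors_iff e he).1 (by simpa using hv)
  · ext g
    simp [whittakerFunction, he]

lemma isWhittakerNewvector_congr (e : V ≃ₗ[ℂ] V') (he : ∀ g v, e (π g v) = σ g (e v))
    {W : G p → ℂ} : IsWhittakerNewvector π ψ W ↔ IsWhittakerNewvector σ ψ W :=
  ⟨isWhittakerNewvector_map e.symm fun g v => by
    rw [LinearEquiv.symm_apply_eq, he, LinearEquiv.apply_symm_apply], isWhittakerNewvector_map e he⟩

lemma IsExtremalNewvector.map (e : V ≃ₗ[ℂ] V') (he : ∀ g v, e (π g v) = σ g (e v)) {W : G p → ℂ}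
    (h : IsExtremalNewvector σ ψ W) : IsExtremalNewvector π ψ W where
  isNewvector := (isWhittakerNewvector_congr e he).2 h.isNewvector
  unique W' hW' := h.unique W' ((isWhittakerNewvector_congr e he).1 hW')
  apply_one_ne_zero := h.apply_one_ne_zero
  norm_le := h.norm_le
  exists_norm_eq := h.exists_norm_eq

end transfer

/-! ### The case of unramified `χ₁` -/

/-- Two lines combine: the vectors of level `p²` and the Whittaker functionals. Nonvanishing at the
identity ensures that neither the vector nor the functional is zero. -/
lemma whittakerNewvector_of_span (hψ : IsUnramifiedAddChar ψ)
    (hcond : conductor (principalSeries χ₁ χ₂) = 2) {Λ : principalSeriesSpace χ₁ χ₂ →ₗ[ℂ] ℂ}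
    (hΛ : ∀ x v, Λ (principalSeries χ₁ χ₂ (nMat x) v) = ψ x * Λ v) {F : principalSeriesSpace χ₁ χ₂}
    (hF : F ∈ levelVectors (principalSeries χ₁ χ₂) 2)
    (hspan : ∀ v ∈ levelVectors (principalSeries χ₁ χ₂) 2, ∃ a : ℂ, v = a • F)
    (h1 : whittakerFunction (principalSeries χ₁ χ₂) Λ F 1 ≠ 0) :
    IsWhittakerNewvector (principalSeries χ₁ χ₂) ψ
        (whittakerFunction (principalSeries χ₁ χ₂) Λ F) ∧
      ∀ W, IsWhittakerNewvector (principalSeries χ₁ χ₂) ψ W →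
        ∃ c : ℂ, c ≠ 0 ∧ W = c • whittakerFunction (principalSeries χ₁ χ₂) Λ F := by
  have hF0 : F ≠ 0 := by
    rintro rfl
    simp [whittakerFunction] at h1
  have hΛ' : IsWhittakerFunctional (principalSeries χ₁ χ₂) ψ Λ := by
    refine ⟨?_, hΛ⟩
    rintro rfl
    simp [whittakerFunction] at h1
  refine ⟨⟨Λ, hΛ', F, ⟨hF0, hcond ▸ hF⟩, rfl⟩, ?_⟩
  rintro W ⟨Λ₁, hΛ₁, v, ⟨hv0, hv⟩, rfl⟩
  obtain ⟨c, hc, rfl⟩ := exists_eq_smul_of_whittaker hψ hΛ' hΛ₁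
  obtain ⟨a, rfl⟩ := hspan v (hcond ▸ hv)
  have ha : a ≠ 0 := fun ha => hv0 (by rw [ha, zero_smul])
  refine ⟨c * a, mul_ne_zero hc ha, ?_⟩
  ext g
  simp [whittakerFunction, mul_assoc, mul_left_comm]

lemma smul_mem_levelVectors {V : Type*} [AddCommGroup V] [Module ℂ V]
    {π : Representation ℂ (G p) V} {r : ℕ} {v : V} (a : ℂ) (hv : v ∈ levelVectors π r) :
    a • v ∈ levelVectors π r := fun k hk => by rw [map_smul, hv k hk]

/-- The values at `l` and `w` vanish on vectors of level `p ^ 2` if `χ₂` has conductor `p ^ 2`. -/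
lemma apply_eq_zero_of_level_two (h : ¬ IsTrivialMod χ₂ 1) {v : principalSeriesSpace χ₁ χ₂}
    (hv : v ∈ levelVectors (principalSeries χ₁ χ₂) 2) : v.1 (lMat p) = 0 ∧ v.1 wMat = 0 := by
  constructor
  · by_contra h0
    exact h (characters_of_apply_lMat_ne_zero hv h0).2
  · by_contra h0
    exact h ((characters_of_apply_wMat_ne_zero hv h0).2.isTrivialMod 1)

lemma eq_smul_levelVec (h₁ : IsUnramifiedChar χ₁) (h₂ : IsTrivialMod χ₂ 2)
    (h : ¬ IsTrivialMod χ₂ 1) {v : principalSeriesSpace χ₁ χ₂}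
    (hv : v ∈ levelVectors (principalSeries χ₁ χ₂) 2) :
    v = v.1 1 • levelVec two_ne_zero h₁ h₂ := by
  have hF := levelVec_mem two_ne_zero h₁ h₂
  obtain ⟨hl, hw⟩ := apply_eq_zero_of_level_two h hv
  obtain ⟨hl', hw'⟩ := apply_eq_zero_of_level_two h hF
  have h1 := levelVec_apply_one two_ne_zero h₁ h₂
  refine ext_of_level_two hv (smul_mem_levelVectors _ hF) ?_ ?_ ?_
  · simp [h1]
  · simp [hl, hl']
  · simp [hw, hw']

lemma conductor_le {V : Type*} [AddCommGroup V] [Module ℂ V] {π : Representation ℂ (G p) V}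
    {r : ℕ} {v : V} (hv : v ∈ levelVectors π r) (hv0 : v ≠ 0) : conductor π ≤ r :=
  Nat.sInf_le ⟨v, hv, hv0⟩

lemma levelVectors_mono {V : Type*} [AddCommGroup V] [Module ℂ V] {π : Representation ℂ (G p) V}
    {r s : ℕ} (h : r ≤ s) : levelVectors π r ⊆ levelVectors π s :=
  fun _ hv k hk => hv k (kOneSubgroup_mono h hk)

lemma conductor_eq_two (h₁ : IsUnramifiedChar χ₁) (h₂ : IsTrivialMod χ₂ 2)
    (h : ¬ IsTrivialMod χ₂ 1) : conductor (principalSeries χ₁ χ₂) = 2 := by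
  have hF := levelVec_mem two_ne_zero h₁ h₂
  have hF0 := levelVec_ne_zero two_ne_zero h₁ h₂
  refine le_antisymm (conductor_le hF hF0) ?_
  by_contra hlt
  obtain ⟨v, hv, hv0⟩ := Nat.sInf_mem (s := {r : ℕ | ∃ v ∈ levelVectors (principalSeries χ₁ χ₂) r,
    v ≠ 0}) ⟨2, _, hF, hF0⟩
  change v ∈ levelVectors _ (conductor (principalSeries χ₁ χ₂)) at hv
  have hv1 : v ∈ levelVectors (principalSeries χ₁ χ₂) 1 := levelVectors_mono (by omega) hv
  have hv2 : v ∈ levelVectors (principalSeries χ₁ χ₂) 2 := levelVectors_mono one_le_two hv1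
  -- A vector of level `p` is fixed by `l(p)`, so its value at the identity equals its value at
  -- `l(p)`, which is zero. That value determines the vector.
  have hl := mem_levelVectors_iff.1 hv1 (lMat p) (lMat_mem (by simp)) 1
  rw [one_mul, (apply_eq_zero_of_level_two h hv2).1] at hl
  rw [eq_smul_levelVec h₁ h₂ h hv2, ← hl, zero_smul] at hv0
  exact hv0 rfl

lemma bMat_mul_bMat (a b d e : ℚ_[p]ˣ) (x z : ℚ_[p]) :
    bMat a x d * bMat b z e = bMat (a * b) (a * z + x * e) (d * e) := by
  refine ext_entries ?_ ?_ ?_ ?_ <;> simp [mul_entry]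

lemma bMat_mul_kOne_mul_mem_doubleCoset (a d : ℚ_[p]ˣ) (x : ℚ_[p]) {k : G p}
    (hk : k ∈ iwahori 2) : bMat a x d * kOne * k ∈ doubleCoset (kOne : G p) 2 :=
  ⟨a, x, d, k, hk, rfl⟩

lemma lMat_eq_bMat_mul_kOne :
    lMat (p : ℚ_[p]) = bMat (Units.mk0 (p : ℚ_[p]) cast_p_ne_zero)⁻¹ 0 1 * kOne := by
  refine ext_entries ?_ ?_ ?_ ?_ <;> simp [mul_entry, (cast_p_ne_zero (p := p))]

lemma bMat_mul_lMat_mul_mem_doubleCoset (a d : ℚ_[p]ˣ) (x : ℚ_[p]) {k : G p}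
    (hk : k ∈ iwahori 2) : bMat a x d * lMat p * k ∈ doubleCoset (kOne : G p) 2 := by
  rw [lMat_eq_bMat_mul_kOne, ← mul_assoc, bMat_mul_bMat]
  exact bMat_mul_kOne_mul_mem_doubleCoset _ _ _ hk

lemma one_mem_iwahori (r : ℕ) : (1 : G p) ∈ iwahori r := by
  rw [← nMat_zero]
  exact kOneSubgroup_subset_iwahori r (nMat_mem r (by simp))

section unramified

variable (hψ : IsUnramifiedAddChar ψ) (h₁ : IsUnramifiedChar χ₁) (h₂ : IsTrivialMod χ₂ 2)
  (h : ¬ IsTrivialMod χ₂ 1)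

/-- A unit `a` for which `a / p` is dual to `χ₂`, so that `W` is extremal at `a(a) l`. -/
lemma norm_neg_div_add_self (y : ℚ_[p]ˣ) :
    ‖-((y * Units.mk0 (p : ℚ_[p]) cast_p_ne_zero : ℚ_[p]ˣ) : ℚ_[p]) / p + y‖ ≤ p := by
  have := cast_p_ne_zero (p := p)
  rw [Units.val_mul, Units.val_mk0, neg_div, mul_div_cancel_right₀ _ this, neg_add_cancel, norm_zero]
  exact cast_p_pos.le

include h in
lemma newW_unique : IsWhittakerNewvector (principalSeries χ₁ χ₂) ψ (newW hψ h₁ h₂) ∧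
    ∀ W, IsWhittakerNewvector (principalSeries χ₁ χ₂) ψ W →
      ∃ c : ℂ, c ≠ 0 ∧ W = c • newW hψ h₁ h₂ := by
  obtain ⟨y, hy⟩ := exists_isDual hψ h₂ h
  refine whittakerNewvector_of_span hψ (conductor_eq_two h₁ h₂ h) (jacquetLimit_nMat hψ)
    (levelVec_mem two_ne_zero h₁ h₂) (fun v hv => ⟨_, eq_smul_levelVec h₁ h₂ h hv⟩) ?_
  change newW hψ h₁ h₂ 1 ≠ 0
  have hp := cast_p_ne_zero (p := p)
  rw [← aMat_one, newW_aMat hψ h₁ h₂ hy, if_pos (by simp), Units.val_one, phase]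
  simp [ext_ne_zero, (Fact.out : p.Prime).ne_zero]

include h in
lemma isExtremalNewvector_newW (hu₁ : IsUnitaryChar χ₁) (hu₂ : IsUnitaryChar χ₂) :
    IsExtremalNewvector (principalSeries χ₁ χ₂) ψ (newW hψ h₁ h₂) := by
  obtain ⟨y, hy⟩ := exists_isDual hψ h₂ h
  have h1 := norm_newW_one hψ h₁ h₂ hu₁ hu₂ hy
  refine ⟨(newW_unique hψ h₁ h₂ h).1, (newW_unique hψ h₁ h₂ h).2, ?_, fun g => ?_, ?_⟩
  · rw [← norm_ne_zero_iff, h1]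
    exact inv_ne_zero cast_p_pos.ne'
  · rw [h1]
    exact norm_newW_le hψ h₁ h₂ hu₁ hu₂ hy g
  · rw [h1]
    refine ⟨_, ?_, norm_newW_aMat_mul_lMat hψ h₁ h₂ hu₁ hu₂ hy (norm_neg_div_add_self y)⟩
    rw [← mul_one (aMat _ * _)]
    exact bMat_mul_lMat_mul_mem_doubleCoset _ _ _ (one_mem_iwahori 2)

/-- The value at `a(y) k₁` relative to the value at the identity. -/
lemma newW_aMat_mul_kOne {y₀ : ℚ_[p]ˣ} (hy₀ : IsDual χ₂ ψ y₀) (y : ℚ_[p]ˣ) :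
    (IsDual χ₂ ψ y → newW hψ h₁ h₂ (aMat y * kOne) =
      χ₁.ext (p * y) * ((√(p : ℝ) : ℝ) : ℂ) * newW hψ h₁ h₂ 1) ∧
    (¬ IsDual χ₂ ψ y → newW hψ h₁ h₂ (aMat y * kOne) = 0) := by
  have hp := cast_p_pos (p := p)
  have hp0 := cast_p_ne_zero (p := p)
  have e : aMat y * kOne = aMat (y * Units.mk0 (p : ℚ_[p]) hp0) * lMat p := by
    rw [kOne_eq, aMat_mul, mul_assoc]
  have e1 : -((y * Units.mk0 (p : ℚ_[p]) hp0 : ℚ_[p]ˣ) : ℚ_[p]) / p = -y := by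
    rw [Units.val_mul, Units.val_mk0]
    field_simp
  constructor
  · intro hy
    have hn : ‖((y * Units.mk0 (p : ℚ_[p]) hp0 : ℚ_[p]ˣ) : ℚ_[p])‖ = p := by
      rw [Units.val_mul, Units.val_mk0, norm_mul, hy.1, Padic.norm_p]
      field_simp
    have e2 : χ₁.ext (-((y * Units.mk0 (p : ℚ_[p]) hp0 : ℚ_[p]ˣ) : ℚ_[p])) = χ₁.ext (p * y) := by
      refine h₁.ext_congr ?_
      rw [norm_neg, Units.val_mul, Units.val_mk0, mul_comm]
    have e3 : χ₁.ext (-1) = 1 := h₁.ext_eq_one (by simp)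
    -- Both values are computed with `y` itself as the dual element, so the same factor `phase χ₁ χ₂
    -- ψ (-y)` times `p` occurs on both sides.
    rw [e, newW_aMat_mul_lMat hψ h₁ h₂ hy, if_pos (norm_neg_div_add_self y), e1, hn, e2,
      ← aMat_one, newW_aMat hψ h₁ h₂ hy, if_pos (by simp)]
    simp [e3]
  · intro hy
    rw [e, newW_aMat_mul_lMat hψ h₁ h₂ hy₀, e1, if_neg]
    rw [hy₀.iff_norm_sub_le hψ] at hy
    rwa [neg_add_eq_sub]

end unramified

/-! ### Twisting and the case of unramified `χ₂` -/

lemma IsTrivialMod.eventually_det {η : QuasiChar p} {n : ℕ} (h : IsTrivialMod η n) (hn : n ≠ 0) :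
    ∀ᶠ k in 𝓝 (1 : G p), η (GeneralLinearGroup.det k) = 1 := by
  have hdet : Continuous fun g : G p => g.1.det := by
    simp only [det_eq]
    exact ((continuous_entry 0 0).mul (continuous_entry 1 1)).sub
      ((continuous_entry 0 1).mul (continuous_entry 1 0))
  have := hdet.continuousAt (x := 1) |>.eventually
    (Metric.closedBall_mem_nhds _ (zpow_pos (cast_p_pos (p := p)) (-(n : ℤ))))
  filter_upwards [this] with k hk
  have hk' : ‖k.1.det - 1‖ ≤ (p : ℝ) ^ (-(n : ℤ)) := by simpa [dist_eq_norm] using hk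
  exact h _ (norm_eq_one_of_sub_one hn hk') hk'

section twisting

variable {χ₁' χ₂' η : QuasiChar p} {n : ℕ}

/-- Multiplication by `η ∘ det`, from the principal series of `(χ₁', χ₂')` to that of
`(η χ₁', η χ₂')`. -/
def twistMap (hη : IsTrivialMod η n) (hn : n ≠ 0) (e₁ : ∀ a, χ₁ a = η a * χ₁' a)
    (e₂ : ∀ a, χ₂ a = η a * χ₂' a) :
    principalSeriesSpace χ₁' χ₂' →ₗ[ℂ] principalSeriesSpace χ₁ χ₂ where
  toFun f := ⟨fun g => (η (GeneralLinearGroup.det g) : ℂ) * f.1 g, by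
    refine ⟨fun a x d g => ?_, ?_⟩
    · have hd : GeneralLinearGroup.det (bMat a x d) = a * d := Units.ext (det_bMat a d x)
      beta_reduce
      rw [principalSeries_bMat_mul, e₁, e₂, map_mul, hd]
      simp only [map_mul, Units.val_mul]
      ring
    · obtain ⟨U, hU, hf⟩ := f.2.2
      let K : Subgroup (G p) := ((η : ℚ_[p]ˣ →* ℂˣ).comp GeneralLinearGroup.det).ker
      have hK : IsOpen (K : Set (G p)) :=
        K.isOpen_of_mem_nhds (g := 1) (hη.eventually_det hn)
      refine ⟨U ⊓ K, hU.inter hK, fun g k hk => ?_⟩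
      have hk2 : η (GeneralLinearGroup.det k) = 1 := hk.2
      beta_reduce
      rw [hf g k hk.1, map_mul, map_mul, hk2, mul_one]⟩
  map_add' f f' := by
    ext g
    exact mul_add _ _ _
  map_smul' c f := by
    ext g
    exact mul_left_comm _ _ _

lemma twistMap_apply (hη : IsTrivialMod η n) (hn : n ≠ 0) (e₁ : ∀ a, χ₁ a = η a * χ₁' a)
    (e₂ : ∀ a, χ₂ a = η a * χ₂' a) (f : principalSeriesSpace χ₁' χ₂') (g : G p) :
    (twistMap hη hn e₁ e₂ f).1 g = (η (GeneralLinearGroup.det g) : ℂ) * f.1 g := rfl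

lemma principalSeries_twistMap (hη : IsTrivialMod η n) (hn : n ≠ 0)
    (e₁ : ∀ a, χ₁ a = η a * χ₁' a) (e₂ : ∀ a, χ₂ a = η a * χ₂' a) (g : G p)
    (f : principalSeriesSpace χ₁' χ₂') :
    principalSeries χ₁ χ₂ g (twistMap hη hn e₁ e₂ f) =
      (η (GeneralLinearGroup.det g) : ℂ) • twistMap hη hn e₁ e₂ (principalSeries χ₁' χ₂' g f) := by
  ext h
  change (η (GeneralLinearGroup.det (h * g)) : ℂ) * f.1 (h * g) =
    (η (GeneralLinearGroup.det g) : ℂ) * ((η (GeneralLinearGroup.det h) : ℂ) * f.1 (h * g))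
  rw [map_mul, map_mul, Units.val_mul]
  ring

end twisting

lemma IsTrivialMod.inv {χ : QuasiChar p} {n : ℕ} (h : IsTrivialMod χ n) : IsTrivialMod χ⁻¹ n :=
  fun u hu hu1 => by
    change (χ u)⁻¹ = 1
    rw [h u hu hu1, inv_one]

lemma IsTrivialMod.mul {χ χ' : QuasiChar p} {n : ℕ} (h : IsTrivialMod χ n)
    (h' : IsTrivialMod χ' n) : IsTrivialMod (χ * χ') n := fun u hu hu1 => by
  change χ u * χ' u = 1
  rw [h u hu hu1, h' u hu hu1, mul_one]

/-- If both characters are tamely ramified, some twist has conductor at most `p`. -/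
lemma exists_conductor_twist_le_one (h₁ : IsTrivialMod χ₁ 1) (h₂ : IsTrivialMod χ₂ 1) :
    ∃ η : QuasiChar p, conductor (twist (principalSeries χ₁ χ₂) η) ≤ 1 := by
  have hun : IsUnramifiedChar (1 : QuasiChar p) := fun _ _ => rfl
  have h2 : IsTrivialMod (χ₂ * χ₁⁻¹) 1 := h₂.mul h₁.inv
  have e₁ (a) : χ₁ a = χ₁ a * (1 : QuasiChar p) a := (mul_one _).symm
  have e₂ (a) : χ₂ a = χ₁ a * (χ₂ * χ₁⁻¹) a := by
    change χ₂ a = χ₁ a * (χ₂ a * (χ₁ a)⁻¹)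
    rw [mul_comm, inv_mul_cancel_right]
  -- After the twist the representation is the principal series of `(1, χ₂ χ₁⁻¹)`, which has a
  -- vector of level `p` supported on `B I₁`. Its image under multiplication by `χ₁ ∘ det` is the
  -- witness.
  refine ⟨χ₁⁻¹, conductor_le
    (v := twistMap h₁ one_ne_zero e₁ e₂ (levelVec one_ne_zero hun h2)) ?_ ?_⟩
  · intro k hk
    rw [twist_apply, principalSeries_twistMap, levelVec_mem one_ne_zero hun h2 k hk, smul_smul]
    have h0 : ((χ₁⁻¹ : QuasiChar p) (GeneralLinearGroup.det k) : ℂ) *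
        χ₁ (GeneralLinearGroup.det k) = 1 := Units.inv_mul _
    rw [h0, one_smul]
  · intro h0
    have := twistMap_apply h₁ one_ne_zero e₁ e₂ (levelVec one_ne_zero hun h2) 1
    rw [h0, levelVec_apply_one] at this
    simp at this

end Newvectors

/-! ### The Atkin–Lehner operator, unramified `χ₂`, and the twist-minimal case -/

section TwistMinimal

open QuasiChar Topology Filter

variable {χ₁ χ₂ : QuasiChar p} {ψ : AddChar ℚ_[p] Circle}

lemma not_isTrivialMod_inv {χ : QuasiChar p} {n : ℕ} (h : ¬ IsTrivialMod χ n) :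
    ¬ IsTrivialMod χ⁻¹ n := fun h' => h fun u hu hu1 => inv_eq_one.1 (h' u hu hu1)

lemma IsUnramifiedChar.inv {χ : QuasiChar p} (h : IsUnramifiedChar χ) :
    IsUnramifiedChar χ⁻¹ := fun u hu => by
  change (χ u)⁻¹ = 1
  rw [h u hu, inv_one]

lemma IsUnitaryChar.inv {χ : QuasiChar p} (h : IsUnitaryChar χ) : IsUnitaryChar χ⁻¹ := fun u => by
  change ‖((χ u)⁻¹ : ℂˣ).1‖ = 1
  rw [Units.val_inv_eq_inv_val, norm_inv, h u, inv_one]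

lemma IsUnitaryChar.mul {χ χ' : QuasiChar p} (h : IsUnitaryChar χ) (h' : IsUnitaryChar χ') :
    IsUnitaryChar (χ * χ') := fun u => by
  change ‖((χ u * χ' u : ℂˣ) : ℂ)‖ = 1
  rw [Units.val_mul, norm_mul, h u, h' u, one_mul]

/-- The unit `p⁻²`. -/
def invSq (p : ℕ) [Fact p.Prime] : ℚ_[p]ˣ := (Units.mk0 (p : ℚ_[p]) cast_p_ne_zero ^ 2)⁻¹

lemma invSq_val : (invSq p : ℚ_[p]) = ((p : ℚ_[p]) ^ 2)⁻¹ := by simp [invSq]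

lemma norm_invSq : ‖(invSq p : ℚ_[p])‖ = (p : ℝ) ^ (2 : ℤ) := by
  rw [invSq_val, norm_inv, norm_pow, Padic.norm_p, inv_pow, inv_inv]
  norm_cast

/-- The inverse `(0 p⁻²; 1 0)` of the Atkin–Lehner element `(0 1; p² 0)`. -/
def alMat (p : ℕ) [Fact p.Prime] : G p := aMat (invSq p) * wMat

@[simp] lemma alMat_zero_zero : alMat p 0 0 = 0 := by simp [alMat, mul_entry, aMat]
@[simp] lemma alMat_zero_one : alMat p 0 1 = invSq p := by simp [alMat, mul_entry, aMat]
@[simp] lemma alMat_one_zero : alMat p 1 0 = 1 := by simp [alMat, mul_entry, aMat]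
@[simp] lemma alMat_one_one : alMat p 1 1 = 0 := by simp [alMat, mul_entry, aMat]

/-- Conjugation by the Atkin–Lehner element preserves `I₂` and swaps the diagonal entries. -/
lemma exists_mul_alMat {k : G p} (hk : k ∈ iwahori 2) :
    ∃ k' ∈ (iwahori 2 : Set (G p)), k * alMat p = alMat p * k' ∧ k' 1 1 = k 0 0 := by
  have hp0 := cast_p_ne_zero (p := p)
  have hp := cast_p_pos (p := p)
  have hq := (invSq p).ne_zero
  have hdet : (k 1 1 * k 0 0 - k 1 0 * invSq p * (k 0 1 / invSq p)) = k.1.det := by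
    rw [det_eq]
    field_simp
  let k' : G p := GeneralLinearGroup.mkOfDetNeZero
    !![k 1 1, k 1 0 * invSq p; k 0 1 / invSq p, k 0 0] (by
      rw [Matrix.det_fin_two_of, hdet]
      exact det_ne_zero k)
  have e00 : k' 0 0 = k 1 1 := rfl
  have e01 : k' 0 1 = k 1 0 * invSq p := rfl
  have e10 : k' 1 0 = k 0 1 / invSq p := rfl
  have e11 : k' 1 1 = k 0 0 := rfl
  have n10 : ‖k' 1 0‖ ≤ (p : ℝ) ^ (-((2 : ℕ) : ℤ)) := by
    rw [e10, norm_div, norm_invSq, _root_.zpow_neg, ← one_div]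
    exact div_le_div_of_nonneg_right (hk.1.1 0 1) (by positivity)
  have n01 : ‖k' 0 1‖ ≤ 1 := by
    rw [e01, norm_mul, norm_invSq]
    calc _ ≤ (p : ℝ) ^ (-((2 : ℕ) : ℤ)) * (p : ℝ) ^ (2 : ℤ) := by
          gcongr
          exact hk.2
      _ = 1 := by rw [← zpow_add₀ hp.ne']; simp
  refine ⟨k', ⟨⟨fun i j => ?_, ?_⟩, n10⟩, ?_, e11⟩
  · fin_cases i <;> fin_cases j
    · exact hk.1.1 1 1
    · exact n01
    · exact n10.trans (zpow_le_one_of_nonpos₀ one_lt_cast_p.le (by simp))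
    · exact hk.1.1 0 0
  · rw [det_eq, e00, e01, e10, e11, hdet]
    exact hk.1.2
  · refine ext_entries ?_ ?_ ?_ ?_ <;> simp [mul_entry, e00, e01, e10, e11] <;> field_simp

section ramified

variable (hψ : IsUnramifiedAddChar ψ) (h₁ : IsTrivialMod χ₁ 2) (h₂ : IsUnramifiedChar χ₂)

/-- The vector of level `p ^ 2` obtained by the Atkin–Lehner operator. -/
def alVec : principalSeriesSpace χ₁ χ₂ :=
  principalSeries χ₁ χ₂ (alMat p)
    (twistMap (χ₁' := χ₂⁻¹) (χ₂' := χ₁⁻¹) (h₁.mul (h₂.isTrivialMod 2)) two_ne_zero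
      (fun a => (mul_inv_cancel_right (χ₁ a) (χ₂ a)).symm)
      (fun a => by
        change χ₂ a = χ₁ a * χ₂ a * (χ₁ a)⁻¹
        rw [mul_comm (χ₁ a), mul_inv_cancel_right])
      (levelVec two_ne_zero h₂.inv h₁.inv))

lemma alVec_apply (g : G p) : (alVec h₁ h₂).1 g =
    ((χ₁ * χ₂) (GeneralLinearGroup.det (g * alMat p)) : ℂ) *
      levelFun χ₂⁻¹ χ₁⁻¹ 2 (g * alMat p) := rfl

/-- Moving `k` past `alMat p` makes `k₀₀` the relevant diagonal entry and produces the factor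
`χ₁⁻¹(k₀₀)`. It cancels against `(χ₁χ₂)(det k) = χ₁(k₀₀)`, which holds because `det k ≡ k₀₀` modulo
`p²` and `χ₂` is unramified. -/
lemma alVec_mem : alVec h₁ h₂ ∈ levelVectors (principalSeries χ₁ χ₂) 2 := by
  rw [mem_levelVectors_iff]
  intro k hk g
  have hkI := kOneSubgroup_subset_iwahori 2 hk
  obtain ⟨k', hk', he, h11⟩ := exists_mul_alMat hkI
  have hn := iwahori_one_one_norm two_ne_zero hk'
  rw [h11] at hn
  have h00 : k 0 0 ≠ 0 := norm_ne_zero_iff.1 (by rw [hn]; exact one_ne_zero)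
  have hdet : ((χ₁ * χ₂) (GeneralLinearGroup.det k) : ℂ) * (χ₁⁻¹ : QuasiChar p).ext (k 0 0) = 1 := by
    have e1 : χ₂ (GeneralLinearGroup.det k) = 1 := h₂ _ hk.1.2
    have e2 : χ₁.ext k.1.det = χ₁.ext (k 0 0) := by
      refine h₁.ext_congr two_ne_zero ?_
      rw [hn, mul_one, det_eq, show k 0 0 * k 1 1 - k 0 1 * k 1 0 - k 0 0 =
        k 0 0 * (k 1 1 - 1) - k 0 1 * k 1 0 by ring]
      refine norm_sub_le_of_le ?_ ?_
      · rw [norm_mul, hn, one_mul]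
        exact hk.2.2
      · rw [norm_mul]
        exact (mul_le_of_le_one_left (norm_nonneg _) (hk.1.1 0 1)).trans hk.2.1
    have e3 : ((χ₁ * χ₂) (GeneralLinearGroup.det k) : ℂ) = χ₁.ext (k 0 0) := by
      change ((χ₁ (GeneralLinearGroup.det k) * χ₂ (GeneralLinearGroup.det k) : ℂˣ) : ℂ) = _
      rw [e1, mul_one, ← e2, ← ext_coe]
      rfl
    rw [e3, ← Units.val_mk0 h00, ext_coe, ext_coe]
    exact Units.mul_inv _
  rw [alVec_apply, alVec_apply, mul_assoc g k, he, ← mul_assoc g,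
    levelFun_mul_iwahori two_ne_zero h₂.inv h₁.inv _ hk', h11, mul_assoc g, ← he, ← mul_assoc g]
  have e4 : ((χ₁ * χ₂) (GeneralLinearGroup.det (g * k * alMat p)) : ℂ) =
      ((χ₁ * χ₂) (GeneralLinearGroup.det (g * alMat p)) : ℂ) *
        ((χ₁ * χ₂) (GeneralLinearGroup.det k) : ℂ) := by
    simp only [map_mul, Units.val_mul]
    ring
  rw [e4]
  linear_combination (((χ₁ * χ₂) (GeneralLinearGroup.det (g * alMat p)) : ℂ) *
    levelFun χ₂⁻¹ χ₁⁻¹ 2 (g * alMat p)) * hdet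

/-- The Whittaker functional corresponding to the Jacquet integral for `(χ₂⁻¹, χ₁⁻¹)`. -/
def alFunctional : principalSeriesSpace χ₁ χ₂ →ₗ[ℂ] ℂ :=
  jacquetLimit (χ₁ := χ₂⁻¹) (χ₂ := χ₁⁻¹) hψ ∘ₗ
    twistMap (η := (χ₁ * χ₂)⁻¹) (h₁.mul (h₂.isTrivialMod 2)).inv two_ne_zero
      (fun a => by
        change (χ₂ a)⁻¹ = (χ₁ a * χ₂ a)⁻¹ * χ₁ a
        rw [mul_comm (χ₁ a), mul_inv, inv_mul_cancel_right])
      (fun a => by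
        change (χ₁ a)⁻¹ = (χ₁ a * χ₂ a)⁻¹ * χ₂ a
        rw [mul_inv, inv_mul_cancel_right])

lemma alFunctional_nMat (x : ℚ_[p]) (v : principalSeriesSpace χ₁ χ₂) :
    alFunctional hψ h₁ h₂ (principalSeries χ₁ χ₂ (nMat x) v) = ψ x * alFunctional hψ h₁ h₂ v := by
  have hd : GeneralLinearGroup.det (nMat x) = 1 := Units.ext (det_nMat x)
  rw [alFunctional, LinearMap.comp_apply, LinearMap.comp_apply, ← jacquetLimit_nMat hψ,
    principalSeries_twistMap, hd, map_one, Units.val_one, one_smul]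

/-- The twist in the functional undoes the twist in the vector up to a character value at `det (g *
alMat p)`, which has modulus one for unitary characters. So sizes reduce to those of `newW` for
`(χ₂⁻¹, χ₁⁻¹)`. -/
lemma whittakerFunction_alVec (g : G p) :
    whittakerFunction (principalSeries χ₁ χ₂) (alFunctional hψ h₁ h₂) (alVec h₁ h₂) g =
      ((χ₁ * χ₂) (GeneralLinearGroup.det (g * alMat p)) : ℂ) *
        newW hψ h₂.inv h₁.inv (g * alMat p) := by
  rw [whittakerFunction, newW, whittakerFunction, ← smul_eq_mul, ← map_smul, alFunctional,
    LinearMap.comp_apply]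
  congr 1
  ext h
  change (((χ₁ * χ₂) (GeneralLinearGroup.det h))⁻¹ : ℂˣ).1 *
    (((χ₁ * χ₂) (GeneralLinearGroup.det (h * g * alMat p)) : ℂ) *
      levelFun χ₂⁻¹ χ₁⁻¹ 2 (h * g * alMat p)) =
    ((χ₁ * χ₂) (GeneralLinearGroup.det (g * alMat p)) : ℂ) *
      levelFun χ₂⁻¹ χ₁⁻¹ 2 (h * (g * alMat p))
  rw [mul_assoc h, map_mul _ h, map_mul _ (GeneralLinearGroup.det h), Units.val_mul,
    mul_assoc (((χ₁ * χ₂) (GeneralLinearGroup.det h) : ℂˣ) : ℂ), Units.inv_mul_cancel_left]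

include hψ h₁ h₂ in
-- Translation by `alMat p` does not change the supremum of `|newW|`, and the value at the
-- translated base point still has modulus `p⁻¹`. It remains to see that the translated maximum lies
-- in `B k₁ I₂`.
lemma isExtremalNewvector_of_unramified_right (h : ¬ IsTrivialMod χ₁ 1) (hu₁ : IsUnitaryChar χ₁)
    (hu₂ : IsUnitaryChar χ₂) (hcond : conductor (principalSeries χ₁ χ₂) = 2) :
    ∃ W, IsExtremalNewvector (principalSeries χ₁ χ₂) ψ W := by
  obtain ⟨y, hy⟩ := exists_isDual hψ h₁.inv (not_isTrivialMod_inv h)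
  set W := whittakerFunction (principalSeries χ₁ χ₂) (alFunctional hψ h₁ h₂) (alVec h₁ h₂) with hW
  have hnorm (g : G p) : ‖W g‖ = ‖newW hψ h₂.inv h₁.inv (g * alMat p)‖ := by
    rw [hW, whittakerFunction_alVec, norm_mul, (hu₁.mul hu₂) _, one_mul]
  have hone : ‖W 1‖ = (p : ℝ)⁻¹ := by
    rw [hnorm, one_mul, alMat, norm_newW_aMat_mul_wMat hψ h₂.inv h₁.inv hu₁.inv norm_invSq]
  have h1 : W 1 ≠ 0 := by
    rw [← norm_ne_zero_iff, hone]
    exact inv_ne_zero cast_p_pos.ne'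
  have hvanish {v : principalSeriesSpace χ₁ χ₂}
      (hv : v ∈ levelVectors (principalSeries χ₁ χ₂) 2) : v.1 1 = 0 ∧ v.1 (lMat p) = 0 := by
    constructor
    · by_contra h0
      exact h ((characters_of_apply_one_ne_zero hv h0).1.isTrivialMod 1)
    · by_contra h0
      exact h (characters_of_apply_lMat_ne_zero hv h0).1
  have hF := alVec_mem h₁ h₂
  have hFw : (alVec h₁ h₂).1 wMat ≠ 0 := by
    intro h0
    have hz : alVec h₁ h₂ = 0 := by
      refine ext_of_level_two hF (fun k _ => map_zero _) ?_ ?_ ?_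
      · simp [(hvanish hF).1]
      · simp [(hvanish hF).2]
      · simp [h0]
    apply h1
    rw [hW, hz]
    simp [whittakerFunction]
  have hspan : ∀ v ∈ levelVectors (principalSeries χ₁ χ₂) 2, ∃ a : ℂ, v = a • alVec h₁ h₂ := by
    intro v hv
    refine ⟨v.1 wMat / (alVec h₁ h₂).1 wMat,
      ext_of_level_two hv (smul_mem_levelVectors _ hF) ?_ ?_ ?_⟩
    · simp [(hvanish hv).1, (hvanish hF).1]
    · simp [(hvanish hv).2, (hvanish hF).2]
    · simp [hFw]
  obtain ⟨hnew, huniq⟩ := whittakerNewvector_of_span hψ hcond (alFunctional_nMat hψ h₁ h₂) hF hspan h1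
  refine ⟨W, hnew, huniq, h1, fun g => ?_, ?_⟩
  · rw [hone, hnorm]
    exact norm_newW_le hψ h₂.inv h₁.inv hu₂.inv hu₁.inv hy _
  · obtain ⟨x, hx⟩ : ∃ x, x = y * Units.mk0 (p : ℚ_[p]) cast_p_ne_zero := ⟨_, rfl⟩
    set g := aMat x * lMat p * (alMat p)⁻¹ with hg
    have hgal : g * alMat p = aMat x * lMat p := inv_mul_cancel_right _ _
    have e10 := congrArg (fun m : G p => m 1 1) hgal
    have e11 := congrArg (fun m : G p => m 1 0) hgal
    have hq := (invSq p).ne_zero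
    simp only [mul_entry, alMat_zero_zero, alMat_zero_one, alMat_one_zero, alMat_one_one, aMat,
      bMat_one_zero, bMat_one_one, lMat_zero_one, lMat_one_one, lMat_zero_zero, lMat_one_zero,
      mul_zero, Units.val_one, one_mul, add_zero, zero_add, mul_one] at e10 e11
    -- The bottom row of `g` is `(p², p)`, with ratio `p`. Hence `g` lies in `B l(p)`: the
    -- Atkin–Lehner element preserves the middle coset.
    have e10' : g 1 0 = (p : ℚ_[p]) * p * (1 : ℚ_[p]ˣ) := by
      rw [eq_inv_of_mul_eq_one_left e10, invSq_val, inv_inv, Units.val_one]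
      ring
    obtain ⟨A, X, hA⟩ := eq_bMat_mul_lMat_mul_aMat
      (d := Units.mk0 (p : ℚ_[p]) cast_p_ne_zero) (u := 1) (x := p) g e11 e10'
    refine ⟨g, ?_, ?_⟩
    · rw [hA, aMat_one]
      exact bMat_mul_lMat_mul_mem_doubleCoset _ _ _ (one_mem_iwahori 2)
    · rw [hone, hnorm, hgal, hx, norm_newW_aMat_mul_lMat hψ h₂.inv h₁.inv hu₂.inv hu₁.inv hy
        (norm_neg_div_add_self y)]

end ramified

/-! ### Twist-minimal principal series of conductor `p ^ 2` -/

/-- A nonzero vector of level `p²` vanishes at `l(p)` by twist-minimality, so it is nonzero at `1`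
or at `w`. This decides which character is unramified, and the other is not trivial modulo `p`,
again by twist-minimality. -/
lemma exists_isExtremalNewvector (hψ : IsUnramifiedAddChar ψ) (hu₁ : IsUnitaryChar χ₁)
    (hu₂ : IsUnitaryChar χ₂) (hmin : IsTwistMinimal (principalSeries χ₁ χ₂))
    (hcond : conductor (principalSeries χ₁ χ₂) = 2) :
    ∃ W, IsExtremalNewvector (principalSeries χ₁ χ₂) ψ W := by
  have htame (h : IsTrivialMod χ₁ 1 ∧ IsTrivialMod χ₂ 1) : False := by
    obtain ⟨η, hη⟩ := exists_conductor_twist_le_one h.1 h.2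
    have := (hmin η).trans hη
    omega
  obtain ⟨v, hv, hv0⟩ : ∃ v ∈ levelVectors (principalSeries χ₁ χ₂) 2, v ≠ 0 := by
    have hne : {r : ℕ | ∃ v ∈ levelVectors (principalSeries χ₁ χ₂) r, v ≠ 0}.Nonempty := by
      by_contra h0
      rw [Set.not_nonempty_iff_eq_empty] at h0
      rw [conductor, h0, Nat.sInf_empty] at hcond
      omega
    have := Nat.sInf_mem hne
    rwa [show sInf {r : ℕ | ∃ v ∈ levelVectors (principalSeries χ₁ χ₂) r, v ≠ 0} = 2
      from hcond] at this
  have hl : v.1 (lMat p) = 0 := by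
    by_contra hl
    exact htame (characters_of_apply_lMat_ne_zero hv hl)
  by_cases h1 : v.1 1 = 0
  · have hw : v.1 wMat ≠ 0 := fun hw => hv0 (ext_of_level_two hv (fun k _ => map_zero _)
      (by simp [h1]) (by simp [hl]) (by simp [hw]))
    obtain ⟨h₁, h₂⟩ := characters_of_apply_wMat_ne_zero hv hw
    exact isExtremalNewvector_of_unramified_right hψ h₁ h₂
      (fun h => htame ⟨h, h₂.isTrivialMod 1⟩) hu₁ hu₂ hcond
  · obtain ⟨h₁, h₂⟩ := characters_of_apply_one_ne_zero hv h1
    exact ⟨_, isExtremalNewvector_newW hψ h₁ h₂ (fun h => htame ⟨h₁.isTrivialMod 1, h⟩) hu₁ hu₂⟩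

end TwistMinimal

end GLTwo

end

/-! ### The theorem -/

theorem proposition4 (p : ℕ) [Fact p.Prime] (ψ : AddChar ℚ_[p] Circle)
    (hψ : GLTwo.IsUnramifiedAddChar ψ) :
    -- twist-minimal unitary principal series of conductor `p ^ 2`
    (∀ {V : Type*} [AddCommGroup V] [Module ℂ V] (π : Representation ℂ (GLTwo.G p) V),
      GLTwo.IsUnitaryPrincipalSeries π → GLTwo.IsTwistMinimal π → GLTwo.conductor π = 2 →
        (∃! W : GLTwo.G p → ℂ, GLTwo.IsNormalizedNewvector π ψ W) ∧
        (∀ W : GLTwo.G p → ℂ, GLTwo.IsWhittakerNewvector π ψ W →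
          W 1 ≠ 0 ∧
          IsGreatest (Set.range fun g => ‖W g‖) (√(p : ℝ) * ‖W 1‖) ∧
          ∃ g ∈ GLTwo.doubleCoset (GLTwo.kOne : GLTwo.G p) 2, ‖W g‖ = √(p : ℝ) * ‖W 1‖) ∧
        IsGreatest (GLTwo.newvectorValues π ψ) √(p : ℝ) ∧
        GLTwo.localInvariant π ψ = √(p : ℝ)) ∧
    -- the same invariant in terms of the inducing characters
    (∀ χ₁ χ₂ : GLTwo.QuasiChar p, GLTwo.IsUnitaryChar χ₁ → GLTwo.IsUnitaryChar χ₂ →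
      GLTwo.IsUnramifiedChar χ₁ → GLTwo.charConductor χ₂ = 2 →
        IsGreatest (GLTwo.newvectorValues (GLTwo.principalSeries χ₁ χ₂) ψ) √(p : ℝ) ∧
        GLTwo.localInvariant (GLTwo.principalSeries χ₁ χ₂) ψ = √(p : ℝ)) ∧
    -- the values of the normalized newvector of `1 ⊞ χ` at `a(y) k₁`
    (∀ χ : GLTwo.QuasiChar p, GLTwo.IsUnitaryChar χ → GLTwo.charConductor χ = 2 →
      (∃ y : ℚ_[p]ˣ, GLTwo.IsDual χ ψ y) ∧
      (∃! W : GLTwo.G p → ℂ, GLTwo.IsNormalizedNewvector (GLTwo.principalSeries 1 χ) ψ W) ∧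
      ∀ W : GLTwo.G p → ℂ, GLTwo.IsNormalizedNewvector (GLTwo.principalSeries 1 χ) ψ W →
        ∀ y : ℚ_[p]ˣ,
          (GLTwo.IsDual χ ψ y → W (GLTwo.aMat y * GLTwo.kOne) = ((√(p : ℝ) : ℝ) : ℂ)) ∧
          (¬ GLTwo.IsDual χ ψ y → W (GLTwo.aMat y * GLTwo.kOne) = 0)) := by
  have hramified {χ : GLTwo.QuasiChar p} (h : GLTwo.charConductor χ = 2) :
      GLTwo.IsTrivialMod χ 2 ∧ ¬ GLTwo.IsTrivialMod χ 1 :=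
    ⟨GLTwo.isTrivialMod_of_charConductor h two_ne_zero,
      GLTwo.not_isTrivialMod_of_lt_charConductor (by omega)⟩
  refine ⟨fun π hπ hmin hcond => ?_, fun χ₁ χ₂ hu₁ hu₂ h₁ hc => ?_, fun χ hu hc => ?_⟩
  · obtain ⟨χ₁, χ₂, hu₁, hu₂, ⟨e⟩⟩ := hπ
    have he (g v) : e.toLinearEquiv (π g v) =
        GLTwo.principalSeries χ₁ χ₂ g (e.toLinearEquiv v) :=
      LinearMap.congr_fun (e.isIntertwining' g) v
    obtain ⟨W, hW⟩ := GLTwo.exists_isExtremalNewvector hψ hu₁ hu₂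
      (GLTwo.isTwistMinimal_congr _ he hmin) ((GLTwo.conductor_congr _ he).symm.trans hcond)
    have hE := hW.map _ he
    refine ⟨hE.existsUnique_normalized, fun W' hW' => ?_, hE.isGreatest_newvectorValues,
      hE.localInvariant_eq⟩
    have hE' := hE.of_isWhittakerNewvector hW'
    exact ⟨hE'.apply_one_ne_zero, hE'.isGreatest_range, hE'.exists_norm_eq⟩
  · obtain ⟨h2, h1⟩ := hramified hc
    have hE := GLTwo.isExtremalNewvector_newW hψ h₁ h2 h1 hu₁ hu₂
    exact ⟨hE.isGreatest_newvectorValues, hE.localInvariant_eq⟩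
  · obtain ⟨h2, h1⟩ := hramified hc
    have hun : GLTwo.IsUnramifiedChar (1 : GLTwo.QuasiChar p) := fun _ _ => rfl
    have hu1 : GLTwo.IsUnitaryChar (1 : GLTwo.QuasiChar p) := fun _ => norm_one
    obtain ⟨y₀, hy₀⟩ := GLTwo.exists_isDual hψ h2 h1
    refine ⟨⟨y₀, hy₀⟩,
      (GLTwo.isExtremalNewvector_newW hψ hun h2 h1 hu1 hu).existsUnique_normalized, ?_⟩
    rintro W ⟨hW, hW1⟩ y
    -- `W` is `c • newW` with `c · newW(1) = 1`, and for `χ₁ = 1` the factor `χ₁(p y)` in the value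
    -- at `a(y) k₁` is `1`. So exactly `p^(1/2)` remains, not just its modulus.
    obtain ⟨c, -, rfl⟩ := (GLTwo.newW_unique hψ hun h2 h1).2 W hW
    obtain ⟨hd, hnd⟩ := GLTwo.newW_aMat_mul_kOne hψ hun h2 hy₀ y
    simp only [Pi.smul_apply, smul_eq_mul] at hW1 ⊢
    refine ⟨fun hy => ?_, fun hy => by rw [hnd hy, mul_zero]⟩
    rw [hd hy, GLTwo.QuasiChar.ext_one_char (mul_ne_zero GLTwo.cast_p_ne_zero y.ne_zero), one_mul,
      mul_left_comm, hW1, mul_one]
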